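/- Let $n\ge 1$. For every prime power $p^v$ ($v\ge 1$) let $A_{p^v}\subset(\mathbf Z/p^v\mathbf Z)^n$ be an arbitrary, possibly empty, set. For a positive integer $q$ let $A_q\subset(\mathbf Z/q\mathbf Z)^n$ be the set of $x \bmod q$ such that $x \bmod p^v\in A_{p^v}$ for every prime power $p^v$ exactly dividing $q$, and put $\rho(q)=|A_q|$ (so $\rho(1)=1$). Let $\mathcal Q=\{q\ge 1:\rho(q)\ge 1\}$; let $\mathcal Q_k$ be the set of $q\in\mathcal Q$ with exactly $k$ distinct prime factors, and let $\mathcal Q(x)$, $\mathcal Q_k(x)$ be the sets of elements $\le x$ of $\mathcal Q$, $\mathcal Q_k$. For a prime $p\in\mathcal Q$ let $\lambda(p)=\max_H|H\cap A_p|$, where $H$ runs over the affine hyperplanes $\{x: h_1x_1+\cdots+h_nx_n=a\}$ of $(\mathbf Z/p\mathbf Z)^n$ with $(h_1,\dots,h_n)\ne 0$. For $q\in\mathcal Q$ let $\Delta_q=\frac1{\rho(q)}\sum_{a\in A_q}\delta_{\{a/q\}}$, a probability measure on $(\mathbf R/\mathbf Z)^n$, and let $\mathrm{disc}(\Delta_q)=\sup_B|\Delta_q(B)-\mathrm{vol}(B)|$,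 where $B$ runs over the images in $(\mathbf R/\mathbf Z)^n$ of products of $n$ closed intervals of length at most $1$. Suppose that there are constants $\alpha>0$ and $x_0\ge 2$ such that $\sum_{p\le y,\ \rho(p)\ge 1}\log p\ge\alpha y$ for all $y\ge x_0$. Then there are a constant $C(n)>0$ depending only on $n$ and a threshold $X(\alpha,x_0)$ depending only on $\alpha$ and $x_0$ such that the following holds for all $x\ge X(\alpha,x_0)$. Let $\delta>0$ satisfy $1/\log\log x\le\delta\le 1/e$ and $$\sum_{p\in\mathcal Q(x)}\frac1p\,\frac{\lambda(p)}{\rho(p)}\le\delta\sum_{p\in\mathcal Q(x)}\frac1p ,$$ where $p$ runs over primes. Then for every integer $k$ with $2\le k\le\alpha\delta\log\log x$ the set $\mathcal Q_k(x)$ is non-empty and $$\frac1{|\mathcal Q_k(x)|}\sum_{q\in\mathcal Q_k(x)}\mathrm{disc}(\Delta_q)\le\frac{C(n)}{\alpha}\,\delta^{(k-1)/10}.$$ -/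

import Mathlib

open MeasureTheory
open scoped ENNReal

namespace CRTSets

/-- A choice of a set `A m ⊆ (ℤ/mℤ)^n` for every `m`. Only the sets `A (p ^ v)` with `p` prime and
`v ≥ 1` are ever used; they are arbitrary and unrelated to each other (and may be empty). -/
abbrev LocalSets (n : ℕ) : Type := (m : ℕ) → Set (Fin n → ZMod m)

variable {n : ℕ}

/-- The set `A_q ⊆ (ℤ/qℤ)^n` defined by the Chinese Remainder Theorem: the `x mod q` such that
`x mod p ^ v` lies in `A (p ^ v)` for every prime power `p ^ v` exactly dividing `q`. -/
def residueSet (A : LocalSets n) (q : ℕ) : Set (Fin n → ZMod q) :=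
  {x | ∀ (p v : ℕ) (_ : p.Prime) (_ : 1 ≤ v) (h : p ^ v ∣ q) (_ : ¬ p ^ (v + 1) ∣ q),
    (fun i => ZMod.castHom h (ZMod (p ^ v)) (x i)) ∈ A (p ^ v)}

/-- At a prime power the set `A_q` is the given one. -/
theorem residueSet_prime_pow (A : LocalSets n) {p v : ℕ} (hp : p.Prime) (hv : 1 ≤ v) :
    residueSet A (p ^ v) = A (p ^ v) := by
  ext x
  constructor
  · intro hx
    have h := hx p v hp hv dvd_rfl
      (fun h => absurd ((Nat.pow_dvd_pow_iff_le_right hp.one_lt).1 h) (by omega))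
    simpa using h
  · intro hx r w hr hw h h'
    obtain rfl : r = p :=
      (Nat.prime_dvd_prime_iff_eq hr hp).1
        (hr.dvd_of_dvd_pow ((dvd_pow_self r (by omega)).trans h))
    have h1 : w ≤ v := (Nat.pow_dvd_pow_iff_le_right hp.one_lt).1 h
    have h2 : ¬ w + 1 ≤ v := fun hle => h' ((Nat.pow_dvd_pow_iff_le_right hp.one_lt).2 hle)
    obtain rfl : w = v := by omega
    simpa using hx

/-- `ρ(q) = |A_q|`. -/
noncomputable def rho (A : LocalSets n) (q : ℕ) : ℕ := (residueSet A q).ncard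

/-- `𝒬(x)`: the positive integers `q ≤ x` with `ρ(q) ≥ 1`. -/
noncomputable def moduli (A : LocalSets n) (x : ℝ) : Finset ℕ :=
  (Finset.Icc 1 ⌊x⌋₊).filter (fun q => 1 ≤ rho A q)

/-- `𝒬_k(x)`: the elements of `𝒬(x)` with exactly `k` distinct prime factors. -/
noncomputable def moduliWith (A : LocalSets n) (k : ℕ) (x : ℝ) : Finset ℕ :=
  (moduli A x).filter (fun q => q.primeFactors.card = k)

/-- The primes in `𝒬(x)`. -/
noncomputable def primeModuli (A : LocalSets n) (x : ℝ) : Finset ℕ :=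
  (moduli A x).filter Nat.Prime

/-- The primes `p` with `ρ(p) ≥ 1` satisfy `∑_{p ≤ x} log p ≥ α x` for all `x ≥ x₀`. -/
def ManyPrimes (A : LocalSets n) (α x₀ : ℝ) : Prop :=
  ∀ x : ℝ, x₀ ≤ x → α * x ≤ ∑ p ∈ primeModuli A x, Real.log p

/-- Affine hyperplanes `{x | h₁ x₁ + ⋯ + hₙ xₙ = a}` with `h ≠ 0` in `(ℤ/pℤ)^n`. -/
def IsAffineHyperplane {p : ℕ} (H : Set (Fin n → ZMod p)) : Prop :=
  ∃ h : Fin n → ZMod p, h ≠ 0 ∧ ∃ a : ZMod p, H = {x | ∑ i, h i * x i = a}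

/-- `λ(p)`: the maximal number of elements of `A_p` on an affine hyperplane. -/
noncomputable def lam (A : LocalSets n) (p : ℕ) : ℕ :=
  sSup {m : ℕ | ∃ H : Set (Fin n → ZMod p), IsAffineHyperplane H ∧ m = (H ∩ residueSet A p).ncard}

/-- The point `{a / q}` of `(ℝ/ℤ)^n` attached to `a ∈ (ℤ/qℤ)^n`. -/
noncomputable def fracPoint {q : ℕ} (a : Fin n → ZMod q) : Fin n → UnitAddCircle :=
  fun i => ((((a i).val : ℝ) / (q : ℝ) : ℝ) : UnitAddCircle)

/-- `Δ_q = ρ(q)⁻¹ ∑_{a ∈ A_q} δ_{{a / q}}`, a probability measure on `(ℝ/ℤ)^n` when `q ∈ 𝒬`. -/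
noncomputable def Delta (A : LocalSets n) (q : ℕ) : Measure (Fin n → UnitAddCircle) :=
  ((rho A q : ℝ≥0∞))⁻¹ •
    Measure.sum (fun a : residueSet A q => Measure.dirac (fracPoint (a : Fin n → ZMod q)))

/-- A box in `(ℝ/ℤ)^n`: the image of a product of closed intervals of length at most `1`. -/
def IsBox (B : Set (Fin n → UnitAddCircle)) : Prop :=
  ∃ a b : Fin n → ℝ, (∀ i, a i ≤ b i ∧ b i - a i ≤ 1) ∧
    B = (fun (t : Fin n → ℝ) (i : Fin n) => (t i : UnitAddCircle)) '' Set.Icc a b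

/-- The box discrepancy `sup_B |μ(B) - vol(B)|`. -/
noncomputable def disc (μ : Measure (Fin n → UnitAddCircle)) : ℝ :=
  sSup {d : ℝ | ∃ B : Set (Fin n → UnitAddCircle), IsBox B ∧
    d = |μ.real B - (volume : Measure (Fin n → UnitAddCircle)).real B|}

end CRTSets

/-! Discrepancy is converted into exponential sums. Fejér-kernel majorants of arcs, and of the
complementary arcs, bound disc(Δ_q) by a small cutoff error plus a weighted sum over nonzero integer
vectors h with |h_i| ≤ N of |W_h(q)|, where W_h(q) is the mean of e(h·a/q) over a in A_q
(`disc_Delta_le`). It remains to bound the average of |W_h(q)| over q in Q_k(x), uniformly in h ≠ 0.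

The sums W are only twisted multiplicative: for coprime r and s, W_h(rs) is the product of W_h(r)
with h multiplied by the inverse of s mod r, and W_h(s) with h multiplied by the inverse of r mod s
(`expSum_mul`). Nothing can be said about a single twist, so one averages over twists. Apart from
few exceptional q, write q = tP with P the largest prime factor, so that P ≥ q^(1/k), and let r be
the part of t made of prime powers at most z. Then |W_h(q)| is at most |W_h(r)| twisted by the
inverse of q/r. As P varies with t fixed, an upper bound of Brun–Titchmarsh type
(`card_primes_modEq_le`, from the Selberg sieve) shows that no reduced class mod r is hit too often.
So the sum over P is controlled by U(r), the sum of |W_h(r)| over all unit twists. Unlike W, the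
function U is genuinely multiplicative, and at a prime p not dividing h, Cauchy–Schwarz and
orthogonality give U(p) ≤ p·√(λ(p)/ρ(p)) (`unitSum_prime_le`).

Summing over t gives an elementary symmetric sum, so the total is at most about (kx/log
x)·M^(k-1)/(k-1)!. A second Cauchy–Schwarz, applied to the hypothesis on λ/ρ, gives M ≤ √δ·P(x) +
O(log log log x), where P(x) is the sum of 1/p over primes p ≤ x in Q (`sum_localFactor_le`). In the
other direction, products of k-1 small primes and one large prime show |Q_k(x)| ≥ (αx/(2 log
x))·d^(k-1)/(k-1)! with d close to P(x) (`le_card_moduliWith`). Since P(x) ≥ c·log log x and δ ≥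
1/log log x, the term √δ·P(x) dominates every additive error, and the ratio of the two bounds is
essentially k·δ^((k-1)/2)/α.

With δ = θ^10 and η = θ^(k-1), this ratio is spent as follows: some of the powers of θ absorb k and
the multiplicative errors, leaving η²; one η pays for the factor (log N)^n coming from the Fourier
weights with N about η^(-3); the other η is the asserted saving. -/

namespace CRTSets

/-! ### Elementary symmetric sums against powers of the first one. -/

section ElementarySymmetric

variable {ι : Type*} [DecidableEq ι]

/-- Counting pairs (subset of size `m + 1`, element of it). -/
theorem succ_mul_sum_powersetCard (s : Finset ι) (f : ι → ℝ) (m : ℕ) :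
    ((m : ℝ) + 1) * ∑ S ∈ s.powersetCard (m + 1), ∏ i ∈ S, f i =
      ∑ S ∈ s.powersetCard m, (∏ i ∈ S, f i) * ∑ i ∈ s \ S, f i := by
  have h1 : ((m : ℝ) + 1) * ∑ S ∈ s.powersetCard (m + 1), ∏ i ∈ S, f i =
      ∑ S ∈ s.powersetCard (m + 1), ∑ _j ∈ S, ∏ i ∈ S, f i := by
    rw [Finset.mul_sum]
    refine Finset.sum_congr rfl fun S hS => ?_
    rw [Finset.sum_const, (Finset.mem_powersetCard.1 hS).2]
    simp
  rw [h1]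
  simp_rw [Finset.mul_sum]
  rw [Finset.sum_sigma', Finset.sum_sigma']
  refine Finset.sum_bij' (fun a _ => ⟨a.1.erase a.2, a.2⟩) (fun b _ => ⟨insert b.2 b.1, b.2⟩)
    ?_ ?_ ?_ ?_ ?_
  · rintro ⟨S, j⟩ h
    simp only [Finset.mem_sigma, Finset.mem_powersetCard, Finset.mem_sdiff] at h ⊢
    obtain ⟨⟨hs, hc⟩, hj⟩ := h
    refine ⟨⟨(Finset.erase_subset _ _).trans hs, ?_⟩, hs hj, Finset.notMem_erase _ _⟩
    rw [Finset.card_erase_of_mem hj, hc]; rfl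
  · rintro ⟨S, j⟩ h
    simp only [Finset.mem_sigma, Finset.mem_powersetCard, Finset.mem_sdiff] at h ⊢
    obtain ⟨⟨hs, hc⟩, hj, hjS⟩ := h
    refine ⟨⟨Finset.insert_subset hj hs, ?_⟩, Finset.mem_insert_self _ _⟩
    rw [Finset.card_insert_of_notMem hjS, hc]
  · rintro ⟨S, j⟩ h
    simp only [Finset.mem_sigma] at h
    simp [Finset.insert_erase h.2]
  · rintro ⟨S, j⟩ h
    simp only [Finset.mem_sigma, Finset.mem_sdiff] at h
    simp [Finset.erase_insert h.2.2]
  · rintro ⟨S, j⟩ h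
    simp only [Finset.mem_sigma] at h
    simp [Finset.prod_erase_mul _ _ h.2]

/-- Induction on m: in the counting identity the inner sum over the complement of S is at most the
full sum. -/
theorem sum_powersetCard_prod_le (s : Finset ι) (f : ι → ℝ) (hf : ∀ i ∈ s, 0 ≤ f i) (m : ℕ) :
    ∑ S ∈ s.powersetCard m, ∏ i ∈ S, f i ≤ (∑ i ∈ s, f i) ^ m / m.factorial := by
  induction m with
  | zero => simp
  | succ m ih =>
    have hP : 0 ≤ ∑ i ∈ s, f i := Finset.sum_nonneg hf
    have key : ((m : ℝ) + 1) * ∑ S ∈ s.powersetCard (m + 1), ∏ i ∈ S, f i ≤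
        (∑ i ∈ s, f i) ^ m / m.factorial * ∑ i ∈ s, f i := by
      rw [succ_mul_sum_powersetCard]
      refine le_trans (Finset.sum_le_sum fun S hS => ?_)
        ((Finset.sum_mul _ _ _).symm.le.trans (mul_le_mul_of_nonneg_right ih hP))
      have hS' := (Finset.mem_powersetCard.1 hS).1
      refine mul_le_mul_of_nonneg_left ?_ (Finset.prod_nonneg fun i hi => hf i (hS' hi))
      exact Finset.sum_le_sum_of_subset_of_nonneg Finset.sdiff_subset fun i hi _ => hf i hi
    have hm : (0 : ℝ) < (m : ℝ) + 1 := by positivity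
    rw [Nat.factorial_succ, pow_succ, Nat.cast_mul, Nat.cast_succ]
    rw [← le_div_iff₀' hm] at key
    refine key.trans (le_of_eq ?_)
    field_simp

/-- The same induction from below: removing the chosen elements lowers the inner sum by at most E.
For reciprocals of at most k primes, E = 1 + log k will do. -/
theorem le_sum_powersetCard_prod (s : Finset ι) (f : ι → ℝ) (hf : ∀ i ∈ s, 0 ≤ f i) (E : ℝ)
    (hE : E ≤ ∑ i ∈ s, f i) (m : ℕ)
    (h : ∀ S ⊆ s, S.card ≤ m → ∑ i ∈ S, f i ≤ E) :
    (∑ i ∈ s, f i - E) ^ m / m.factorial ≤ ∑ S ∈ s.powersetCard m, ∏ i ∈ S, f i := by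
  induction m with
  | zero => simp
  | succ m ih =>
    have hP : 0 ≤ ∑ i ∈ s, f i - E := by linarith
    have ih' := ih fun S hS hc => h S hS (by omega)
    have key : (∑ i ∈ s, f i - E) ^ m / m.factorial * (∑ i ∈ s, f i - E) ≤
        ((m : ℝ) + 1) * ∑ S ∈ s.powersetCard (m + 1), ∏ i ∈ S, f i := by
      rw [succ_mul_sum_powersetCard]
      refine le_trans ((mul_le_mul_of_nonneg_right ih' hP).trans
        (Finset.sum_mul _ _ _).le) (Finset.sum_le_sum fun S hS => ?_)
      obtain ⟨hS', hc⟩ := Finset.mem_powersetCard.1 hS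
      refine mul_le_mul_of_nonneg_left ?_ (Finset.prod_nonneg fun i hi => hf i (hS' hi))
      have := h S hS' (by omega)
      have h2 := Finset.sum_sdiff (f := f) hS'
      linarith
    have hm : (0 : ℝ) < (m : ℝ) + 1 := by positivity
    rw [Nat.factorial_succ, pow_succ, Nat.cast_mul, Nat.cast_succ]
    rw [← div_le_iff₀' hm] at key
    refine (le_of_eq ?_).trans key
    field_simp

end ElementarySymmetric

/-- Among sets of positive integers of given size, the initial segment has the largest sum of
reciprocals. -/
theorem sum_inv_le_harmonic (S : Finset ℕ) (hS : ∀ p ∈ S, 0 < p) :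
    ∑ p ∈ S, 1 / (p : ℝ) ≤ (harmonic S.card : ℝ) := by
  induction S using Finset.induction_on_max with
  | empty => simp
  | insert a s hlt ih =>
    have has : a ∉ s := fun h => lt_irrefl _ (hlt a h)
    have ha : 0 < a := hS a (Finset.mem_insert_self _ _)
    rw [Finset.sum_insert has, Finset.card_insert_of_notMem has, harmonic_succ]
    push_cast
    have hc : s.card + 1 ≤ a := by
      have : s ⊆ Finset.Ico 1 a := fun p hp =>
        Finset.mem_Ico.2 ⟨hS p (Finset.mem_insert_of_mem hp), hlt p hp⟩
      have := Finset.card_le_card this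
      simp at this
      omega
    have h1 := ih fun p hp => hS p (Finset.mem_insert_of_mem hp)
    have h2 : 1 / (a : ℝ) ≤ ((s.card : ℝ) + 1)⁻¹ := by
      rw [one_div]
      apply inv_anti₀ (by positivity)
      exact_mod_cast hc
    linarith

theorem sum_inv_le_one_add_log (S : Finset ℕ) (hS : ∀ p ∈ S, 0 < p) {K : ℝ} (hK : 1 ≤ K)
    (h : (S.card : ℝ) ≤ K) :
    ∑ p ∈ S, 1 / (p : ℝ) ≤ 1 + Real.log K := by
  refine (sum_inv_le_harmonic S hS).trans ((harmonic_le_one_add_log _).trans ?_)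
  rcases Nat.eq_zero_or_pos S.card with h0 | h0
  · rw [h0]; simp [Real.log_nonneg hK]
  · have : (0 : ℝ) < S.card := by exact_mod_cast h0
    have := Real.log_le_log this h
    linarith

/-! ### Mertens-type bounds, above for all primes and below for the primes in Q. -/

section Primes

open Real Chebyshev

/-- Chebyshev's bound for θ at 2^(i+1): on the block, log p ≥ i·log 2 and p ≥ 2^i, so each term 1/p
is at most log p divided by i·log 2·2^i. -/
theorem sum_inv_primes_dyadic_block (i : ℕ) (hi : 1 ≤ i) :
    ∑ p ∈ (Finset.Ioc (2 ^ i) (2 ^ (i + 1))).filter Nat.Prime, 1 / (p : ℝ) ≤ 4 / i := by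
  have hi0 : (0 : ℝ) < i := by exact_mod_cast hi
  have hl2 : 0 < Real.log 2 := Real.log_pos (by norm_num)
  have hθ := theta_le_log4_mul_x (x := (2 : ℝ) ^ (i + 1)) (by positivity)
  have hfl : ⌊(2 : ℝ) ^ (i + 1)⌋₊ = 2 ^ (i + 1) := by
    have : ((2 : ℝ) ^ (i + 1)) = ((2 ^ (i + 1) : ℕ) : ℝ) := by push_cast; rfl
    rw [this, Nat.floor_natCast]
  have hlog4 : Real.log 4 = 2 * Real.log 2 := by
    rw [show (4 : ℝ) = 2 ^ 2 by norm_num, Real.log_pow]; norm_num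
  have h1 : ∑ p ∈ (Finset.Ioc (2 ^ i) (2 ^ (i + 1))).filter Nat.Prime,
      (i * Real.log 2 * 2 ^ i) * (1 / (p : ℝ)) ≤ θ ((2 : ℝ) ^ (i + 1)) := by
    rw [theta, hfl]
    refine (Finset.sum_le_sum fun p hp => ?_).trans
      (Finset.sum_le_sum_of_subset_of_nonneg (Finset.filter_subset_filter _
        (Finset.Ioc_subset_Ioc_left (Nat.zero_le _))) fun p hp _ =>
          Real.log_natCast_nonneg _)
    simp only [Finset.mem_filter, Finset.mem_Ioc] at hp
    have hp2 : (2 : ℝ) ^ i ≤ p := by exact_mod_cast hp.1.1.le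
    have hp0 : (0 : ℝ) < p := lt_of_lt_of_le (by positivity) hp2
    have : (i : ℝ) * Real.log 2 ≤ Real.log p := by
      rw [← Real.log_pow]
      exact Real.log_le_log (by positivity) hp2
    rw [mul_one_div, div_le_iff₀ hp0]
    exact mul_le_mul this hp2 (by positivity) (le_trans (by positivity) this)
  rw [← Finset.mul_sum] at h1
  have h2 := h1.trans hθ
  rw [hlog4, pow_succ (2 : ℝ)] at h2
  rw [le_div_iff₀ hi0]
  have hpos : (0 : ℝ) < Real.log 2 * 2 ^ i := by positivity
  refine le_of_mul_le_mul_left ?_ hpos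
  linarith

theorem sum_inv_primes_dyadic (a b : ℕ) (ha : 1 ≤ a) (hab : a ≤ b) :
    ∑ p ∈ (Finset.Ioc (2 ^ a) (2 ^ b)).filter Nat.Prime, 1 / (p : ℝ)
      ≤ 4 * (1 + Real.log (b / a)) := by
  have ha0 : (0 : ℝ) < a := by exact_mod_cast ha
  -- The first block costs 4/a; each later block i costs 4/i, which is at most 4(log i - log(i-1))
  -- and telescopes.
  suffices H : ∀ c : ℕ, ∑ p ∈ (Finset.Ioc (2 ^ a) (2 ^ (a + c + 1))).filter Nat.Prime, 1 / (p : ℝ)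
      ≤ 4 * (1 / a + Real.log ((a + c : ℕ) / a)) by
    rcases hab.eq_or_lt with h | h
    · subst h
      simp [ha0.ne']
    · obtain ⟨c, rfl⟩ : ∃ c, b = a + c + 1 := ⟨b - a - 1, by omega⟩
      refine (H c).trans ?_
      have h1 : 1 / (a : ℝ) ≤ 1 := by
        rw [div_le_one ha0]; exact_mod_cast ha
      have h2 : Real.log ((a + c : ℕ) / a) ≤ Real.log ((a + c + 1 : ℕ) / a) := by
        apply Real.log_le_log
        · have : (0 : ℝ) < (a + c : ℕ) := by exact_mod_cast (by omega)
          positivity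
        · refine div_le_div_of_nonneg_right ?_ ha0.le
          exact_mod_cast Nat.le_succ _
      linarith
  intro c
  induction c with
  | zero =>
    refine (sum_inv_primes_dyadic_block a ha).trans (le_of_eq ?_)
    simp [ha0.ne', div_eq_mul_inv]
  | succ c ih =>
    have hsplit : (Finset.Ioc (2 ^ a) (2 ^ (a + (c + 1) + 1))).filter Nat.Prime =
        (Finset.Ioc (2 ^ a) (2 ^ (a + c + 1))).filter Nat.Prime ∪
        (Finset.Ioc (2 ^ (a + c + 1)) (2 ^ (a + c + 1 + 1))).filter Nat.Prime := by
      rw [← Finset.filter_union, Finset.Ioc_union_Ioc_eq_Ioc]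
      · congr 1
      · exact Nat.pow_le_pow_right (by norm_num) (by omega)
      · exact Nat.pow_le_pow_right (by norm_num) (by omega)
    rw [hsplit]
    rw [Finset.sum_union (Finset.disjoint_filter_filter (Finset.Ioc_disjoint_Ioc_of_le le_rfl))]
    have hb := sum_inv_primes_dyadic_block (a + c + 1) (by omega)
    have hac : (0 : ℝ) < (a + c : ℕ) := by exact_mod_cast (by omega)
    have hac1 : (0 : ℝ) < (a + c + 1 : ℕ) := by positivity
    have hlog : 1 / ((a + c + 1 : ℕ) : ℝ) ≤
        Real.log ((a + (c + 1) : ℕ) / a) - Real.log ((a + c : ℕ) / a) := by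
      rw [← Real.log_div (by positivity) (by positivity), div_div_div_cancel_right₀ ha0.ne']
      have h := Real.one_sub_inv_le_log_of_pos
        (x := ((a + (c + 1) : ℕ) : ℝ) / (a + c : ℕ)) (by positivity)
      refine le_trans (le_of_eq ?_) h
      push_cast
      push_cast at hac
      field_simp
      ring
    have : (4 : ℝ) / ((a + c + 1 : ℕ) : ℝ) = 4 * (1 / ((a + c + 1 : ℕ) : ℝ)) := by ring
    linarith

/-- An upper bound of Mertens type for the primes in `(z, x]`. -/
theorem sum_inv_primes_Ioc_le {z x : ℝ} (hz : 4 ≤ z) (hzx : z ≤ x) (S : Finset ℕ)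
    (hS : ∀ p ∈ S, p.Prime ∧ z < p ∧ (p : ℝ) ≤ x) :
    ∑ p ∈ S, 1 / (p : ℝ) ≤ 12 + 4 * Real.log (Real.log x / Real.log z) := by
  have hl2 : 0 < Real.log 2 := Real.log_pos (by norm_num)
  have hlog4 : Real.log 4 = 2 * Real.log 2 := by
    rw [show (4 : ℝ) = 2 ^ 2 by norm_num, Real.log_pow]; norm_num
  have hz0 : 0 < z := by linarith
  have hlz : 2 * Real.log 2 ≤ Real.log z := hlog4 ▸ Real.log_le_log (by norm_num) hz
  have hlx : Real.log z ≤ Real.log x := Real.log_le_log hz0 hzx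
  set a := ⌊Real.log z / Real.log 2⌋₊ with ha
  set b := ⌈Real.log x / Real.log 2⌉₊ with hb
  have hu : 2 ≤ Real.log z / Real.log 2 := by rw [le_div_iff₀ hl2]; exact hlz
  have hv : Real.log z / Real.log 2 ≤ Real.log x / Real.log 2 := by gcongr
  have ha1 : 1 ≤ a := Nat.le_floor (by push_cast; linarith)
  have haz : (a : ℝ) ≤ Real.log z / Real.log 2 := Nat.floor_le (by linarith)
  have haz' : Real.log z / Real.log 2 - 1 < a := by have := Nat.lt_floor_add_one (Real.log z / Real.log 2); linarith
  have hbx : Real.log x / Real.log 2 ≤ b := Nat.le_ceil _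
  have hbx' : (b : ℝ) < Real.log x / Real.log 2 + 1 := Nat.ceil_lt_add_one (by linarith)
  have hab : a ≤ b := by exact_mod_cast haz.trans (hv.trans hbx)
  have hsub : S ⊆ (Finset.Ioc (2 ^ a) (2 ^ b)).filter Nat.Prime := by
    intro p hp
    obtain ⟨h1, h2, h3⟩ := hS p hp
    rw [Finset.mem_filter, Finset.mem_Ioc]
    refine ⟨⟨?_, ?_⟩, h1⟩
    · have : ((2 : ℝ) ^ a) < p := by
        refine lt_of_le_of_lt ?_ h2
        rw [← Real.rpow_natCast, Real.rpow_def_of_pos (by norm_num), ← Real.le_log_iff_exp_le hz0]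
        rw [le_div_iff₀ hl2] at haz
        linarith
      exact_mod_cast this
    · have : (p : ℝ) ≤ ((2 : ℝ) ^ b) := by
        refine h3.trans ?_
        rw [← Real.rpow_natCast, Real.rpow_def_of_pos (by norm_num), ← Real.log_le_iff_le_exp (by linarith)]
        rw [div_le_iff₀ hl2] at hbx
        linarith
      exact_mod_cast this
  refine (Finset.sum_le_sum_of_subset_of_nonneg hsub fun _ _ _ => by positivity).trans
    ((sum_inv_primes_dyadic a b ha1 hab).trans ?_)
  have ha0 : (0 : ℝ) < a := by exact_mod_cast ha1
  have hb0 : (0 : ℝ) < b := by linarith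
  have hlz0 : 0 < Real.log z := by linarith
  have hlx0 : 0 < Real.log x := by linarith
  -- Rounding the binary logarithms costs a factor of at most 3, because log z / log 2 ≥ 2.
  -- Replacing 3 by e² turns it into 4·2, which with the 4 of the dyadic bound makes 12.
  have hquot : (b : ℝ) / a ≤ Real.exp 2 * (Real.log x / Real.log z) := by
    have e2 : (3 : ℝ) ≤ Real.exp 2 := by have := Real.add_one_le_exp (2 : ℝ); linarith
    refine le_trans ?_ (mul_le_mul_of_nonneg_right e2 (by positivity))
    have h1 : (b : ℝ) ≤ (3 / 2) * (Real.log x / Real.log 2) := by linarith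
    have h2 : (1 / 2) * (Real.log z / Real.log 2) ≤ a := by linarith
    calc (b : ℝ) / a ≤ ((3 / 2) * (Real.log x / Real.log 2)) / ((1 / 2) * (Real.log z / Real.log 2)) := by
          gcongr
      _ = 3 * (Real.log x / Real.log z) := by field_simp; try ring
  have := Real.log_le_log (by positivity) hquot
  rw [Real.log_mul (by positivity) (by positivity), Real.log_exp] at this
  linarith

theorem mem_primeModuli {n : ℕ} {A : LocalSets n} {x : ℝ} {p : ℕ} :
    p ∈ primeModuli A x ↔ p.Prime ∧ (p : ℝ) ≤ x ∧ 1 ≤ rho A p := by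
  simp only [primeModuli, moduli, Finset.mem_filter, Finset.mem_Icc]
  constructor
  · rintro ⟨⟨⟨h1, h2⟩, h3⟩, h4⟩
    exact ⟨h4, (Nat.le_floor_iff' (by omega)).1 h2, h3⟩
  · rintro ⟨h1, h2, h3⟩
    exact ⟨⟨⟨h1.one_le, (Nat.le_floor_iff' h1.ne_zero).2 h2⟩, h3⟩, h1⟩

theorem sum_log_primeModuli_le {n : ℕ} (A : LocalSets n) {x : ℝ} (hx : 0 ≤ x) :
    ∑ p ∈ primeModuli A x, Real.log p ≤ Real.log 4 * x := by
  refine le_trans ?_ (theta_le_log4_mul_x hx)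
  rw [theta]
  refine Finset.sum_le_sum_of_subset_of_nonneg (fun p hp => ?_) fun p _ _ =>
    Real.log_natCast_nonneg _
  obtain ⟨h1, h2, -⟩ := mem_primeModuli.1 hp
  rw [Finset.mem_filter, Finset.mem_Ioc]
  exact ⟨⟨h1.pos, Nat.le_floor h2⟩, h1⟩

/-- An absolute bound on α lets bounds without the factor 1/α be absorbed into those that carry it,
and turns k ≤ αδ log log x into k ≤ log log x. -/
theorem ManyPrimes.le_log_four {n : ℕ} {A : LocalSets n} {α x₀ : ℝ} (hx₀ : 2 ≤ x₀)
    (h : ManyPrimes A α x₀) : α ≤ Real.log 4 := by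
  have := (h x₀ le_rfl).trans (sum_log_primeModuli_le A (by linarith))
  exact le_of_mul_le_mul_right this (by linarith)

theorem primeModuli_mono {n : ℕ} (A : LocalSets n) {x y : ℝ} (h : x ≤ y) :
    primeModuli A x ⊆ primeModuli A y := fun p hp => by
  obtain ⟨h1, h2, h3⟩ := mem_primeModuli.1 hp
  exact mem_primeModuli.2 ⟨h1, h2.trans h, h3⟩

/-- Cut at powers of an integer K with αK ≥ 2 log 4. The hypothesis at K^(J+1) exceeds Chebyshev's
bound at K^J by at least log 4·K^J, so the interval between them contributes at least c₀/(J+1) to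
the sum of reciprocals. Summing over J gives log log x. Both c and X are chosen before n and A. -/
theorem exists_loglog_le_sum_inv {α x₀ : ℝ} (hα : 0 < α) :
    ∃ c : ℝ, 0 < c ∧ ∃ X : ℝ, ∀ (n : ℕ) (A : LocalSets n), ManyPrimes A α x₀ → ∀ x : ℝ, X ≤ x →
      c * Real.log (Real.log x) ≤ ∑ p ∈ primeModuli A x, 1 / (p : ℝ) := by
  have hlog4 : 0 < Real.log 4 := Real.log_pos (by norm_num)
  obtain ⟨K, hK⟩ : ∃ K : ℕ, max 2 (2 * Real.log 4 / α) ≤ K := exists_nat_ge _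
  have hK2 : (2 : ℝ) ≤ K := (le_max_left _ _).trans hK
  have hKα : 2 * Real.log 4 ≤ α * K := by
    have := (le_max_right _ _).trans hK
    rwa [div_le_iff₀' hα] at this
  have hK0 : (0 : ℝ) < K := by linarith
  have hlK : 0 < Real.log K := Real.log_pos (by linarith)
  obtain ⟨j₀, hj₀⟩ := pow_unbounded_of_one_lt x₀ (show (1 : ℝ) < K by linarith)
  set c₀ := Real.log 4 / (K * Real.log K) with hc₀
  have hc₀pos : 0 < c₀ := by positivity
  set B := Real.log (j₀ + 1) + Real.log (Real.log K) with hB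
  -- Past exp(exp(2B)) half of log log x swallows the constant B, hence the halved c₀.
  refine ⟨c₀ / 2, by positivity, max ((K : ℝ) ^ j₀) (Real.exp (Real.exp (2 * B))), ?_⟩
  intro n A hA x hx
  have key : ∀ i : ℕ, c₀ * (Real.log ((j₀ + i : ℕ) + 1) - Real.log (j₀ + 1)) ≤
      ∑ p ∈ primeModuli A ((K : ℝ) ^ (j₀ + i)), 1 / (p : ℝ) := by
    intro i
    induction i with
    | zero => simpa using Finset.sum_nonneg fun _ _ => by positivity
    | succ i ih =>
      set J := j₀ + i with hJ
      have hmono : (K : ℝ) ^ J ≤ (K : ℝ) ^ (J + 1) := pow_le_pow_right₀ (by linarith) (by omega)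
      have hsub := primeModuli_mono A hmono
      have hsd := Finset.sum_sdiff (f := fun p : ℕ => 1 / (p : ℝ)) hsub
      have hsd' := Finset.sum_sdiff (f := fun p : ℕ => Real.log p) hsub
      have hx₀J : x₀ ≤ (K : ℝ) ^ (J + 1) :=
        hj₀.le.trans (pow_le_pow_right₀ (by linarith) (by omega))
      have h1 := hA _ hx₀J
      have h2 := sum_log_primeModuli_le A (x := (K : ℝ) ^ J) (by positivity)
      have hlow : Real.log 4 * (K : ℝ) ^ J ≤
          ∑ p ∈ primeModuli A ((K : ℝ) ^ (J + 1)) \ primeModuli A ((K : ℝ) ^ J), Real.log p := by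
        have : α * (K : ℝ) ^ (J + 1) = (α * K) * (K : ℝ) ^ J := by ring
        have h3 := mul_le_mul_of_nonneg_right hKα (show (0 : ℝ) ≤ (K : ℝ) ^ J by positivity)
        linarith
      have hJ0 : (0 : ℝ) < (J : ℝ) + 1 := by positivity
      have hup : ∑ p ∈ primeModuli A ((K : ℝ) ^ (J + 1)) \ primeModuli A ((K : ℝ) ^ J),
          Real.log p ≤ ((K : ℝ) ^ (J + 1) * ((J + 1) * Real.log K)) *
          ∑ p ∈ primeModuli A ((K : ℝ) ^ (J + 1)) \ primeModuli A ((K : ℝ) ^ J), 1 / (p : ℝ) := by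
        rw [Finset.mul_sum]
        refine Finset.sum_le_sum fun p hp => ?_
        obtain ⟨hp1, hp2, -⟩ := mem_primeModuli.1 (Finset.mem_sdiff.1 hp).1
        have hp0 : (0 : ℝ) < p := by exact_mod_cast hp1.pos
        have hl : Real.log p ≤ (J + 1) * Real.log K := by
          have := Real.log_le_log hp0 hp2
          rw [Real.log_pow] at this
          exact_mod_cast this
        rw [mul_one_div, le_div_iff₀ hp0, mul_comm]
        exact mul_le_mul hp2 hl (Real.log_natCast_nonneg _) (by positivity)
      have hinc : c₀ / (J + 1) ≤
          ∑ p ∈ primeModuli A ((K : ℝ) ^ (J + 1)) \ primeModuli A ((K : ℝ) ^ J), 1 / (p : ℝ) := by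
        have h4 := hlow.trans hup
        have h5 : c₀ / (J + 1) = (Real.log 4 * (K : ℝ) ^ J) /
            ((K : ℝ) ^ (J + 1) * ((J + 1) * Real.log K)) := by
          rw [hc₀, pow_succ]; field_simp
        rw [h5, div_le_iff₀' (by positivity)]
        exact h4
      have hlog : Real.log ((J : ℝ) + 1 + 1) - Real.log ((J : ℝ) + 1) ≤ 1 / ((J : ℝ) + 1) := by
        rw [← Real.log_div (by positivity) (by positivity)]
        have := Real.log_le_sub_one_of_pos (x := ((J : ℝ) + 1 + 1) / (J + 1)) (by positivity)
        refine this.trans (le_of_eq ?_)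
        field_simp; ring
      have h6 := mul_le_mul_of_nonneg_left hlog hc₀pos.le
      rw [mul_one_div] at h6
      have hcast : ((j₀ + (i + 1) : ℕ) : ℝ) = (J : ℝ) + 1 := by rw [hJ]; push_cast; ring
      rw [hcast, show j₀ + (i + 1) = J + 1 by omega]
      linarith
  have hx1 := (le_max_left _ _).trans hx
  have hx2 := (le_max_right _ _).trans hx
  have hx0 : 0 < x := lt_of_lt_of_le (Real.exp_pos _) hx2
  have hlx : Real.exp (2 * B) ≤ Real.log x := (Real.le_log_iff_exp_le hx0).2 hx2
  have hlx0 : 0 < Real.log x := (Real.exp_pos _).trans_le hlx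
  have hllx : 2 * B ≤ Real.log (Real.log x) := (Real.le_log_iff_exp_le hlx0).2 hlx
  set J := ⌊Real.log x / Real.log K⌋₊ with hJ
  have hJj : j₀ ≤ J := by
    refine Nat.le_floor ?_
    rw [le_div_iff₀ hlK, ← Real.log_pow]
    exact Real.log_le_log (by positivity) hx1
  have hJx : (K : ℝ) ^ J ≤ x := by
    have : (J : ℝ) ≤ Real.log x / Real.log K := Nat.floor_le (by positivity)
    rw [le_div_iff₀ hlK, ← Real.log_pow] at this
    exact (Real.log_le_log_iff (by positivity) hx0).1 this
  have h1 := key (J - j₀)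
  rw [Nat.add_sub_cancel' hJj] at h1
  have h2 : ∑ p ∈ primeModuli A ((K : ℝ) ^ J), 1 / (p : ℝ) ≤ ∑ p ∈ primeModuli A x, 1 / (p : ℝ) :=
    Finset.sum_le_sum_of_subset_of_nonneg (primeModuli_mono A hJx) fun _ _ _ => by positivity
  have h3 : Real.log (Real.log x) - Real.log (Real.log K) ≤ Real.log ((J : ℝ) + 1) := by
    rw [← Real.log_div hlx0.ne' hlK.ne']
    exact Real.log_le_log (by positivity) (Nat.lt_floor_add_one _).le
  have h4 : c₀ / 2 * Real.log (Real.log x) ≤ c₀ * (Real.log ((J : ℝ) + 1) - Real.log (j₀ + 1)) := by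
    have : 1 / 2 * Real.log (Real.log x) ≤ Real.log ((J : ℝ) + 1) - Real.log (j₀ + 1) := by
      linarith
    have := mul_le_mul_of_nonneg_left this hc₀pos.le
    linarith
  linarith

end Primes

/-! ### The Selberg upper bound sieve with bounded remainders. -/

section SelbergSieveBound

open Finset ArithmeticFunction
open scoped ArithmeticFunction.Moebius

/-- Möbius sum over the multiples of `l` dividing a squarefree `m`. -/
theorem sum_divisors_moebius_of_dvd {m l : ℕ} (hm : Squarefree m) :
    (∑ d ∈ m.divisors, if l ∣ d then (μ d : ℝ) else 0) = if l = m then (μ l : ℝ) else 0 := by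
  have hm0 : m ≠ 0 := hm.ne_zero
  by_cases hl : l ∣ m
  · obtain ⟨e, rfl⟩ := hl
    have hcop : l.Coprime e := Nat.coprime_of_squarefree_mul hm
    have hl0 : l ≠ 0 := left_ne_zero_of_mul hm0
    have he0 : e ≠ 0 := right_ne_zero_of_mul hm0
    rw [← sum_filter]
    have h1 : ((l * e).divisors.filter (l ∣ ·)) = e.divisors.image (l * ·) := by
      ext d
      simp only [mem_filter, Nat.mem_divisors, mem_image]
      constructor
      · rintro ⟨⟨h, -⟩, c, rfl⟩
        exact ⟨c, ⟨(Nat.mul_dvd_mul_iff_left (Nat.pos_of_ne_zero hl0)).1 h, he0⟩, rfl⟩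
      · rintro ⟨c, ⟨h, -⟩, rfl⟩
        exact ⟨⟨mul_dvd_mul_left l h, hm0⟩, dvd_mul_right _ _⟩
    rw [h1, sum_image (fun a _ b _ h => Nat.eq_of_mul_eq_mul_left (Nat.pos_of_ne_zero hl0) h)]
    have h2 : ∀ c ∈ e.divisors, (μ (l * c) : ℝ) = μ l * μ c := fun c hc => by
      rw [isMultiplicative_moebius.map_mul_of_coprime
        (hcop.coprime_dvd_right (Nat.dvd_of_mem_divisors hc))]
      push_cast; rfl
    rw [sum_congr rfl h2, ← mul_sum]
    have h3 : ∑ c ∈ e.divisors, (μ c : ℝ) = if e = 1 then 1 else 0 := by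
      have := congrArg (fun f : ArithmeticFunction ℤ => f e) coe_zeta_mul_moebius
      simp only [coe_zeta_mul_apply, one_apply] at this
      exact_mod_cast this
    rw [h3]
    by_cases he : e = 1
    · simp [he]
    · have : l ≠ l * e := fun h => he (by
        have h' : l * 1 = l * e := by rw [mul_one]; exact h
        exact (Nat.eq_of_mul_eq_mul_left (Nat.pos_of_ne_zero hl0) h').symm)
      simp [he, this]
  · rw [if_neg (fun h : l = m => hl (h ▸ dvd_rfl))]
    exact sum_eq_zero fun d hd => if_neg fun h => hl (h.trans (Nat.dvd_of_mem_divisors hd))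

variable (s : BoundingSieve)

/-- The divisors of the sifting modulus up to the level `D`. -/
def sieveSupport (D : ℕ) : Finset ℕ := s.prodPrimes.divisors.filter (· ≤ D)

/-- The main denominator of the Selberg sieve. -/
noncomputable def sieveDensity (D : ℕ) : ℝ := ∑ l ∈ sieveSupport s D, s.selbergTerms l

/-- The optimal weights of the Selberg sieve. -/
noncomputable def optimalWeight (D d : ℕ) : ℝ :=
  μ d * (s.nu d)⁻¹ *
    ((∑ l ∈ sieveSupport s D, if d ∣ l then s.selbergTerms l else 0) / sieveDensity s D)

variable {s}

theorem dvd_of_mem_sieveSupport {D l : ℕ} (hl : l ∈ sieveSupport s D) : l ∣ s.prodPrimes :=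
  Nat.dvd_of_mem_divisors (mem_filter.1 hl).1

theorem selbergTerms_pos_of_mem {D l : ℕ} (hl : l ∈ sieveSupport s D) : 0 < s.selbergTerms l :=
  BoundingSieve.selbergTerms_pos (dvd_of_mem_sieveSupport hl)

theorem sieveDensity_pos {D : ℕ} (hD : 1 ≤ D) : 0 < sieveDensity s D :=
  sum_pos (fun _ hl => selbergTerms_pos_of_mem hl)
    ⟨1, mem_filter.2 ⟨Nat.one_mem_divisors.2 BoundingSieve.prodPrimes_ne_zero, hD⟩⟩

theorem optimalWeight_one {D : ℕ} (hD : 1 ≤ D) : optimalWeight s D 1 = 1 := by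
  have := (sieveDensity_pos (s := s) hD).ne'
  simp only [optimalWeight, moebius_apply_one, s.nu_mult.map_one, one_dvd, if_true]
  rw [← sieveDensity, div_self this]
  simp

theorem optimalWeight_eq_zero {D d : ℕ} (h : D < d) : optimalWeight s D d = 0 := by
  rw [optimalWeight, sum_eq_zero, zero_div, mul_zero]
  intro l hl
  refine if_neg fun hd => ?_
  have hl0 : 0 < l := Nat.pos_of_dvd_of_pos (dvd_of_mem_sieveSupport hl)
    (Nat.pos_of_ne_zero BoundingSieve.prodPrimes_ne_zero)
  have := Nat.le_of_dvd hl0 hd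
  have := (mem_filter.1 hl).2
  omega

/-- The restricted sum of Selberg terms is part of the full one. This crude bound suffices because
the level will be a very small power of y. -/
theorem abs_optimalWeight_le {D d : ℕ} (hD : 1 ≤ D) : |optimalWeight s D d| ≤ |(s.nu d)⁻¹| := by
  have hG := sieveDensity_pos (s := s) hD
  have h1 : |(μ d : ℝ)| ≤ 1 := by exact_mod_cast abs_moebius_le_one
  have h2 : |(∑ l ∈ sieveSupport s D, if d ∣ l then s.selbergTerms l else 0) / sieveDensity s D|
      ≤ 1 := by
    rw [abs_of_nonneg (div_nonneg (sum_nonneg fun l hl => ?_) hG.le), div_le_one hG]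
    · refine sum_le_sum fun l hl => ?_
      split_ifs
      · exact le_rfl
      · exact (selbergTerms_pos_of_mem hl).le
    · split_ifs
      · exact (selbergTerms_pos_of_mem hl).le
      · exact le_rfl
  rw [optimalWeight, abs_mul, abs_mul]
  calc _ ≤ 1 * |(s.nu d)⁻¹| * 1 := by gcongr
    _ = _ := by ring

/-- Möbius inversion: after exchanging the sums, the Selberg term at m is multiplied by the sum of
μ(d) over l ∣ d ∣ m, which vanishes unless l = m. These are the coordinates in which the quadratic
form is diagonal. -/
theorem sum_nu_mul_optimalWeight {D l : ℕ} :
    (∑ d ∈ s.prodPrimes.divisors, if l ∣ d then s.nu d * optimalWeight s D d else 0) =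
      if l ∈ sieveSupport s D then μ l * s.selbergTerms l / sieveDensity s D else 0 := by
  have hP := BoundingSieve.prodPrimes_ne_zero (s := s)
  have h1 : ∀ d ∈ s.prodPrimes.divisors, (if l ∣ d then s.nu d * optimalWeight s D d else 0) =
      ∑ m ∈ sieveSupport s D, s.selbergTerms m / sieveDensity s D *
        (if d ∣ m then (if l ∣ d then (μ d : ℝ) else 0) else 0) := by
    intro d hd
    have hν := BoundingSieve.nu_ne_zero (Nat.dvd_of_mem_divisors hd)
    split_ifs with h
    · rw [optimalWeight, sum_div, mul_sum, mul_sum]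
      refine sum_congr rfl fun m _ => ?_
      split_ifs
      · field_simp
      · simp
    · simp
  rw [sum_congr rfl h1, sum_comm]
  have h2 : ∀ m ∈ sieveSupport s D, (∑ d ∈ s.prodPrimes.divisors,
      s.selbergTerms m / sieveDensity s D *
        (if d ∣ m then (if l ∣ d then (μ d : ℝ) else 0) else 0)) =
      if l = m then μ l * s.selbergTerms l / sieveDensity s D else 0 := by
    intro m hm
    have hmP := dvd_of_mem_sieveSupport hm
    rw [← mul_sum, ← sum_filter, Nat.divisors_filter_dvd_of_dvd hP hmP,
      sum_divisors_moebius_of_dvd (BoundingSieve.squarefree_of_dvd_prodPrimes hmP)]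
    split_ifs with h
    · subst h; ring
    · simp
  rw [sum_congr rfl h2, sum_ite_eq]

/-- In the diagonal coordinates the form is a sum of g(l)⁻¹·(g(l)/G)² over the support, that is
G/G². -/
theorem mainSum_optimalWeight {D : ℕ} (hD : 1 ≤ D) :
    s.mainSum (BoundingSieve.lambdaSquared (optimalWeight s D)) = (sieveDensity s D)⁻¹ := by
  have hG := sieveDensity_pos (s := s) hD
  rw [BoundingSieve.mainSum_lambdaSquared_eq_sum_mul_sum_sq]
  simp_rw [sum_nu_mul_optimalWeight]
  have h1 : ∀ l ∈ s.prodPrimes.divisors, (s.selbergTerms l)⁻¹ *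
      (if l ∈ sieveSupport s D then μ l * s.selbergTerms l / sieveDensity s D else 0) ^ 2 =
      if l ≤ D then s.selbergTerms l / (sieveDensity s D) ^ 2 else 0 := by
    intro l hl
    have hlP := Nat.dvd_of_mem_divisors hl
    have hg := BoundingSieve.selbergTerms_pos hlP
    have hiff : l ∈ sieveSupport s D ↔ l ≤ D := by simp [sieveSupport, hl]
    simp only [hiff]
    split_ifs
    · have hμ : (μ l : ℝ) ^ 2 = 1 := by
        exact_mod_cast moebius_sq_eq_one_of_squarefree
          (BoundingSieve.squarefree_of_dvd_prodPrimes hlP)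
      rw [div_pow, mul_pow, hμ]
      field_simp
    · simp
  rw [sum_congr rfl h1, ← sum_filter, ← sum_div]
  change sieveDensity s D / _ = _
  field_simp

/-- The Selberg sieve when all remainders are bounded. -/
theorem siftedSum_le_of_rem_le {D : ℕ} (hD : 1 ≤ D) {R : ℝ}
    (hR : ∀ d ∈ s.prodPrimes.divisors, |s.rem d| ≤ R) {w : ℝ}
    (hw : ∀ d ∈ s.prodPrimes.divisors, |optimalWeight s D d| ≤ if d ≤ D then w else 0) :
    s.siftedSum ≤ s.totalMass * (sieveDensity s D)⁻¹ + R * (D * w) ^ 2 := by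
  have hP := BoundingSieve.prodPrimes_ne_zero (s := s)
  have h1 := BoundingSieve.siftedSum_le_mainSum_errSum_of_upperMoebius (s := s) _
    (BoundingSieve.upperMoebius_lambdaSquared (optimalWeight s D) (optimalWeight_one hD))
  rw [mainSum_optimalWeight hD] at h1
  refine h1.trans (add_le_add le_rfl ?_)
  have hR0 : 0 ≤ R := (abs_nonneg _).trans (hR 1 (Nat.one_mem_divisors.2 hP))
  set v := optimalWeight s D with hv
  have hbound : ∀ d ∈ s.prodPrimes.divisors, |BoundingSieve.lambdaSquared v d| ≤
      ∑ d1 ∈ s.prodPrimes.divisors, ∑ d2 ∈ s.prodPrimes.divisors,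
        if d = Nat.lcm d1 d2 then |v d1| * |v d2| else 0 := by
    intro d hd
    have hsub : d.divisors ⊆ s.prodPrimes.divisors :=
      Nat.divisors_subset_of_dvd hP (Nat.dvd_of_mem_divisors hd)
    rw [BoundingSieve.lambdaSquared]
    refine (abs_sum_le_sum_abs _ _).trans ?_
    refine (sum_le_sum fun d1 _ => abs_sum_le_sum_abs _ _).trans ?_
    refine (sum_le_sum fun d1 _ => sum_le_sum_of_subset_of_nonneg hsub
      fun _ _ _ => abs_nonneg _).trans ?_
    refine (sum_le_sum_of_subset_of_nonneg hsub
      fun _ _ _ => sum_nonneg fun _ _ => abs_nonneg _).trans (le_of_eq ?_)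
    refine sum_congr rfl fun d1 _ => sum_congr rfl fun d2 _ => ?_
    split_ifs
    · rw [abs_mul]
    · simp
  calc s.errSum (BoundingSieve.lambdaSquared v)
      ≤ ∑ d ∈ s.prodPrimes.divisors, (∑ d1 ∈ s.prodPrimes.divisors,
          ∑ d2 ∈ s.prodPrimes.divisors, if d = Nat.lcm d1 d2 then |v d1| * |v d2| else 0) * R := by
        rw [BoundingSieve.errSum]
        refine sum_le_sum fun d hd => ?_
        exact mul_le_mul (hbound d hd) (hR d hd) (abs_nonneg _)
          (sum_nonneg fun _ _ => sum_nonneg fun _ _ => by split_ifs <;> positivity)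
    _ ≤ (∑ d1 ∈ s.prodPrimes.divisors, ∑ d2 ∈ s.prodPrimes.divisors, |v d1| * |v d2|) * R := by
        -- A pair has only one least common multiple, so summing over d counts it at most once.
        rw [← sum_mul]
        refine mul_le_mul_of_nonneg_right ?_ hR0
        rw [sum_comm]
        refine sum_le_sum fun d1 _ => ?_
        rw [sum_comm]
        refine sum_le_sum fun d2 _ => ?_
        rw [sum_ite_eq']
        split_ifs
        · exact le_rfl
        · positivity
    _ = R * (∑ d ∈ s.prodPrimes.divisors, |v d|) ^ 2 := by
        rw [sq, sum_mul_sum]; ring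
    _ ≤ R * (D * w) ^ 2 := by
        have hw0 : 0 ≤ w := by
          have := (abs_nonneg _).trans (hw 1 (Nat.one_mem_divisors.2 hP))
          rwa [if_pos hD] at this
        refine mul_le_mul_of_nonneg_left ?_ hR0
        refine pow_le_pow_left₀ (sum_nonneg fun _ _ => abs_nonneg _) ?_ 2
        refine (sum_le_sum hw).trans ?_
        rw [← sum_filter, sum_const, nsmul_eq_mul]
        refine mul_le_mul_of_nonneg_right ?_ hw0
        have : s.prodPrimes.divisors.filter (· ≤ D) ⊆ Finset.Icc 1 D := fun d hd => by
          obtain ⟨h1, h2⟩ := mem_filter.1 hd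
          exact mem_Icc.2 ⟨Nat.pos_of_mem_divisors h1, h2⟩
        have := card_le_card this
        simp only [Nat.card_Icc, Nat.add_sub_cancel] at this
        exact_mod_cast this

end SelbergSieveBound

/-! ### Reciprocals of squarefree numbers, with and without a coprimality condition. -/

section SquarefreeSums

open Finset

theorem sum_inv_sq_le_two (D : ℕ) : ∑ s ∈ Icc 1 D, 1 / (s : ℝ) ^ 2 ≤ 2 := by
  suffices ∀ D : ℕ, ∑ s ∈ Icc 1 (D + 1), 1 / (s : ℝ) ^ 2 ≤ 2 - 1 / ((D : ℝ) + 1) by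
    rcases D with _ | D
    · simp
    · refine (this D).trans ?_
      have : (0 : ℝ) ≤ 1 / ((D : ℝ) + 1) := by positivity
      linarith
  intro D
  induction D with
  | zero => norm_num
  | succ D ih =>
    rw [sum_Icc_succ_top (by omega)]
    have : 1 / (((D + 1 + 1 : ℕ) : ℝ)) ^ 2 ≤ 1 / ((D : ℝ) + 1) - 1 / (((D + 1 : ℕ) : ℝ) + 1) := by
      push_cast
      rw [div_sub_div _ _ (by positivity) (by positivity), div_le_div_iff₀ (by positivity) (by positivity)]
      ring_nf
      nlinarith [(Nat.cast_nonneg D : (0 : ℝ) ≤ D)]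
    linarith

/-- The squarefree numbers up to `D`. -/
def squarefreeUpTo (D : ℕ) : Finset ℕ := (Icc 1 D).filter Squarefree

/-- Writing m = b²a with a squarefree bounds the harmonic sum by the squarefree sum times the sum of
1/b², which is at most 2. -/
theorem log_le_sum_inv_squarefree (D : ℕ) :
    Real.log (D + 1) ≤ 2 * ∑ m ∈ squarefreeUpTo D, 1 / (m : ℝ) := by
  have h1 : Real.log (D + 1) ≤ ∑ m ∈ Icc 1 D, 1 / (m : ℝ) := by
    refine (by exact_mod_cast log_add_one_le_harmonic D : Real.log (D + 1) ≤ _).trans ?_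
    rw [harmonic_eq_sum_Icc]
    push_cast
    simp
  refine h1.trans ?_
  choose a b hab ha using Nat.sq_mul_squarefree
  have h2 : ∑ m ∈ Icc 1 D, 1 / (m : ℝ) ≤
      ∑ x ∈ squarefreeUpTo D ×ˢ Icc 1 D, 1 / (x.1 : ℝ) * (1 / (x.2 : ℝ) ^ 2) := by
    have hinj : Set.InjOn (fun m => (a m, b m)) (Icc 1 D : Finset ℕ) := by
      intro m _ m' _ h
      simp only [Prod.mk.injEq] at h
      rw [← hab m, ← hab m', h.1, h.2]
    calc ∑ m ∈ Icc 1 D, 1 / (m : ℝ) = ∑ m ∈ Icc 1 D, 1 / (a m : ℝ) * (1 / (b m : ℝ) ^ 2) := by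
          refine sum_congr rfl fun m _ => ?_
          conv_lhs => rw [← hab m]
          push_cast
          rw [one_div_mul_one_div, mul_comm]
      _ = ∑ x ∈ (Icc 1 D).image (fun m => (a m, b m)), 1 / (x.1 : ℝ) * (1 / (x.2 : ℝ) ^ 2) := by
          rw [sum_image hinj]
      _ ≤ _ := by
          refine sum_le_sum_of_subset_of_nonneg ?_ fun _ _ _ => by positivity
          intro x hx
          obtain ⟨m, hm, rfl⟩ := mem_image.1 hx
          obtain ⟨hm1, hm2⟩ := mem_Icc.1 hm
          have hb0 : b m ≠ 0 := fun h => by have := hab m; rw [h] at this; simp at this; omega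
          have ha0 : a m ≠ 0 := (ha m).ne_zero
          have hb1 : b m ≤ m := by
            calc b m ≤ b m ^ 2 := Nat.le_self_pow (by norm_num) _
              _ ≤ b m ^ 2 * a m := Nat.le_mul_of_pos_right _ (Nat.pos_of_ne_zero ha0)
              _ = m := hab m
          have ha1 : a m ≤ m := by
            conv_rhs => rw [← hab m]
            exact Nat.le_mul_of_pos_left _ (by positivity)
          simp only [squarefreeUpTo, mem_product, mem_filter, mem_Icc]
          exact ⟨⟨⟨by omega, by omega⟩, ha m⟩, by omega, by omega⟩
  refine h2.trans ?_
  rw [sum_product, mul_comm, sum_mul]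
  refine sum_le_sum fun m _ => ?_
  simp only
  rw [← mul_sum]
  exact mul_le_mul_of_nonneg_left (sum_inv_sq_le_two D) (by positivity)

/-- Removing the primes dividing `r` costs at most `∏ (1 + 1 / p)`. -/
theorem sum_inv_squarefree_le (D r : ℕ) (hr : 0 < r) :
    ∑ m ∈ squarefreeUpTo D, 1 / (m : ℝ) ≤
      (∑ l ∈ (squarefreeUpTo D).filter (Nat.Coprime r), 1 / (l : ℝ)) *
        ∏ p ∈ r.primeFactors, (1 + 1 / (p : ℝ)) := by
  -- Expanding the product gives a sum over pairs (l, set of primes of r). A squarefree m is sent to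
  -- m / gcd(m, r) and the primes of gcd(m, r); the gcd is the product of those primes, so m is
  -- recovered.
  rw [prod_one_add, sum_mul_sum, ← sum_product']
  have hsq : ∀ m ∈ squarefreeUpTo D, Squarefree m ∧ 0 < m ∧ m ≤ D := fun m hm => by
    simp only [squarefreeUpTo, mem_filter, mem_Icc] at hm
    exact ⟨hm.2, by omega, by omega⟩
  have hprod : ∀ m ∈ squarefreeUpTo D, ∏ p ∈ (m.gcd r).primeFactors, p = m.gcd r := fun m hm =>
    Nat.prod_primeFactors_of_squarefree ((hsq m hm).1.squarefree_of_dvd (Nat.gcd_dvd_left m r))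
  have hinj : Set.InjOn (fun m : ℕ => (m / m.gcd r, (m.gcd r).primeFactors))
      (squarefreeUpTo D : Set ℕ) := by
    intro m hm m' hm' h
    simp only [Prod.mk.injEq] at h
    have e : m.gcd r = m'.gcd r := by rw [← hprod m hm, ← hprod m' hm', h.2]
    rw [← Nat.div_mul_cancel (Nat.gcd_dvd_left m r), ← Nat.div_mul_cancel (Nat.gcd_dvd_left m' r),
      h.1, e]
  calc ∑ m ∈ squarefreeUpTo D, 1 / (m : ℝ)
      = ∑ m ∈ squarefreeUpTo D, 1 / ((m / m.gcd r : ℕ) : ℝ) *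
          ∏ p ∈ (m.gcd r).primeFactors, 1 / (p : ℝ) := by
        refine sum_congr rfl fun m hm => ?_
        have : ∏ p ∈ (m.gcd r).primeFactors, 1 / (p : ℝ) = 1 / (m.gcd r : ℝ) := by
          rw [prod_div_distrib, prod_const_one]
          conv_rhs => rw [← hprod m hm]
          push_cast; rfl
        rw [this, one_div_mul_one_div, ← Nat.cast_mul, Nat.div_mul_cancel (Nat.gcd_dvd_left m r)]
    _ = ∑ x ∈ (squarefreeUpTo D).image (fun m : ℕ => (m / m.gcd r, (m.gcd r).primeFactors)),
          1 / ((x.1 : ℕ) : ℝ) * ∏ p ∈ x.2, 1 / ((p : ℕ) : ℝ) := by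
        rw [sum_image hinj]
    _ ≤ _ := by
        refine sum_le_sum_of_subset_of_nonneg ?_ fun _ _ _ => by positivity
        intro x hx
        obtain ⟨m, hm, rfl⟩ := mem_image.1 hx
        obtain ⟨h1, h2, h3⟩ := hsq m hm
        have hg : 0 < m.gcd r := Nat.gcd_pos_of_pos_left _ h2
        have hmul := Nat.div_mul_cancel (Nat.gcd_dvd_left m r)
        have hd : m / m.gcd r ∣ m := Nat.div_dvd_of_dvd (Nat.gcd_dvd_left m r)
        simp only [squarefreeUpTo, mem_product, mem_filter, mem_Icc, mem_powerset]
        refine ⟨⟨⟨⟨Nat.div_pos (Nat.le_of_dvd h2 (Nat.gcd_dvd_left m r)) hg,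
          (Nat.le_of_dvd h2 hd).trans h3⟩, h1.squarefree_of_dvd hd⟩, ?_⟩,
          Nat.primeFactors_mono (Nat.gcd_dvd_right m r) hr.ne'⟩
        rw [Nat.coprime_comm, Nat.coprime_iff_gcd_eq_one]
        have hcop : (m / m.gcd r).Coprime (m.gcd r) :=
          Nat.coprime_of_squarefree_mul (hmul.symm ▸ h1)
        have hdv : (m / m.gcd r).gcd r ∣ m.gcd r :=
          Nat.dvd_gcd ((Nat.gcd_dvd_left _ _).trans hd) (Nat.gcd_dvd_right _ _)
        exact Nat.eq_one_of_dvd_coprimes hcop (Nat.gcd_dvd_left _ _) hdv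

end SquarefreeSums

/-! ### Primes in arithmetic progressions, bounded above by the sieve. -/

section BrunTitchmarsh

open Finset

theorem abs_card_modEq_sub_le (N M v : ℕ) (hM : 0 < M) :
    |(((Ioc 0 N).filter (· ≡ v [MOD M])).card : ℝ) - N / M| ≤ 1 := by
  have h := Nat.Ioc_filter_modEq_card 0 N hM v
  have hM' : (0 : ℚ) < M := by exact_mod_cast hM
  have hle : ⌊((0 : ℕ) - v : ℚ) / (M : ℚ)⌋ ≤ ⌊((N : ℚ) - v) / (M : ℚ)⌋ := by
    apply Int.floor_le_floor
    push_cast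
    gcongr
    exact Nat.cast_nonneg _
  rw [max_eq_left (by linarith)] at h
  have h1 := Int.floor_le (((N : ℚ) - v) / (M : ℚ))
  have h2 := Int.lt_floor_add_one (((N : ℚ) - v) / (M : ℚ))
  have h3 := Int.floor_le (((0 : ℕ) - v : ℚ) / (M : ℚ))
  have h4 := Int.lt_floor_add_one (((0 : ℕ) - v : ℚ) / (M : ℚ))
  have hq : |(((Ioc 0 N).filter (· ≡ v [MOD M])).card : ℚ) - N / M| ≤ 1 := by
    have : (((Ioc 0 N).filter (· ≡ v [MOD M])).card : ℚ) =
        (⌊((N : ℚ) - v) / (M : ℚ)⌋ : ℚ) - (⌊((0 : ℕ) - v : ℚ) / (M : ℚ)⌋ : ℚ) := by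
      exact_mod_cast h
    rw [this, abs_le]
    have e1 : ((N : ℚ) - v) / M = N / M - v / M := sub_div _ _ _
    have e2 : (((0 : ℕ) : ℚ) - v) / M = - (v / M) := by push_cast; ring
    constructor <;> linarith
  have hq' := (Rat.cast_le (K := ℝ)).2 hq
  push_cast at hq'
  exact hq'

/-- The arithmetic function `n ↦ 1 / n`. -/
noncomputable def invArith : ArithmeticFunction ℝ := ⟨fun n => (n : ℝ)⁻¹, by simp⟩

theorem invArith_apply (n : ℕ) : invArith n = (n : ℝ)⁻¹ := rfl

/-- The sieve of the `n ≤ y` in a residue class modulo `r` by the primes up to `D` not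
dividing `r`. -/
noncomputable def progressionSieve (y : ℝ) (r b D : ℕ) : BoundingSieve where
  support := (Ioc 0 ⌊y⌋₊).filter (· ≡ b [MOD r])
  prodPrimes := ∏ p ∈ (Icc 1 D).filter (fun p => p.Prime ∧ ¬ p ∣ r), p
  prodPrimes_squarefree := by
    refine Finset.squarefree_prod_of_pairwise_isCoprime ?_ ?_
    · intro p hp q hq hpq
      simp only [coe_filter, Set.mem_ofPred_eq] at hp hq
      exact Nat.coprime_iff_isRelPrime.1 ((Nat.coprime_primes hp.2.1 hq.2.1).2 hpq)
    · intro p hp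
      exact (mem_filter.1 hp).2.1.prime.squarefree
  weights := fun _ => 1
  weights_nonneg := fun _ => zero_le_one
  totalMass := y / r
  nu := invArith
  nu_mult := ⟨by simp [invArith_apply], fun {m n} _ => by simp [invArith_apply, mul_comm]⟩
  nu_pos_of_prime := fun p hp _ => by
    rw [invArith_apply]
    have : (0 : ℝ) < p := by exact_mod_cast hp.pos
    positivity
  nu_lt_one_of_prime := fun p hp _ => by
    rw [invArith_apply]
    exact inv_lt_one_of_one_lt₀ (by exact_mod_cast hp.one_lt)

variable {y : ℝ} {r b D : ℕ}

theorem progressionSieve_prodPrimes : (progressionSieve y r b D).prodPrimes =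
    ∏ p ∈ (Icc 1 D).filter (fun p => p.Prime ∧ ¬ p ∣ r), p := rfl

theorem coprime_prodPrimes : Nat.Coprime r (progressionSieve y r b D).prodPrimes := by
  rw [progressionSieve_prodPrimes]
  refine Nat.Coprime.prod_right fun p hp => ?_
  obtain ⟨-, h1, h2⟩ := mem_filter.1 hp
  exact ((Nat.Prime.coprime_iff_not_dvd h1).2 h2).symm

theorem dvd_prodPrimes_of_squarefree {l : ℕ} (hl : Squarefree l) (hlD : l ≤ D)
    (hlr : Nat.Coprime r l) : l ∣ (progressionSieve y r b D).prodPrimes := by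
  rw [← Nat.prod_primeFactors_of_squarefree hl]
  rw [progressionSieve_prodPrimes]
  refine prod_dvd_prod_of_subset _ _ (fun p : ℕ => p) fun p hp => ?_
  have hp' := Nat.mem_primeFactors.1 hp
  rw [mem_filter, mem_Icc]
  refine ⟨⟨hp'.1.one_le, (Nat.le_of_dvd (Nat.pos_of_ne_zero hp'.2.2) hp'.2.1).trans hlD⟩,
    hp'.1, fun h => ?_⟩
  exact Nat.not_coprime_of_dvd_of_dvd hp'.1.one_lt h hp'.2.1 hlr

/-- Each Selberg term is 1/l times a product of factors (1 - 1/p)⁻¹ ≥ 1, so the density dominates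
the sum of 1/l over squarefree l ≤ D coprime to r. -/
theorem le_sieveDensity (hr : 0 < r) :
    Real.log (D + 1) ≤ 2 * (sieveDensity (progressionSieve y r b D) D *
      ∏ p ∈ r.primeFactors, (1 + 1 / (p : ℝ))) := by
  refine (log_le_sum_inv_squarefree D).trans (mul_le_mul_of_nonneg_left ?_ (by norm_num))
  refine (sum_inv_squarefree_le D r hr).trans (mul_le_mul_of_nonneg_right ?_ (by positivity))
  rw [sieveDensity]
  have hsub : (squarefreeUpTo D).filter (Nat.Coprime r) ⊆
      sieveSupport (progressionSieve y r b D) D := by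
    intro l hl
    simp only [squarefreeUpTo, mem_filter, mem_Icc] at hl
    exact mem_filter.2 ⟨Nat.mem_divisors.2 ⟨dvd_prodPrimes_of_squarefree hl.1.2 hl.1.1.2 hl.2,
      BoundingSieve.prodPrimes_ne_zero⟩, hl.1.1.2⟩
  refine le_trans (sum_le_sum fun l hl => ?_)
    (sum_le_sum_of_subset_of_nonneg hsub fun l hl _ => (selbergTerms_pos_of_mem hl).le)
  rw [BoundingSieve.selbergTerms_apply, one_div]
  change (l : ℝ)⁻¹ ≤ (l : ℝ)⁻¹ * _
  refine le_mul_of_one_le_right (by positivity) ?_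
  refine Finset.one_le_prod fun p hp => ?_
  have hp := (Nat.mem_primeFactors.1 hp).1
  change 1 ≤ (1 - (p : ℝ)⁻¹)⁻¹
  have h1 : (p : ℝ)⁻¹ < 1 := inv_lt_one_of_one_lt₀ (by exact_mod_cast hp.one_lt)
  have h2 : (0 : ℝ) ≤ (p : ℝ)⁻¹ := by positivity
  exact (one_le_inv₀ (by linarith)).2 (by linarith)

/-- The classes b mod r and 0 mod d merge into one class mod rd. Counting it costs 1, and replacing
⌊y⌋ by y costs another 1. -/
theorem abs_rem_progressionSieve_le (hr : 0 < r) (hy : 0 ≤ y) {d : ℕ}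
    (hd : d ∣ (progressionSieve y r b D).prodPrimes) :
    |(progressionSieve y r b D).rem d| ≤ 2 := by
  have hd0 : 0 < d := Nat.pos_of_dvd_of_pos hd
    (Nat.pos_of_ne_zero BoundingSieve.prodPrimes_ne_zero)
  have hcop : Nat.Coprime r d := coprime_prodPrimes.coprime_dvd_right hd
  obtain ⟨c, hc1, hc2⟩ := Nat.chineseRemainder hcop b 0
  have h1 : (progressionSieve y r b D).multSum d =
      (((Ioc 0 ⌊y⌋₊).filter (· ≡ c [MOD r * d])).card : ℝ) := by
    rw [BoundingSieve.multSum]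
    change (∑ n ∈ (Ioc 0 ⌊y⌋₊).filter (· ≡ b [MOD r]), if d ∣ n then (1 : ℝ) else 0) = _
    rw [← sum_filter, filter_filter, sum_const, nsmul_eq_mul, mul_one]
    congr 2
    refine filter_congr fun n _ => ?_
    rw [← Nat.modEq_and_modEq_iff_modEq_mul hcop, ← Nat.modEq_zero_iff_dvd]
    exact ⟨fun h => ⟨h.1.trans hc1.symm, h.2.trans hc2.symm⟩,
      fun h => ⟨h.1.trans hc1, h.2.trans hc2⟩⟩
  have h2 := abs_card_modEq_sub_le ⌊y⌋₊ (r * d) c (by positivity)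
  rw [BoundingSieve.rem, h1]
  change |_ - (d : ℝ)⁻¹ * (y / r)| ≤ 2
  have h3 : |((⌊y⌋₊ : ℝ) / ((r * d : ℕ) : ℝ)) - (d : ℝ)⁻¹ * (y / r)| ≤ 1 := by
    have hr' : (0 : ℝ) < r := by exact_mod_cast hr
    have hd' : (0 : ℝ) < d := by exact_mod_cast hd0
    have e : ((⌊y⌋₊ : ℝ) / ((r * d : ℕ) : ℝ)) - (d : ℝ)⁻¹ * (y / r) =
        (⌊y⌋₊ - y) / ((r * d : ℕ) : ℝ) := by
      push_cast; field_simp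
    have hrd : (1 : ℝ) ≤ ((r * d : ℕ) : ℝ) := by exact_mod_cast Nat.mul_pos hr hd0
    rw [e, abs_div, abs_of_pos (show (0 : ℝ) < ((r * d : ℕ) : ℝ) by linarith),
      div_le_one (by linarith)]
    refine le_trans ?_ hrd
    rw [abs_le]
    have := Nat.floor_le hy
    have := Nat.lt_floor_add_one y
    constructor <;> linarith
  calc _ ≤ _ := abs_sub_le _ ((⌊y⌋₊ : ℝ) / ((r * d : ℕ) : ℝ)) _
    _ ≤ 1 + 1 := add_le_add h2 h3
    _ = 2 := by norm_num

/-- An upper bound of Brun–Titchmarsh type for primes in arithmetic progressions. -/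
theorem card_primes_modEq_le (hr : 0 < r) (hy : 2 ≤ y) (hry : (r : ℝ) ^ 4 ≤ y) (b : ℕ)
    (S : Finset ℕ) (hS : ∀ p ∈ S, p.Prime ∧ (p : ℝ) ≤ y ∧ p ≡ b [MOD r]) :
    (S.card : ℝ) ≤ 50 * (y / (r * Real.log y)) * ∏ p ∈ r.primeFactors, (1 + 1 / (p : ℝ)) := by
  have hy0 : 0 < y := by linarith
  have hlog : 0 < Real.log y := Real.log_pos (by linarith)
  have hr' : (0 : ℝ) < r := by exact_mod_cast hr
  -- The sieve error is 2(D·D)² = 2D⁴ ≤ 2y^(1/5). Against y/(r log y), with r ≤ y^(1/4) and log y ≤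
  -- 2y^(11/20), the exponents 1/5 + 1/4 + 11/20 add up to 1.
  set D := ⌊y ^ (1 / 20 : ℝ)⌋₊ with hD
  have hy20 : 1 ≤ y ^ (1 / 20 : ℝ) := Real.one_le_rpow (by linarith) (by norm_num)
  have hD1 : 1 ≤ D := Nat.le_floor (by simpa using hy20)
  have hDy : (D : ℝ) ≤ y ^ (1 / 20 : ℝ) := Nat.floor_le (by linarith)
  have hD1' : (1 : ℝ) ≤ D := by exact_mod_cast hD1
  set s := progressionSieve y r b D with hs
  set Pr := ∏ p ∈ r.primeFactors, (1 + 1 / (p : ℝ)) with hPr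
  have hPr1 : 1 ≤ Pr := Finset.one_le_prod fun p _ => by
    have : (0 : ℝ) ≤ 1 / (p : ℝ) := by positivity
    linarith
  have hsift := siftedSum_le_of_rem_le (s := s) hD1 (R := 2) (w := D)
    (fun d hd => abs_rem_progressionSieve_le hr hy0.le (Nat.dvd_of_mem_divisors hd))
    (fun d hd => by
      split_ifs with h
      · refine (abs_optimalWeight_le hD1).trans ?_
        change |((d : ℝ)⁻¹)⁻¹| ≤ D
        rw [inv_inv, abs_of_nonneg (Nat.cast_nonneg _)]
        exact_mod_cast h
      · rw [optimalWeight_eq_zero (not_le.1 h), abs_zero])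
  have hG := sieveDensity_pos (s := s) hD1
  have hGl : Real.log y / 40 ≤ sieveDensity s D * Pr := by
    have h1 := le_sieveDensity (y := y) (b := b) (D := D) hr
    have h2 : Real.log (y ^ (1 / 20 : ℝ)) ≤ Real.log (D + 1) :=
      Real.log_le_log (by linarith) (Nat.lt_floor_add_one _).le
    rw [Real.log_rpow hy0] at h2
    linarith
  -- Primes up to D may be removed by the sieve, so they are counted trivially. The main term
  -- contributes 40 and the error 3D⁴ at most 6, within the final 50.
  have hcard : (S.card : ℝ) ≤ D + s.siftedSum := by
    have hsub : S ⊆ Icc 1 D ∪ s.support.filter (Nat.Coprime s.prodPrimes) := by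
      intro p hp
      obtain ⟨h1, h2, h3⟩ := hS p hp
      rw [mem_union, mem_Icc, mem_filter]
      by_cases hpD : p ≤ D
      · exact Or.inl ⟨h1.one_le, hpD⟩
      · refine Or.inr ⟨mem_filter.2 ⟨mem_Ioc.2 ⟨h1.pos, Nat.le_floor h2⟩, h3⟩, ?_⟩
        rw [hs, progressionSieve_prodPrimes]
        refine Nat.Coprime.prod_left fun q hq => ?_
        obtain ⟨hq1, hq2, -⟩ := mem_filter.1 hq
        rw [mem_Icc] at hq1
        exact (Nat.coprime_primes hq2 h1).2 (by omega)
    have h1 := (card_le_card hsub).trans (card_union_le _ _)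
    have h2 : s.siftedSum = ((s.support.filter (Nat.Coprime s.prodPrimes)).card : ℝ) := by
      rw [BoundingSieve.siftedSum, ← sum_filter]
      change ∑ _ ∈ _, (1 : ℝ) = _
      simp
    rw [h2]
    simp only [Nat.card_Icc, Nat.add_sub_cancel] at h1
    exact_mod_cast h1
  have hmain : s.totalMass * (sieveDensity s D)⁻¹ ≤ 40 * (y / (r * Real.log y)) * Pr := by
    change y / r * _ ≤ _
    have : (sieveDensity s D)⁻¹ ≤ 40 * Pr / Real.log y := by
      rw [inv_le_iff_one_le_mul₀ hG, mul_comm, ← mul_div_assoc, le_div_iff₀ hlog]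
      linarith
    calc y / r * (sieveDensity s D)⁻¹ ≤ y / r * (40 * Pr / Real.log y) := by gcongr
      _ = _ := by field_simp
  have hD4 : (D : ℝ) ^ 4 ≤ y ^ (1 / 5 : ℝ) := by
    calc (D : ℝ) ^ 4 ≤ (y ^ (1 / 20 : ℝ)) ^ 4 := by gcongr
      _ = y ^ (1 / 5 : ℝ) := by
        rw [← Real.rpow_natCast, ← Real.rpow_mul hy0.le]; norm_num
  have herr : y ^ (1 / 5 : ℝ) ≤ 2 * (y / (r * Real.log y)) := by
    have hr4 : (r : ℝ) ≤ y ^ (1 / 4 : ℝ) := by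
      have := Real.rpow_le_rpow (by positivity) hry (show (0 : ℝ) ≤ 1 / 4 by norm_num)
      rwa [← Real.rpow_natCast, ← Real.rpow_mul hr'.le, show ((4 : ℕ) : ℝ) * (1 / 4) = 1 by norm_num,
        Real.rpow_one] at this
    have hl : Real.log y ≤ 2 * y ^ (11 / 20 : ℝ) := by
      have := Real.log_le_rpow_div hy0.le (show (0 : ℝ) < 11 / 20 by norm_num)
      have h0 : 0 ≤ y ^ (11 / 20 : ℝ) := by positivity
      refine this.trans ?_
      rw [div_le_iff₀ (by norm_num)]
      linarith
    rw [mul_div_assoc', le_div_iff₀ (by positivity)]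
    calc y ^ (1 / 5 : ℝ) * (r * Real.log y) ≤
          y ^ (1 / 5 : ℝ) * (y ^ (1 / 4 : ℝ) * (2 * y ^ (11 / 20 : ℝ))) := by gcongr
      _ = 2 * (y ^ (1 / 5 : ℝ) * y ^ (1 / 4 : ℝ) * y ^ (11 / 20 : ℝ)) := by ring
      _ = 2 * y := by
        rw [← Real.rpow_add hy0, ← Real.rpow_add hy0]; norm_num
  have hDD : (D : ℝ) ≤ D ^ 4 := le_self_pow₀ hD1' (by norm_num)
  have hX : 0 ≤ y / (r * Real.log y) := by positivity
  have hXPr : y / (r * Real.log y) ≤ y / (r * Real.log y) * Pr := le_mul_of_one_le_right hX hPr1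
  have e : (2 : ℝ) * ((D : ℝ) * D) ^ 2 = 2 * (D : ℝ) ^ 4 := by ring
  rw [e] at hsift
  linarith

end BrunTitchmarsh

/-! ### Multiplicativity of the sets A_q and of ρ. -/

section ChineseRemainder

variable {n : ℕ} {r s : ℕ}

/-- Reduction of a vector modulo a divisor. -/
def reduceVec {q r : ℕ} (h : r ∣ q) (x : Fin n → ZMod q) : Fin n → ZMod r :=
  fun i => ZMod.castHom h (ZMod r) (x i)

theorem mem_residueSet_iff {A : LocalSets n} {q : ℕ} {x : Fin n → ZMod q} :
    x ∈ residueSet A q ↔ ∀ (p v : ℕ) (_ : p.Prime) (_ : 1 ≤ v) (h : p ^ v ∣ q)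
      (_ : ¬ p ^ (v + 1) ∣ q), reduceVec h x ∈ A (p ^ v) := Iff.rfl

theorem reduceVec_reduceVec {q r t : ℕ} (h : r ∣ q) (h' : t ∣ r) (x : Fin n → ZMod q) :
    reduceVec h' (reduceVec h x) = reduceVec (h'.trans h) x := by
  funext i
  have : (ZMod.castHom h' (ZMod t)).comp (ZMod.castHom h (ZMod r)) =
      ZMod.castHom (h'.trans h) (ZMod t) := Subsingleton.elim _ _
  exact congrArg (fun f : ZMod q →+* ZMod t => f (x i)) this

theorem residueSet_one (A : LocalSets n) : residueSet A 1 = Set.univ := by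
  refine Set.eq_univ_of_forall fun x p v hp hv h => ?_
  exact absurd (Nat.dvd_one.1 ((dvd_pow_self p (by omega)).trans h)) hp.one_lt.ne'

theorem rho_one (A : LocalSets n) : rho A 1 = 1 := by
  rw [rho, residueSet_one, Set.ncard_univ]
  simp

/-- A prime dividing rs divides only one of the coprime factors, and which of its powers divide the
product is decided by that factor. -/
theorem mem_residueSet_mul (A : LocalSets n) (hrs : Nat.Coprime r s) (x : Fin n → ZMod (r * s)) :
    x ∈ residueSet A (r * s) ↔ reduceVec (dvd_mul_right r s) x ∈ residueSet A r ∧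
      reduceVec (dvd_mul_left s r) x ∈ residueSet A s := by
  have key : ∀ {a b : ℕ}, Nat.Coprime a b → ∀ {p v : ℕ}, p.Prime → p ∣ a →
      (p ^ v ∣ a * b ↔ p ^ v ∣ a) := by
    intro a b hab p v hp hpa
    refine ⟨fun h => ?_, fun h => h.trans (dvd_mul_right _ _)⟩
    exact (Nat.Coprime.pow_left v ((hp.coprime_iff_not_dvd).2 fun hpb =>
      Nat.not_coprime_of_dvd_of_dvd hp.one_lt hpa hpb hab)).dvd_of_dvd_mul_right h
  simp only [mem_residueSet_iff]
  constructor
  · intro hx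
    refine ⟨fun p v hp hv h h' => ?_, fun p v hp hv h h' => ?_⟩
    · have hpr : p ∣ r := (dvd_pow_self p (by omega)).trans h
      rw [reduceVec_reduceVec]
      exact hx p v hp hv _ fun h'' => h' ((key hrs hp hpr).1 h'')
    · have hps : p ∣ s := (dvd_pow_self p (by omega)).trans h
      rw [reduceVec_reduceVec]
      exact hx p v hp hv _ fun h'' => h' ((key hrs.symm hp hps).1 (mul_comm r s ▸ h''))
  · rintro ⟨h1, h2⟩ p v hp hv h h'
    have hp' : p ∣ r * s := (dvd_pow_self p (by omega)).trans h
    rcases (hp.dvd_mul).1 hp' with hpr | hps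
    · have h3 := (key hrs hp hpr).1 h
      have := h1 p v hp hv h3 fun h'' => h' ((key hrs hp hpr).2 h'')
      rwa [reduceVec_reduceVec] at this
    · have h3 := (key hrs.symm hp hps).1 (mul_comm r s ▸ h)
      have := h2 p v hp hv h3 fun h'' => h' (mul_comm r s ▸ (key hrs.symm hp hps).2 h'')
      rwa [reduceVec_reduceVec] at this

/-- The Chinese Remainder Theorem for vectors. -/
noncomputable def vecEquiv (hrs : Nat.Coprime r s) :
    (Fin n → ZMod (r * s)) ≃ (Fin n → ZMod r) × (Fin n → ZMod s) :=
  (Equiv.arrowCongr (Equiv.refl (Fin n)) (ZMod.chineseRemainder hrs).toEquiv).trans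
    (Equiv.arrowProdEquivProdArrow _ _ _)

theorem chineseRemainder_fst (hrs : Nat.Coprime r s) (t : ZMod (r * s)) :
    (ZMod.chineseRemainder hrs t).1 = ZMod.castHom (dvd_mul_right r s) (ZMod r) t := by
  have : (RingHom.fst (ZMod r) (ZMod s)).comp (ZMod.chineseRemainder hrs).toRingHom =
      ZMod.castHom (dvd_mul_right r s) (ZMod r) := Subsingleton.elim _ _
  exact congrArg (fun f : ZMod (r * s) →+* ZMod r => f t) this

theorem chineseRemainder_snd (hrs : Nat.Coprime r s) (t : ZMod (r * s)) :
    (ZMod.chineseRemainder hrs t).2 = ZMod.castHom (dvd_mul_left s r) (ZMod s) t := by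
  have : (RingHom.snd (ZMod r) (ZMod s)).comp (ZMod.chineseRemainder hrs).toRingHom =
      ZMod.castHom (dvd_mul_left s r) (ZMod s) := Subsingleton.elim _ _
  exact congrArg (fun f : ZMod (r * s) →+* ZMod s => f t) this

theorem vecEquiv_apply (hrs : Nat.Coprime r s) (x : Fin n → ZMod (r * s)) :
    vecEquiv hrs x = (reduceVec (dvd_mul_right r s) x, reduceVec (dvd_mul_left s r) x) := by
  refine Prod.ext (funext fun i => ?_) (funext fun i => ?_)
  · exact chineseRemainder_fst hrs (x i)
  · exact chineseRemainder_snd hrs (x i)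

theorem rho_mul (A : LocalSets n) (hrs : Nat.Coprime r s) :
    rho A (r * s) = rho A r * rho A s := by
  have : residueSet A (r * s) = (vecEquiv hrs).symm '' (residueSet A r ×ˢ residueSet A s) := by
    ext x
    rw [Equiv.image_symm_eq_preimage, Set.mem_preimage, vecEquiv_apply, Set.mem_prod,
      mem_residueSet_mul A hrs]
  rw [rho, this, Set.ncard_image_of_injective _ (Equiv.injective _), Set.ncard_prod]
  rfl

theorem rho_eq_prod (A : LocalSets n) {q : ℕ} (hq : q ≠ 0) :
    rho A q = q.factorization.prod fun p k => rho A (p ^ k) :=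
  Nat.multiplicative_factorization (rho A) (fun _ _ h => rho_mul A h) (rho_one A) hq

end ChineseRemainder

/-! ### Normalized exponential sums, their twisted multiplicativity and their means over units. -/

section ExponentialSums

open Finset

variable {n : ℕ} {r s : ℕ}

/-- `e(t / q)` for `t` modulo `q`. -/
noncomputable def expZMod (q : ℕ) (t : ZMod q) : ℂ :=
  Complex.exp (2 * Real.pi * Complex.I * t.val / q)

theorem expZMod_eq (q : ℕ) [NeZero q] (t : ZMod q) : expZMod q t = ZMod.stdAddChar t := by
  rw [ZMod.stdAddChar_apply, ZMod.toCircle_apply, expZMod]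

theorem expZMod_intCast (q : ℕ) [NeZero q] (j : ℤ) :
    expZMod q (j : ZMod q) = Complex.exp (2 * Real.pi * Complex.I * j / q) := by
  rw [expZMod_eq, ZMod.stdAddChar_coe]

theorem norm_expZMod (q : ℕ) (t : ZMod q) : ‖expZMod q t‖ = 1 := by
  have : (2 * Real.pi * Complex.I * t.val / q : ℂ) =
      ((2 * Real.pi * t.val / q : ℝ) : ℂ) * Complex.I := by
    push_cast; ring
  rw [expZMod, this, Complex.norm_exp_ofReal_mul_I]

/-- Dividing Bézout's identity ru + sv = 1 by rs splits j/(rs) as jv/r + ju/s, where v inverts s mod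
r and u inverts r mod s. -/
theorem expZMod_mul [NeZero r] [NeZero s] (hrs : Nat.Coprime r s) (t : ZMod (r * s)) :
    expZMod (r * s) t =
      expZMod r (ZMod.castHom (dvd_mul_right r s) (ZMod r) t * (ZMod.unitOfCoprime s hrs.symm)⁻¹) *
      expZMod s (ZMod.castHom (dvd_mul_left s r) (ZMod s) t * (ZMod.unitOfCoprime r hrs)⁻¹) := by
  have : NeZero (r * s) := ⟨mul_ne_zero (NeZero.ne r) (NeZero.ne s)⟩
  obtain ⟨j, rfl⟩ := ZMod.intCast_surjective t
  have hbez : (r : ℤ) * Nat.gcdA r s + s * Nat.gcdB r s = 1 := by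
    have := Nat.gcd_eq_gcd_ab r s
    rw [hrs] at this
    exact_mod_cast this.symm
  have h1 : (((ZMod.unitOfCoprime s hrs.symm)⁻¹ : (ZMod r)ˣ) : ZMod r) =
      ((Nat.gcdB r s : ℤ) : ZMod r) := by
    refine Units.inv_eq_of_mul_eq_one_right ?_
    have := congrArg (Int.cast : ℤ → ZMod r) hbez
    push_cast at this
    rw [ZMod.natCast_self, zero_mul, zero_add] at this
    simpa using this
  have h2 : (((ZMod.unitOfCoprime r hrs)⁻¹ : (ZMod s)ˣ) : ZMod s) =
      ((Nat.gcdA r s : ℤ) : ZMod s) := by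
    refine Units.inv_eq_of_mul_eq_one_right ?_
    have := congrArg (Int.cast : ℤ → ZMod s) hbez
    push_cast at this
    rw [ZMod.natCast_self, zero_mul, add_zero] at this
    simpa using this
  rw [h1, h2, map_intCast, map_intCast, ← Int.cast_mul, ← Int.cast_mul, expZMod_intCast,
    expZMod_intCast, expZMod_intCast, ← Complex.exp_add]
  congr 1
  have hr : (r : ℂ) ≠ 0 := by exact_mod_cast NeZero.ne r
  have hs : (s : ℂ) ≠ 0 := by exact_mod_cast NeZero.ne s
  have hb : (r : ℂ) * Nat.gcdA r s + s * Nat.gcdB r s = 1 := by exact_mod_cast hbez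
  push_cast
  field_simp
  linear_combination (-(j : ℂ)) * hb

/-- The normalized exponential sum `ρ(q)⁻¹ ∑_{a ∈ A_q} e(u (h · a) / q)`. -/
noncomputable def expSum (A : LocalSets n) (h : Fin n → ℤ) (q : ℕ) (u : ZMod q) : ℂ :=
  ((rho A q : ℂ))⁻¹ * ∑ᶠ a : Fin n → ZMod q,
    (residueSet A q).indicator (fun a => expZMod q (u * ∑ i, (h i : ZMod q) * a i)) a

theorem expSum_eq (A : LocalSets n) (h : Fin n → ℤ) (q : ℕ) [NeZero q] (u : ZMod q) :
    expSum A h q u = ((rho A q : ℂ))⁻¹ * ∑ a : Fin n → ZMod q,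
      (residueSet A q).indicator (fun a => expZMod q (u * ∑ i, (h i : ZMod q) * a i)) a := by
  rw [expSum, finsum_eq_sum_of_fintype]

theorem rho_eq_sum (A : LocalSets n) (q : ℕ) [NeZero q] :
    (rho A q : ℝ) = ∑ a : Fin n → ZMod q, (residueSet A q).indicator (fun _ => (1 : ℝ)) a := by
  classical
  rw [rho, Set.ncard_eq_toFinset_card']
  simp [Set.indicator_apply, Set.toFinset_card, Fintype.card_subtype]

theorem norm_expSum_le_one (A : LocalSets n) (h : Fin n → ℤ) (q : ℕ) [NeZero q] (u : ZMod q) :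
    ‖expSum A h q u‖ ≤ 1 := by
  rw [expSum_eq, norm_mul, norm_inv, Complex.norm_natCast]
  have h1 : ‖∑ a : Fin n → ZMod q, (residueSet A q).indicator
      (fun a => expZMod q (u * ∑ i, (h i : ZMod q) * a i)) a‖ ≤ rho A q := by
    rw [rho_eq_sum]
    refine (norm_sum_le _ _).trans (sum_le_sum fun a _ => ?_)
    rw [norm_indicator_eq_indicator_norm]
    simp only [norm_expZMod]
    exact le_rfl
  calc _ ≤ ((rho A q : ℝ))⁻¹ * rho A q := by gcongr
    _ ≤ 1 := inv_mul_le_one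

/-- Twisted multiplicativity of the exponential sums. -/
theorem expSum_mul (A : LocalSets n) (h : Fin n → ℤ) [NeZero r] [NeZero s]
    (hrs : Nat.Coprime r s) (u : ZMod (r * s)) :
    expSum A h (r * s) u =
      expSum A h r
        (ZMod.castHom (dvd_mul_right r s) (ZMod r) u * (ZMod.unitOfCoprime s hrs.symm)⁻¹) *
      expSum A h s
        (ZMod.castHom (dvd_mul_left s r) (ZMod s) u * (ZMod.unitOfCoprime r hrs)⁻¹) := by
  classical
  have : NeZero (r * s) := ⟨mul_ne_zero (NeZero.ne r) (NeZero.ne s)⟩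
  rw [expSum_eq, expSum_eq, expSum_eq, mul_mul_mul_comm, rho_mul A hrs, Finset.sum_mul_sum,
    ← Finset.sum_product', Finset.univ_product_univ]
  congr 1
  · push_cast; rw [mul_inv]
  refine Fintype.sum_equiv (vecEquiv hrs) _ _ fun a => ?_
  rw [vecEquiv_apply]
  simp only [Set.indicator_apply, mem_residueSet_mul A hrs]
  by_cases h1 : reduceVec (dvd_mul_right r s) a ∈ residueSet A r
  · by_cases h2 : reduceVec (dvd_mul_left s r) a ∈ residueSet A s
    · simp only [h1, h2, and_self, if_true]
      rw [expZMod_mul hrs]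
      simp only [map_mul, map_sum, map_intCast, reduceVec]
      congr 2 <;> ring
    · simp [h2]
  · simp [h1]

/-- The sum of `|expSum|` over the reduced residues. -/
noncomputable def unitSum (A : LocalSets n) (h : Fin n → ℤ) (q : ℕ) : ℝ :=
  ∑ᶠ u : (ZMod q)ˣ, ‖expSum A h q (u : ZMod q)‖

theorem unitSum_eq (A : LocalSets n) (h : Fin n → ℤ) (q : ℕ) [NeZero q] :
    unitSum A h q = ∑ u : (ZMod q)ˣ, ‖expSum A h q (u : ZMod q)‖ := by
  rw [unitSum, finsum_eq_sum_of_fintype]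

theorem unitSum_nonneg (A : LocalSets n) (h : Fin n → ℤ) (q : ℕ) : 0 ≤ unitSum A h q :=
  finsum_nonneg fun _ => norm_nonneg _

theorem unitSum_le (A : LocalSets n) (h : Fin n → ℤ) (q : ℕ) [NeZero q] :
    unitSum A h q ≤ q := by
  rw [unitSum_eq]
  calc _ ≤ ∑ _u : (ZMod q)ˣ, (1 : ℝ) := sum_le_sum fun u _ => norm_expSum_le_one A h q _
    _ = Nat.totient q := by simp [ZMod.card_units_eq_totient]
    _ ≤ q := by exact_mod_cast Nat.totient_le q

/-- The twists are multiplications by units, so they only permute the summands and disappear after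
summing over all units. -/
theorem unitSum_mul_of_neZero (A : LocalSets n) (h : Fin n → ℤ) [NeZero r] [NeZero s]
    (hrs : Nat.Coprime r s) : unitSum A h (r * s) = unitSum A h r * unitSum A h s := by
  have : NeZero (r * s) := ⟨mul_ne_zero (NeZero.ne r) (NeZero.ne s)⟩
  rw [unitSum_eq, unitSum_eq, unitSum_eq, Finset.sum_mul_sum, ← Finset.sum_product',
    Finset.univ_product_univ]
  let e : (ZMod (r * s))ˣ ≃ (ZMod r)ˣ × (ZMod s)ˣ :=
    ((Units.mapEquiv (ZMod.chineseRemainder hrs).toMulEquiv).trans MulEquiv.prodUnits).toEquiv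
  let e' : (ZMod r)ˣ × (ZMod s)ˣ ≃ (ZMod r)ˣ × (ZMod s)ˣ :=
    Equiv.prodCongr (Equiv.mulRight (ZMod.unitOfCoprime s hrs.symm)⁻¹)
      (Equiv.mulRight (ZMod.unitOfCoprime r hrs)⁻¹)
  refine Fintype.sum_equiv (e.trans e') _ _ fun u => ?_
  rw [expSum_mul A h hrs, norm_mul]
  have h1 : (((e u).1 : (ZMod r)ˣ) : ZMod r) = ZMod.castHom (dvd_mul_right r s) (ZMod r) u :=
    chineseRemainder_fst hrs u
  have h2 : (((e u).2 : (ZMod s)ˣ) : ZMod s) = ZMod.castHom (dvd_mul_left s r) (ZMod s) u :=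
    chineseRemainder_snd hrs u
  rw [← h1, ← h2]
  rfl

theorem unitSum_one (A : LocalSets n) (h : Fin n → ℤ) : unitSum A h 1 = 1 := by
  rw [unitSum_eq]
  have : ∀ u : (ZMod 1)ˣ, ‖expSum A h 1 (u : ZMod 1)‖ = 1 := fun u => by
    rw [expSum_eq, rho_one, residueSet_one]
    simp [norm_expZMod]
  simp [this]

theorem card_hyperplane_le_lam (A : LocalSets n) (p : ℕ) [NeZero p] (h : Fin n → ZMod p)
    (hh : h ≠ 0) (c : ZMod p) :
    ({x : Fin n → ZMod p | ∑ i, h i * x i = c} ∩ residueSet A p).ncard ≤ lam A p := by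
  refine le_csSup ⟨rho A p, ?_⟩ ⟨_, ⟨h, hh, c, rfl⟩, rfl⟩
  rintro m ⟨H, -, rfl⟩
  exact Set.ncard_le_ncard Set.inter_subset_right (Set.toFinite _)

/-- Orthogonality: opening the square and summing over u leaves p times the number of pairs (a, b)
in A_p with h·a = h·b. For each a, the admissible b lie on one affine hyperplane, a true one because
h ≠ 0 mod p, so there are at most λ(p) of them. -/
theorem sum_norm_sq_expSum_le (A : LocalSets n) (h : Fin n → ℤ) (p : ℕ) [NeZero p]
    (hh : (fun i => (h i : ZMod p)) ≠ 0) :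
    ∑ u : ZMod p, ‖expSum A h p u‖ ^ 2 ≤ p * ((lam A p : ℝ) / rho A p) := by
  classical
  rcases Nat.eq_zero_or_pos (rho A p) with h0 | h0
  · have : ∀ u, expSum A h p u = 0 := fun u => by simp [expSum, h0]
    simp [this, h0]
  have hρ : (0 : ℝ) < rho A p := by exact_mod_cast h0
  set t : (Fin n → ZMod p) → ZMod p := fun a => ∑ i, (h i : ZMod p) * a i with ht
  set F : Finset (Fin n → ZMod p) := univ.filter (· ∈ residueSet A p) with hF
  have hcardF : F.card = rho A p := by
    rw [rho, Set.ncard_eq_toFinset_card']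
    congr 1
    ext a; simp [hF]
  have hsum : ∀ u, ∑ a : Fin n → ZMod p, (residueSet A p).indicator
      (fun a => expZMod p (u * ∑ i, (h i : ZMod p) * a i)) a =
      ∑ a ∈ F, ZMod.stdAddChar (u * t a) := fun u => by
    rw [hF, sum_filter]
    refine sum_congr rfl fun a _ => ?_
    rw [Set.indicator_apply, expZMod_eq]
  have hnorm : ∀ u, ((‖∑ a ∈ F, ZMod.stdAddChar (u * t a)‖ ^ 2 : ℝ) : ℂ) =
      ∑ a ∈ F, ∑ b ∈ F, (ZMod.stdAddChar (u * (t a - t b)) : ℂ) := fun u => by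
    rw [Complex.ofReal_pow, ← Complex.mul_conj', map_sum, sum_mul_sum]
    refine sum_congr rfl fun a _ => sum_congr rfl fun b _ => ?_
    rw [← AddChar.map_neg_eq_conj, ← AddChar.map_add_eq_mul]
    congr 1; ring
  have htotal : ((∑ u : ZMod p, ‖∑ a ∈ F, ZMod.stdAddChar (u * t a)‖ ^ 2 : ℝ) : ℂ) =
      ∑ a ∈ F, ∑ b ∈ F, if t a = t b then (p : ℂ) else 0 := by
    rw [Complex.ofReal_sum, sum_congr rfl fun u _ => hnorm u, sum_comm]
    refine sum_congr rfl fun a _ => ?_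
    rw [sum_comm]
    refine sum_congr rfl fun b _ => ?_
    rw [AddChar.sum_mulShift _ (ZMod.isPrimitive_stdAddChar p), ZMod.card]
    simp [sub_eq_zero]
  have htotal' : (∑ u : ZMod p, ‖∑ a ∈ F, ZMod.stdAddChar (u * t a)‖ ^ 2 : ℝ) =
      ∑ a ∈ F, ∑ b ∈ F, if t a = t b then (p : ℝ) else 0 := by
    apply Complex.ofReal_injective
    rw [htotal, Complex.ofReal_sum]
    refine sum_congr rfl fun a _ => ?_
    rw [Complex.ofReal_sum]
    refine sum_congr rfl fun b _ => ?_
    split_ifs <;> simp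
  have hle : (∑ a ∈ F, ∑ b ∈ F, if t a = t b then (p : ℝ) else 0) ≤
      rho A p * (p * lam A p) := by
    rw [← hcardF, ← nsmul_eq_mul]
    refine sum_le_card_nsmul _ _ _ fun a _ => ?_
    rw [← sum_filter, sum_const, nsmul_eq_mul, mul_comm]
    refine mul_le_mul_of_nonneg_left ?_ (Nat.cast_nonneg _)
    have := card_hyperplane_le_lam A p _ hh (t a)
    rw [Set.ncard_eq_toFinset_card'] at this
    refine le_trans ?_ (Nat.cast_le.2 this)
    refine Nat.cast_le.2 (card_le_card fun b hb => ?_)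
    simp only [hF, mem_filter, mem_univ, true_and] at hb
    rw [Set.mem_toFinset]
    exact ⟨hb.2.symm, hb.1⟩
  calc ∑ u : ZMod p, ‖expSum A h p u‖ ^ 2
      = ((rho A p : ℝ))⁻¹ ^ 2 * ∑ u : ZMod p, ‖∑ a ∈ F, ZMod.stdAddChar (u * t a)‖ ^ 2 := by
        rw [mul_sum]
        refine sum_congr rfl fun u _ => ?_
        rw [expSum_eq, hsum, norm_mul, norm_inv, Complex.norm_natCast, mul_pow]
    _ ≤ ((rho A p : ℝ))⁻¹ ^ 2 * (rho A p * (p * lam A p)) := by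
        rw [htotal']; gcongr
    _ = p * ((lam A p : ℝ) / rho A p) := by field_simp

/-- Cauchy–Schwarz over all p residues, after adding the residue 0 to the units. -/
theorem unitSum_prime_le (A : LocalSets n) (h : Fin n → ℤ) (p : ℕ) [NeZero p]
    (hh : (fun i => (h i : ZMod p)) ≠ 0) :
    unitSum A h p ≤ p * √((lam A p : ℝ) / rho A p) := by
  have hp : (0 : ℝ) ≤ p := Nat.cast_nonneg _
  have hx : (0 : ℝ) ≤ (lam A p : ℝ) / rho A p := by positivity
  have h1 : unitSum A h p ≤ ∑ u : ZMod p, ‖expSum A h p u‖ := by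
    rw [unitSum_eq]
    have : ∑ u : (ZMod p)ˣ, ‖expSum A h p (u : ZMod p)‖ =
        ∑ u ∈ (univ : Finset (ZMod p)ˣ).map ⟨_, Units.val_injective⟩, ‖expSum A h p u‖ := by
      rw [sum_map]; rfl
    rw [this]
    exact sum_le_sum_of_subset_of_nonneg (subset_univ _) fun _ _ _ => norm_nonneg _
  refine h1.trans (le_of_sq_le_sq ?_ (by positivity))
  have h2 := sq_sum_le_card_mul_sum_sq (s := (univ : Finset (ZMod p)))
    (f := fun u => ‖expSum A h p u‖)
  rw [card_univ, ZMod.card] at h2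
  refine h2.trans ?_
  rw [mul_pow, Real.sq_sqrt hx, sq, mul_assoc]
  exact mul_le_mul_of_nonneg_left (sum_norm_sq_expSum_le A h p hh) hp

end ExponentialSums

/-! ### Trigonometric majorants of arcs from the Fejér kernel. -/

section FejerKernel

open Finset Real

/-- The exponential `x ↦ e(m x)`. -/
noncomputable def circleExp (m : ℤ) (x : ℝ) : ℂ :=
  Complex.exp (2 * π * Complex.I * m * x)

theorem circleExp_zero (x : ℝ) : circleExp 0 x = 1 := by simp [circleExp]

theorem circleExp_add (m k : ℤ) (x : ℝ) : circleExp (m + k) x = circleExp m x * circleExp k x := by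
  rw [circleExp, circleExp, circleExp, ← Complex.exp_add]
  congr 1; push_cast; ring

theorem circleExp_sub_right (m : ℤ) (x t : ℝ) :
    circleExp m (x - t) = circleExp m x * circleExp (-m) t := by
  rw [circleExp, circleExp, circleExp, ← Complex.exp_add]
  congr 1; push_cast; ring

theorem circleExp_eq_exp_ofReal (m : ℤ) (x : ℝ) :
    circleExp m x = Complex.exp (Complex.I * (2 * π * m * x : ℝ)) := by
  rw [circleExp]; congr 1; push_cast; ring

theorem norm_circleExp (m : ℤ) (x : ℝ) : ‖circleExp m x‖ = 1 := by
  rw [circleExp_eq_exp_ofReal, Complex.norm_exp_I_mul_ofReal]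

theorem circleExp_add_intCast (m : ℤ) (x : ℝ) (j : ℤ) : circleExp m (x + j) = circleExp m x := by
  rw [circleExp, circleExp]
  rw [show (2 * π * Complex.I * m * ((x + j : ℝ) : ℂ)) =
    2 * π * Complex.I * m * x + ((m * j : ℤ) : ℂ) * (2 * π * Complex.I) by push_cast; ring]
  rw [Complex.exp_add, Complex.exp_int_mul_two_pi_mul_I, mul_one]

theorem conj_circleExp (m : ℤ) (x : ℝ) : (starRingEnd ℂ) (circleExp m x) = circleExp (-m) x := by
  rw [circleExp, circleExp, ← Complex.exp_conj]
  congr 1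
  simp [map_ofNat]

theorem continuous_circleExp (m : ℤ) : Continuous (circleExp m) := by
  unfold circleExp; fun_prop

theorem norm_integral_circleExp_le {m : ℤ} (hm : m ≠ 0) (c d : ℝ) :
    ‖∫ t in c..d, circleExp m t‖ ≤ 1 / |(m : ℝ)| := by
  have hm' : (2 * π * Complex.I * m : ℂ) ≠ 0 := by
    simp [hm, Real.pi_ne_zero, Complex.I_ne_zero]
  have h := integral_exp_mul_complex (a := c) (b := d) hm'
  have h2 : ∫ t in c..d, circleExp m t = (circleExp m d - circleExp m c) / (2 * π * Complex.I * m) :=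
    h
  have hmr : 0 < |(m : ℝ)| := abs_pos.2 (by exact_mod_cast hm)
  have hden : ‖(2 * π * Complex.I * m : ℂ)‖ = 2 * π * |(m : ℝ)| := by
    simp [abs_of_pos Real.pi_pos]
  rw [h2, norm_div, hden, div_le_div_iff₀ (by positivity) hmr, one_mul]
  have h3 : ‖circleExp m d - circleExp m c‖ ≤ 2 := by
    refine (norm_sub_le _ _).trans ?_
    rw [norm_circleExp, norm_circleExp]; norm_num
  have h4 : (2 : ℝ) ≤ 2 * π := by linarith [Real.pi_gt_three]
  exact mul_le_mul_of_nonneg_right (h3.trans h4) hmr.le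

theorem integral_circleExp_period {m : ℤ} (hm : m ≠ 0) (c : ℝ) :
    ∫ t in c..(c + 1), circleExp m t = 0 := by
  have hm' : (2 * π * Complex.I * m : ℂ) ≠ 0 := by
    simp [hm, Real.pi_ne_zero, Complex.I_ne_zero]
  have h := integral_exp_mul_complex (a := c) (b := c + 1) hm'
  have h2 : ∫ t in c..(c + 1), circleExp m t =
      (circleExp m (c + 1) - circleExp m c) / (2 * π * Complex.I * m) := h
  have h3 : circleExp m (c + 1) = circleExp m c := by
    have := circleExp_add_intCast m c 1
    simpa using this
  rw [h2, h3, sub_self, zero_div]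

/-- The frequency attached to a pair of indices. -/
def pairFreq {N : ℕ} (τ : Fin N × Fin N) : ℤ := (τ.1 : ℤ) - (τ.2 : ℤ)

/-- Upper bounds for the Fourier coefficients. -/
noncomputable def pairWeight {N : ℕ} (τ : Fin N × Fin N) : ℝ :=
  1 / N * if τ.1 = τ.2 then 1 else 1 / |(pairFreq τ : ℝ)|

theorem pairWeight_nonneg {N : ℕ} (τ : Fin N × Fin N) : 0 ≤ pairWeight τ := by
  unfold pairWeight; split_ifs <;> positivity

theorem pairFreq_eq_zero_iff {N : ℕ} (τ : Fin N × Fin N) : pairFreq τ = 0 ↔ τ.1 = τ.2 := by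
  rw [pairFreq, sub_eq_zero, Nat.cast_inj, Fin.val_inj]

theorem abs_pairFreq_le {N : ℕ} (τ : Fin N × Fin N) : |pairFreq τ| ≤ N := by
  rw [pairFreq, abs_le]
  have := τ.1.2; have := τ.2.2
  constructor <;> omega

/-- The Fejér kernel. -/
noncomputable def fejer (N : ℕ) (u : ℝ) : ℝ := ‖∑ j : Fin N, circleExp (j : ℤ) u‖ ^ 2 / N

theorem fejer_nonneg (N : ℕ) (u : ℝ) : 0 ≤ fejer N u := by unfold fejer; positivity

theorem continuous_fejer (N : ℕ) : Continuous (fejer N) := by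
  unfold fejer
  have := fun j : Fin N => continuous_circleExp (j : ℤ)
  fun_prop

/-- Terms stay indexed by pairs (j, l) instead of being grouped by the frequency j - l: the Fejér
coefficients become the constant 1/N, and frequency 0 is spread over the N diagonal pairs. -/
theorem fejer_eq_sum (N : ℕ) (u : ℝ) :
    (fejer N u : ℂ) = ∑ τ : Fin N × Fin N, (1 / N : ℂ) * circleExp (pairFreq τ) u := by
  rw [fejer]
  push_cast
  rw [← Complex.mul_conj', map_sum, sum_mul_sum, ← sum_product', univ_product_univ, sum_div]
  refine sum_congr rfl fun τ _ => ?_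
  rw [conj_circleExp, ← circleExp_add, pairFreq, sub_eq_add_neg]
  ring

/-- The exponential sum is geometric with ratio z, and Jordan's inequality gives |z - 1| = 2|sin πu|
≥ 4η, so it is at most 2/(4η). -/
theorem fejer_le {N : ℕ} (hN : 1 ≤ N) {η : ℝ} (hη : 0 < η) {u : ℝ}
    (h1 : η ≤ u) (h2 : u ≤ 1 - η) : fejer N (-u) ≤ 1 / (4 * N * η ^ 2) := by
  have hN' : (0 : ℝ) < N := by exact_mod_cast hN
  set z := circleExp 1 (-u) with hz
  have hpow : ∀ j : ℕ, circleExp (j : ℤ) (-u) = z ^ j := fun j => by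
    rw [hz, circleExp, circleExp, ← Complex.exp_nat_mul]
    congr 1; push_cast; ring
  have hz1 : 4 * η ≤ ‖z - 1‖ := by
    rw [hz, circleExp_eq_exp_ofReal, Complex.norm_exp_I_mul_ofReal_sub_one]
    have e : (2 * π * (1 : ℤ) * (-u)) / 2 = -(π * u) := by push_cast; ring
    rw [e, Real.sin_neg, mul_neg, norm_neg, Real.norm_eq_abs]
    have hs : 2 * η ≤ Real.sin (π * u) := by
      rcases le_total u (1 / 2) with hu | hu
      · have := Real.mul_le_sin (x := π * u) (by have := Real.pi_pos; nlinarith)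
          (by have := Real.pi_pos; nlinarith)
        have e2 : 2 / π * (π * u) = 2 * u := by field_simp
        linarith
      · have := Real.mul_le_sin (x := π * (1 - u)) (by have := Real.pi_pos; nlinarith)
          (by have := Real.pi_pos; nlinarith)
        have e2 : 2 / π * (π * (1 - u)) = 2 * (1 - u) := by field_simp
        have e3 : Real.sin (π * (1 - u)) = Real.sin (π * u) := by
          rw [show π * (1 - u) = π - π * u by ring, Real.sin_pi_sub]
        linarith
    refine le_trans ?_ (le_abs_self _)
    linarith
  have hz0 : z ≠ 1 := fun h => by rw [h, sub_self, norm_zero] at hz1; linarith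
  have hgeom : ∑ j : Fin N, circleExp (j : ℤ) (-u) = (z ^ N - 1) / (z - 1) := by
    rw [← geom_sum_eq hz0, ← Fin.sum_univ_eq_sum_range]
    exact sum_congr rfl fun j _ => hpow j
  have hzn : ‖z‖ = 1 := norm_circleExp _ _
  have hb : ‖∑ j : Fin N, circleExp (j : ℤ) (-u)‖ ≤ 1 / (2 * η) := by
    rw [hgeom, norm_div]
    have h3 : ‖z ^ N - 1‖ ≤ 2 := by
      refine (norm_sub_le _ _).trans ?_
      rw [norm_pow, hzn, one_pow, norm_one]; norm_num
    calc ‖z ^ N - 1‖ / ‖z - 1‖ ≤ 2 / (4 * η) := by gcongr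
      _ = 1 / (2 * η) := by field_simp; norm_num
  rw [fejer]
  calc _ ≤ (1 / (2 * η)) ^ 2 / N := by gcongr
    _ = _ := by field_simp; norm_num

/-- A trigonometric polynomial with values in `[0, 1]`, mean `M` and small Fourier coefficients. -/
structure IsTrigBump (N : ℕ) (g : ℝ → ℝ) (M : ℝ) : Prop where
  nonneg : ∀ x, 0 ≤ g x
  le_one : ∀ x, g x ≤ 1
  mean_nonneg : 0 ≤ M
  mean_le_one : M ≤ 1
  expansion : ∃ c : Fin N × Fin N → ℂ, (∀ τ, ‖c τ‖ ≤ pairWeight τ) ∧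
    (∀ τ, τ.1 = τ.2 → c τ = M / N) ∧ ∀ x, (g x : ℂ) = ∑ τ, c τ * circleExp (pairFreq τ) x

theorem IsTrigBump.periodic {N : ℕ} {g : ℝ → ℝ} {M : ℝ} (h : IsTrigBump N g M) (x : ℝ) (j : ℤ) :
    g (x + j) = g x := by
  obtain ⟨c, -, -, hc⟩ := h.expansion
  apply Complex.ofReal_injective
  rw [hc, hc]
  simp only [circleExp_add_intCast]

theorem sum_diag {N : ℕ} (hN : 1 ≤ N) (x : ℝ) :
    ∑ τ : Fin N × Fin N, (if τ.1 = τ.2 then (1 / N : ℂ) else 0) * circleExp (pairFreq τ) x = 1 := by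
  have hN' : (N : ℂ) ≠ 0 := by exact_mod_cast (by omega : N ≠ 0)
  have : ∀ τ : Fin N × Fin N, (if τ.1 = τ.2 then (1 / N : ℂ) else 0) * circleExp (pairFreq τ) x =
      if τ.1 = τ.2 then (1 / N : ℂ) else 0 := fun τ => by
    split_ifs with h
    · rw [(pairFreq_eq_zero_iff τ).2 h, circleExp_zero, mul_one]
    · rw [zero_mul]
  rw [sum_congr rfl fun τ _ => this τ, Fintype.sum_prod_type]
  simp [hN']

theorem isTrigBump_one {N : ℕ} (hN : 1 ≤ N) : IsTrigBump N (fun _ => 1) 1 where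
  nonneg := fun _ => zero_le_one
  le_one := fun _ => le_rfl
  mean_nonneg := zero_le_one
  mean_le_one := le_rfl
  expansion := by
    refine ⟨fun τ => if τ.1 = τ.2 then (1 / N : ℂ) else 0, fun τ => ?_, fun τ h => ?_, fun x => ?_⟩
    · unfold pairWeight
      by_cases h : τ.1 = τ.2
      · simp [h]
      · simp [h]; positivity
    · simp [h]
    · rw [sum_diag hN]; simp

/-- Turns a majorant of the complementary arc into an approximate minorant of an arc. -/
theorem IsTrigBump.one_sub {N : ℕ} (hN : 1 ≤ N) {g : ℝ → ℝ} {M : ℝ} (h : IsTrigBump N g M) :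
    IsTrigBump N (fun x => 1 - g x) (1 - M) where
  nonneg := fun x => sub_nonneg.2 (h.le_one x)
  le_one := fun x => by linarith [h.nonneg x]
  mean_nonneg := sub_nonneg.2 h.mean_le_one
  mean_le_one := by linarith [h.mean_nonneg]
  expansion := by
    obtain ⟨c, h1, h2, h3⟩ := h.expansion
    refine ⟨fun τ => (if τ.1 = τ.2 then (1 / N : ℂ) else 0) - c τ, fun τ => ?_, fun τ hτ => ?_,
      fun x => ?_⟩
    · dsimp only
      by_cases hτ : τ.1 = τ.2
      · rw [if_pos hτ, h2 τ hτ, pairWeight, if_pos hτ, mul_one, ← sub_div]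
        have e : ((1 : ℂ) - M) = ((1 - M : ℝ) : ℂ) := by push_cast; rfl
        rw [norm_div, Complex.norm_natCast, e, Complex.norm_real, Real.norm_eq_abs,
          abs_of_nonneg (sub_nonneg.2 h.mean_le_one)]
        gcongr
        linarith [h.mean_nonneg]
      · rw [if_neg hτ, zero_sub, norm_neg]
        exact h1 τ
    · dsimp only
      rw [if_pos hτ, h2 τ hτ]; push_cast; ring
    · simp only [sub_mul]
      rw [sum_sub_distrib, sum_diag hN, ← h3]
      push_cast; rfl

/-- Integrating the Fejér kernel over an interval. -/
theorem integral_fejer_eq (N : ℕ) (c d x : ℝ) :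
    ((∫ t in c..d, fejer N (x - t) : ℝ) : ℂ) =
      ∑ τ : Fin N × Fin N, ((1 / N : ℂ) * ∫ t in c..d, circleExp (-pairFreq τ) t) *
        circleExp (pairFreq τ) x := by
  rw [← intervalIntegral.integral_ofReal]
  simp_rw [fejer_eq_sum]
  rw [intervalIntegral.integral_finsetSum]
  · refine sum_congr rfl fun τ _ => ?_
    simp_rw [circleExp_sub_right]
    rw [intervalIntegral.integral_const_mul, intervalIntegral.integral_const_mul]
    ring
  · intro τ _
    apply Continuous.intervalIntegrable
    have := continuous_circleExp (pairFreq τ)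
    fun_prop

theorem integral_fejer_period {N : ℕ} (hN : 1 ≤ N) (c x : ℝ) :
    ∫ t in c..(c + 1), fejer N (x - t) = 1 := by
  apply Complex.ofReal_injective
  rw [integral_fejer_eq, Complex.ofReal_one]
  refine Eq.trans (sum_congr rfl fun τ _ => ?_) (sum_diag hN x)
  split_ifs with h
  · rw [(pairFreq_eq_zero_iff τ).2 h]
    simp [circleExp_zero]
  · rw [integral_circleExp_period (by rwa [neg_ne_zero, Ne, pairFreq_eq_zero_iff])]
    simp

/-- A smooth majorant of an arc. -/
theorem exists_arc_bump {N : ℕ} (hN : 1 ≤ N) {η : ℝ} (hη : 0 < η) {a b : ℝ} (hab : a ≤ b) :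
    ∃ (g : ℝ → ℝ) (M : ℝ), IsTrigBump N g M ∧ M ≤ b - a + 2 * η ∧
      ∀ x, a ≤ x → x ≤ b → 1 - 1 / (4 * N * η ^ 2) ≤ g x := by
  have hN' : (0 : ℝ) < N := by exact_mod_cast hN
  -- Once the enlarged arc covers the circle the constant 1 serves. Otherwise convolve the kernel
  -- with the indicator of [a - η, b + η]: for x in [a, b] the missing part of the period stays at
  -- distance at least η from x mod 1, where the kernel is small.
  rcases le_total 1 (b - a + 2 * η) with h1 | h1
  · refine ⟨fun _ => 1, 1, isTrigBump_one hN, h1, fun x _ _ => ?_⟩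
    have : 0 ≤ 1 / (4 * N * η ^ 2) := by positivity
    linarith
  set c := a - η with hc
  set d := b + η with hd
  have hcd : c ≤ d := by linarith
  have hdc : d ≤ c + 1 := by linarith
  have hint : ∀ x s t : ℝ, IntervalIntegrable (fun t => fejer N (x - t)) volume s t := fun x s t => by
    apply Continuous.intervalIntegrable
    have := continuous_fejer N
    fun_prop
  have hsplit : ∀ x, (∫ t in c..d, fejer N (x - t)) + ∫ t in d..(c + 1), fejer N (x - t) = 1 :=
    fun x => by
      rw [intervalIntegral.integral_add_adjacent_intervals (hint _ _ _) (hint _ _ _),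
        integral_fejer_period hN]
  refine ⟨fun x => ∫ t in c..d, fejer N (x - t), d - c, ⟨fun x => ?_, fun x => ?_, by linarith,
    by linarith, ?_⟩, by linarith, fun x hax hxb => ?_⟩
  · exact intervalIntegral.integral_nonneg hcd fun t _ => fejer_nonneg N _
  · have := intervalIntegral.integral_nonneg (μ := volume) hdc fun t _ => fejer_nonneg N (x - t)
    linarith [hsplit x]
  · refine ⟨_, fun τ => ?_, fun τ hτ => ?_, fun x => integral_fejer_eq N c d x⟩
    · rw [norm_mul, pairWeight]
      have e : ‖(1 / N : ℂ)‖ = 1 / N := by simp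
      rw [e]
      refine mul_le_mul_of_nonneg_left ?_ (by positivity)
      split_ifs with h
      · rw [(pairFreq_eq_zero_iff τ).2 h]
        simp only [neg_zero, circleExp_zero, intervalIntegral.integral_const, Complex.real_smul,
          mul_one, Complex.norm_real, Real.norm_eq_abs]
        rw [abs_of_nonneg (by linarith)]
        linarith
      · refine (norm_integral_circleExp_le ?_ _ _).trans ?_
        · rwa [neg_ne_zero, Ne, pairFreq_eq_zero_iff]
        · push_cast; rw [abs_neg]
    · rw [(pairFreq_eq_zero_iff τ).2 hτ]
      simp only [neg_zero, circleExp_zero, intervalIntegral.integral_const, Complex.real_smul,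
          mul_one]
      ring
  · have h2 : ∫ t in d..(c + 1), fejer N (x - t) ≤ ∫ _t in d..(c + 1), 1 / (4 * N * η ^ 2) := by
      refine intervalIntegral.integral_mono_on hdc (hint _ _ _) (by simp) fun t ht => ?_
      have := fejer_le hN hη (u := t - x) (by linarith [ht.1]) (by linarith [ht.2])
      rwa [neg_sub] at this
    rw [intervalIntegral.integral_const, smul_eq_mul] at h2
    have h3 : (c + 1 - d) * (1 / (4 * N * η ^ 2)) ≤ 1 * (1 / (4 * N * η ^ 2)) := by
      gcongr
      linarith
    linarith [hsplit x]

/-- Each row has a diagonal term 1 and, on either side, distinct reciprocals summing to at most 1 +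
log N; the factor 1/N averages the N rows. -/
theorem sum_pairWeight_le {N : ℕ} (hN : 1 ≤ N) :
    ∑ τ : Fin N × Fin N, pairWeight τ ≤ 3 + 2 * Real.log N := by
  have hN' : (0 : ℝ) < N := by exact_mod_cast hN
  have hside : ∀ (s : Finset (Fin N)) (f : Fin N → ℕ), Set.InjOn f (s : Set (Fin N)) →
      (∀ l ∈ s, 0 < f l) → ∑ l ∈ s, 1 / (f l : ℝ) ≤ 1 + Real.log N := by
    intro s f hf hpos
    rw [← sum_image (f := fun m : ℕ => 1 / (m : ℝ)) hf]
    refine sum_inv_le_one_add_log _ (fun p hp => ?_) (by exact_mod_cast hN) ?_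
    · obtain ⟨l, hl, rfl⟩ := mem_image.1 hp
      exact hpos l hl
    · have := (card_image_le (s := s) (f := f)).trans (card_le_univ s)
      rw [Fintype.card_fin] at this
      exact_mod_cast this
  have hrow : ∀ j : Fin N, ∑ l : Fin N, pairWeight (j, l) ≤ 1 / N * (3 + 2 * Real.log N) := by
    intro j
    unfold pairWeight
    rw [← mul_sum]
    refine mul_le_mul_of_nonneg_left ?_ (by positivity)
    have hlt := hside (univ.filter (· < j)) (fun l => (j : ℕ) - l)
      (fun l hl l' hl' h => by
        simp only [coe_filter, mem_univ, true_and, Set.mem_ofPred_eq, Fin.lt_def] at hl hl' h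
        exact Fin.ext (by omega))
      (fun l hl => by
        simp only [mem_filter, mem_univ, true_and, Fin.lt_def] at hl
        omega)
    have hgt := hside (univ.filter (j < ·)) (fun l => (l : ℕ) - j)
      (fun l hl l' hl' h => by
        simp only [coe_filter, mem_univ, true_and, Set.mem_ofPred_eq, Fin.lt_def] at hl hl' h
        exact Fin.ext (by omega))
      (fun l hl => by
        simp only [mem_filter, mem_univ, true_and, Fin.lt_def] at hl
        omega)
    have hall : ∑ l : Fin N, (if j = l then (1 : ℝ) else 1 / |(pairFreq (j, l) : ℝ)|) =
        ∑ l : Fin N, ((if j = l then (1 : ℝ) else 0) +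
          (if l < j then 1 / (((j : ℕ) - l : ℕ) : ℝ) else 0) +
          (if j < l then 1 / (((l : ℕ) - j : ℕ) : ℝ) else 0)) := by
      refine sum_congr rfl fun l _ => ?_
      rcases lt_trichotomy l j with h | h | h
      · rw [if_neg h.ne', if_neg h.ne', if_pos h, if_neg h.not_gt, pairFreq]
        have : (l : ℕ) ≤ j := h.le
        push_cast [Nat.cast_sub this]
        rw [abs_of_nonneg (sub_nonneg.2 (by exact_mod_cast this))]
        ring
      · subst h; simp
      · rw [if_neg h.ne, if_neg h.ne, if_neg h.not_gt, if_pos h, pairFreq]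
        have : (j : ℕ) ≤ l := h.le
        push_cast [Nat.cast_sub this]
        rw [abs_of_nonpos (sub_nonpos.2 (by exact_mod_cast this))]
        ring
    rw [hall, sum_add_distrib, sum_add_distrib, ← sum_filter, ← sum_filter (fun l => l < j),
      ← sum_filter (fun l => j < l)]
    have : ∑ l ∈ univ.filter (fun l => j = l), (1 : ℝ) = 1 := by simp [filter_eq]
    linarith
  rw [Fintype.sum_prod_type]
  calc _ ≤ ∑ _j : Fin N, 1 / N * (3 + 2 * Real.log N) := sum_le_sum fun j _ => hrow j
    _ = 3 + 2 * Real.log N := by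
      rw [sum_const, card_univ, Fintype.card_fin, nsmul_eq_mul]
      field_simp

end FejerKernel

/-! ### From exponential sums to box discrepancy. -/

section Discrepancy

open Finset

theorem prod_le_prod_add {ι : Type*} (s : Finset ι) {f g : ι → ℝ} {t : ℝ} (ht : 0 ≤ t)
    (hf : ∀ i ∈ s, 0 ≤ f i ∧ f i ≤ 1) (hg : ∀ i ∈ s, 0 ≤ g i ∧ g i ≤ 1)
    (hfg : ∀ i ∈ s, f i ≤ g i + t) : ∏ i ∈ s, f i ≤ ∏ i ∈ s, g i + s.card * t := by
  classical
  induction s using Finset.induction_on with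
  | empty => simp
  | insert a s ha ih =>
    have ih' := ih (fun i hi => hf i (mem_insert_of_mem hi)) (fun i hi => hg i (mem_insert_of_mem hi))
      (fun i hi => hfg i (mem_insert_of_mem hi))
    have hfa := hf a (mem_insert_self _ _)
    have hga := hg a (mem_insert_self _ _)
    have hfga := hfg a (mem_insert_self _ _)
    have hF0 : 0 ≤ ∏ i ∈ s, f i := prod_nonneg fun i hi => (hf i (mem_insert_of_mem hi)).1
    have hF1 : ∏ i ∈ s, f i ≤ 1 := prod_le_one (fun i hi => (hf i (mem_insert_of_mem hi)).1)
      fun i hi => (hf i (mem_insert_of_mem hi)).2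
    rw [prod_insert ha, prod_insert ha, card_insert_of_notMem ha]
    push_cast
    have hc : (0 : ℝ) ≤ s.card * t := by positivity
    calc f a * ∏ i ∈ s, f i ≤ (g a + t) * ∏ i ∈ s, f i := mul_le_mul_of_nonneg_right hfga hF0
      _ = g a * ∏ i ∈ s, f i + t * ∏ i ∈ s, f i := by ring
      _ ≤ g a * (∏ i ∈ s, g i + s.card * t) + t * 1 := by
        gcongr
        exact hga.1
      _ = g a * ∏ i ∈ s, g i + g a * (s.card * t) + t := by ring
      _ ≤ g a * ∏ i ∈ s, g i + 1 * (s.card * t) + t := by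
        gcongr
        exact hga.2
      _ = _ := by ring

variable {n : ℕ}

theorem box_eq_pi (a b : Fin n → ℝ) :
    (fun (t : Fin n → ℝ) (i : Fin n) => (t i : UnitAddCircle)) '' Set.Icc a b =
      Set.univ.pi fun i => ((↑) : ℝ → UnitAddCircle) '' Set.Icc (a i) (b i) := by
  ext x
  constructor
  · rintro ⟨t, ht, rfl⟩ i -
    exact ⟨t i, ⟨ht.1 i, ht.2 i⟩, rfl⟩
  · intro hx
    choose t ht hxt using fun i => hx i (Set.mem_univ i)
    exact ⟨t, ⟨fun i => (ht i).1, fun i => (ht i).2⟩, funext hxt⟩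

/-- As closed balls of the circle, arcs have known measurability and volume. -/
theorem image_Icc_eq_closedBall (a b : ℝ) :
    ((↑) : ℝ → UnitAddCircle) '' Set.Icc a b =
      Metric.closedBall (((a + b) / 2 : ℝ) : UnitAddCircle) ((b - a) / 2) := by
  have hpre := AddCircle.coe_real_preimage_closedBall_eq_iUnion (p := (1 : ℝ)) ((a + b) / 2)
    ((b - a) / 2)
  ext y
  constructor
  · rintro ⟨t, ht, rfl⟩
    have : t ∈ ((↑) : ℝ → UnitAddCircle) ⁻¹'
        Metric.closedBall (((a + b) / 2 : ℝ) : UnitAddCircle) ((b - a) / 2) := by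
      rw [hpre, Set.mem_iUnion]
      refine ⟨0, ?_⟩
      rw [Real.closedBall_eq_Icc]
      constructor <;> simp <;> linarith [ht.1, ht.2]
    exact this
  · intro hy
    obtain ⟨t, rfl⟩ := QuotientAddGroup.mk_surjective y
    have : t ∈ ((↑) : ℝ → UnitAddCircle) ⁻¹'
        Metric.closedBall (((a + b) / 2 : ℝ) : UnitAddCircle) ((b - a) / 2) := hy
    rw [hpre, Set.mem_iUnion] at this
    obtain ⟨z, hz⟩ := this
    rw [Real.closedBall_eq_Icc] at hz
    simp only [zsmul_eq_mul, mul_one] at hz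
    refine ⟨t - z, ⟨by linarith [hz.1], by linarith [hz.2]⟩, ?_⟩
    rw [AddCircle.coe_sub, sub_eq_self]
    exact (AddCircle.coe_eq_zero_iff (1 : ℝ)).2 ⟨z, by simp⟩

theorem measurableSet_image_Icc (a b : ℝ) :
    MeasurableSet (((↑) : ℝ → UnitAddCircle) '' Set.Icc a b) := by
  rw [image_Icc_eq_closedBall]
  exact measurableSet_closedBall

theorem volume_box (a b : Fin n → ℝ) (h : ∀ i, a i ≤ b i ∧ b i - a i ≤ 1) :
    (volume : Measure (Fin n → UnitAddCircle)).real
      ((fun (t : Fin n → ℝ) (i : Fin n) => (t i : UnitAddCircle)) '' Set.Icc a b) =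
      ∏ i, (b i - a i) := by
  rw [box_eq_pi, measureReal_def, volume_pi_pi, ENNReal.toReal_prod]
  refine prod_congr rfl fun i _ => ?_
  rw [image_Icc_eq_closedBall, AddCircle.volume_closedBall, mul_div_cancel₀ _ (by norm_num),
    min_eq_right (h i).2, ENNReal.toReal_ofReal (by linarith [(h i).1])]

/-- The mean of a function over the points `a / q`, `a ∈ A_q`. -/
noncomputable def pointMean (A : LocalSets n) (q : ℕ) [NeZero q] (f : (Fin n → ℝ) → ℝ) : ℝ :=
  ((rho A q : ℝ))⁻¹ * ∑ a : Fin n → ZMod q,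
    (residueSet A q).indicator (fun a => f fun i => ((a i).val : ℝ) / q) a

theorem pointMean_mono (A : LocalSets n) (q : ℕ) [NeZero q] {f g : (Fin n → ℝ) → ℝ}
    (h : ∀ x, f x ≤ g x) : pointMean A q f ≤ pointMean A q g := by
  refine mul_le_mul_of_nonneg_left (sum_le_sum fun a _ => ?_) (by positivity)
  exact Set.indicator_le_indicator (h _)

theorem pointMean_add_const (A : LocalSets n) (q : ℕ) [NeZero q] (hρ : 1 ≤ rho A q)
    (f : (Fin n → ℝ) → ℝ) (c : ℝ) :
    pointMean A q (fun x => f x + c) = pointMean A q f + c := by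
  have h0 : (rho A q : ℝ) ≠ 0 := by exact_mod_cast (by omega : rho A q ≠ 0)
  have : ∀ a : Fin n → ZMod q, (residueSet A q).indicator
      (fun a => f (fun i => ((a i).val : ℝ) / q) + c) a =
      (residueSet A q).indicator (fun a => f (fun i => ((a i).val : ℝ) / q)) a +
        (residueSet A q).indicator (fun _ => (1 : ℝ)) a * c := fun a => by
    by_cases ha : a ∈ residueSet A q <;> simp [ha]
  rw [pointMean, pointMean, sum_congr rfl fun a _ => this a, sum_add_distrib, ← sum_mul,
    ← rho_eq_sum]
  field_simp

open Classical in
theorem Delta_real (A : LocalSets n) (q : ℕ) [NeZero q] {B : Set (Fin n → UnitAddCircle)}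
    (hB : MeasurableSet B) :
    (Delta A q).real B =
      pointMean A q (fun x => if (fun i => (x i : UnitAddCircle)) ∈ B then 1 else 0) := by
  have hsum : (Measure.sum (fun a : residueSet A q =>
      Measure.dirac (fracPoint (a : Fin n → ZMod q)))) B =
      ∑ a : residueSet A q, if fracPoint (a : Fin n → ZMod q) ∈ B then (1 : ℝ≥0∞) else 0 := by
    rw [Measure.sum_apply _ hB, tsum_fintype]
    refine sum_congr rfl fun a _ => ?_
    rw [Measure.dirac_apply' _ hB, Set.indicator_apply]
    rfl
  rw [measureReal_def, Delta, Measure.smul_apply, hsum, smul_eq_mul, ENNReal.toReal_mul,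
    ENNReal.toReal_inv, ENNReal.toReal_natCast, pointMean]
  congr 1
  rw [ENNReal.toReal_sum (fun a _ => by split_ifs <;> simp)]
  refine Eq.trans (sum_congr rfl fun a _ =>
    (?_ : _ = (fun a => if fracPoint a ∈ B then (1 : ℝ) else 0) (a : Fin n → ZMod q)))
    (((sum_subtype (univ.filter (· ∈ residueSet A q)) (by simp)
      (fun a => if fracPoint a ∈ B then (1 : ℝ) else 0)).symm).trans ?_)
  · split_ifs with h <;> simp [h]
  · rw [sum_filter]
    refine sum_congr rfl fun a _ => ?_
    rw [Set.indicator_apply]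
    rfl

/-- The frequency vector of a family of pairs. -/
def vecFreq {N : ℕ} (τ : Fin n → Fin N × Fin N) : Fin n → ℤ := fun i => pairFreq (τ i)

/-- The weighted sum of exponential sums controlling the discrepancy. -/
noncomputable def expSumTotal (A : LocalSets n) (N q : ℕ) : ℝ :=
  ∑ τ ∈ (univ : Finset (Fin n → Fin N × Fin N)).filter (fun τ => vecFreq τ ≠ 0),
    (∏ i, pairWeight (τ i)) * ‖expSum A (vecFreq τ) q 1‖

/-- Multiplying out the n expansions gives one exponential sum per family of pairs. Families of zero
frequency are diagonal in every coordinate and contribute exactly the product of the means; the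
others are bounded by their weights. -/
theorem abs_pointMean_prod_sub_le (A : LocalSets n) (q : ℕ) [NeZero q] (hρ : 1 ≤ rho A q) {N : ℕ}
    (hN : 1 ≤ N) {g : Fin n → ℝ → ℝ} {M : Fin n → ℝ} (h : ∀ i, IsTrigBump N (g i) (M i)) :
    |pointMean A q (fun x => ∏ i, g i (x i)) - ∏ i, M i| ≤ expSumTotal A N q := by
  classical
  choose c hc1 hc2 hc3 using fun i => (h i).expansion
  have h0 : (rho A q : ℂ) ≠ 0 := by exact_mod_cast (by omega : rho A q ≠ 0)
  have hq0 : (q : ℂ) ≠ 0 := by exact_mod_cast NeZero.ne q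
  have hN0 : (N : ℂ) ≠ 0 := by exact_mod_cast (by omega : N ≠ 0)
  have hmean : (pointMean A q (fun x => ∏ i, g i (x i)) : ℂ) =
      ∑ τ : Fin n → Fin N × Fin N, (∏ i, c i (τ i)) * expSum A (vecFreq τ) q 1 := by
    have hterm : ∀ a : Fin n → ZMod q, ((((residueSet A q).indicator
        (fun a => ∏ i, g i (((a i).val : ℝ) / q)) a : ℝ)) : ℂ) =
        ∑ τ : Fin n → Fin N × Fin N, (∏ i, c i (τ i)) * (residueSet A q).indicator
          (fun a => expZMod q (1 * ∑ i, (vecFreq τ i : ZMod q) * a i)) a := by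
      intro a
      by_cases ha : a ∈ residueSet A q
      · simp only [Set.indicator_of_mem ha]
        rw [Complex.ofReal_prod]
        simp_rw [hc3]
        rw [prod_univ_sum, Fintype.piFinset_univ]
        refine sum_congr rfl fun τ _ => ?_
        rw [prod_mul_distrib]
        congr 1
        have e : (1 * ∑ i, (vecFreq τ i : ZMod q) * a i) =
            ((∑ i, vecFreq τ i * ((a i).val : ℤ) : ℤ) : ZMod q) := by
          push_cast; simp
        rw [e, expZMod_intCast]
        simp only [circleExp]
        rw [← Complex.exp_sum]
        congr 1
        push_cast
        rw [mul_sum, sum_div]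
        refine sum_congr rfl fun i _ => ?_
        rw [vecFreq]
        field_simp
      · simp [Set.indicator_of_notMem ha]
    rw [pointMean]
    push_cast
    rw [sum_congr rfl fun a _ => hterm a, sum_comm, mul_sum]
    refine sum_congr rfl fun τ _ => ?_
    rw [expSum_eq, ← mul_sum]
    ring
  have hexp0 : ∀ τ : Fin n → Fin N × Fin N, vecFreq τ = 0 → expSum A (vecFreq τ) q 1 = 1 := by
    intro τ hτ
    rw [expSum_eq, hτ]
    have e0 : expZMod q 0 = 1 := by simp [expZMod]
    simp only [Pi.zero_apply, Int.cast_zero, zero_mul, sum_const_zero, mul_zero, e0]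
    have := rho_eq_sum A q
    have h2 : (rho A q : ℂ) = ∑ a : Fin n → ZMod q, (residueSet A q).indicator (fun _ => (1 : ℂ)) a := by
      have h3 := congrArg (fun x : ℝ => (x : ℂ)) this
      simp only [Complex.ofReal_natCast, Complex.ofReal_sum] at h3
      rw [h3]
      refine sum_congr rfl fun a _ => ?_
      by_cases ha : a ∈ residueSet A q <;> simp [ha]
    rw [← h2, inv_mul_cancel₀ h0]
  have hdiag : ∑ τ ∈ (univ : Finset (Fin n → Fin N × Fin N)).filter (fun τ => vecFreq τ = 0),
      (∏ i, c i (τ i)) = ∏ i, (M i : ℂ) := by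
    have h1 : ∀ i, (M i : ℂ) = ∑ τ : Fin N × Fin N, if τ.1 = τ.2 then c i τ else 0 := by
      intro i
      have : ∀ τ : Fin N × Fin N, (if τ.1 = τ.2 then c i τ else 0) =
          (if τ.1 = τ.2 then (1 / N : ℂ) else 0) * circleExp (pairFreq τ) 0 * M i := fun τ => by
        split_ifs with hτ
        · rw [hc2 i τ hτ, (pairFreq_eq_zero_iff τ).2 hτ, circleExp_zero]; ring
        · simp
      rw [sum_congr rfl fun τ _ => this τ, ← sum_mul, sum_diag hN, one_mul]
    simp_rw [h1]
    rw [prod_univ_sum, Fintype.piFinset_univ, sum_filter]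
    refine sum_congr rfl fun τ _ => ?_
    split_ifs with hτ
    · refine prod_congr rfl fun i _ => ?_
      rw [if_pos ((pairFreq_eq_zero_iff _).1 (congrFun hτ i))]
    · obtain ⟨i, hi⟩ := Function.ne_iff.1 hτ
      refine (prod_eq_zero (mem_univ i) ?_).symm
      rw [if_neg fun h' => hi ((pairFreq_eq_zero_iff _).2 h')]
  rw [← Real.norm_eq_abs, ← Complex.norm_real]
  push_cast
  rw [hmean, ← sum_filter_add_sum_filter_not univ (fun τ : Fin n → Fin N × Fin N => vecFreq τ = 0)]
  have h1 : ∑ τ ∈ univ.filter (fun τ : Fin n → Fin N × Fin N => vecFreq τ = 0),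
      (∏ i, c i (τ i)) * expSum A (vecFreq τ) q 1 = ∏ i, (M i : ℂ) := by
    rw [← hdiag]
    refine sum_congr rfl fun τ hτ => ?_
    rw [hexp0 τ (mem_filter.1 hτ).2, mul_one]
  rw [h1, add_sub_cancel_left]
  refine (norm_sum_le _ _).trans (sum_le_sum fun τ _ => ?_)
  rw [norm_mul, norm_prod]
  refine mul_le_mul_of_nonneg_right ?_ (norm_nonneg _)
  exact prod_le_prod (fun i _ => norm_nonneg _) fun i _ => hc1 i _

/-- From above, a product of arc majorants, losing 2η in each side length and ε in each coordinate.
From below, the product of 1 - g_i with g_i a majorant of the complementary arc [b_i, a_i + 1]: off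
the box some coordinate lies in its complementary arc, and that single factor makes the product at
most ε. -/
theorem disc_Delta_le (A : LocalSets n) (q : ℕ) [NeZero q] (hρ : 1 ≤ rho A q) {N : ℕ}
    (hN : 1 ≤ N) {η : ℝ} (hη : 0 < η) :
    disc (Delta A q) ≤ 2 * n * η + (n + 1) * (1 / (4 * N * η ^ 2)) + expSumTotal A N q := by
  classical
  have hN' : (0 : ℝ) < N := by exact_mod_cast hN
  set ε := 1 / (4 * N * η ^ 2) with hε
  have hε0 : 0 ≤ ε := by positivity
  have hT0 : 0 ≤ expSumTotal A N q := sum_nonneg fun τ _ =>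
    mul_nonneg (prod_nonneg fun i _ => pairWeight_nonneg _) (norm_nonneg _)
  refine Real.sSup_le ?_ (by positivity)
  rintro d ⟨B, ⟨a, b, hab, rfl⟩, rfl⟩
  rw [volume_box a b hab]
  have hmeas : MeasurableSet ((fun (t : Fin n → ℝ) (i : Fin n) => (t i : UnitAddCircle)) ''
      Set.Icc a b) := by
    rw [box_eq_pi]
    exact MeasurableSet.univ_pi fun i => measurableSet_image_Icc _ _
  rw [Delta_real A q hmeas, box_eq_pi]
  set F : (Fin n → ℝ) → ℝ := fun x => if (fun i => (x i : UnitAddCircle)) ∈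
    (Set.univ.pi fun i => ((↑) : ℝ → UnitAddCircle) '' Set.Icc (a i) (b i)) then 1 else 0 with hF
  have hlen : ∀ i, 0 ≤ b i - a i ∧ b i - a i ≤ 1 := fun i => ⟨by linarith [(hab i).1], (hab i).2⟩
  have hper : ∀ {g : ℝ → ℝ} {M : ℝ}, IsTrigBump N g M → ∀ {x t : ℝ},
      (t : UnitAddCircle) = (x : UnitAddCircle) → g x = g t := by
    intro g M hg x t hxt
    obtain ⟨z, hz⟩ := (AddCircle.coe_eq_zero_iff (1 : ℝ)).1
      (show ((x - t : ℝ) : UnitAddCircle) = 0 by rw [AddCircle.coe_sub, hxt, sub_self])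
    have : x = t + z := by simp at hz; linarith
    rw [this, hg.periodic]
  rw [abs_le]
  constructor
  · choose g M hg hM hgε using fun i => exists_arc_bump hN hη (a := b i) (b := a i + 1)
      (by linarith [(hlen i).2])
    have h1 := abs_pointMean_prod_sub_le A q hρ hN fun i => (hg i).one_sub hN
    have h2 : pointMean A q (fun x => ∏ i, (1 - g i (x i))) ≤ pointMean A q (fun x => F x + ε) := by
      refine pointMean_mono A q fun x => ?_
      rw [hF]
      dsimp only
      split_ifs with hx
      · refine (prod_le_one (fun i _ => sub_nonneg.2 ((hg i).le_one _))
          fun i _ => by linarith [(hg i).nonneg (x i)]).trans (by linarith)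
      · simp only [Set.mem_pi, Set.mem_univ, true_implies, not_forall] at hx
        obtain ⟨i, hi⟩ := hx
        -- The representative of x_i in [a_i, a_i + 1): being off the arc, it must lie beyond b_i.
        set t := a i + Int.fract (x i - a i) with ht
        have htx : (t : UnitAddCircle) = (x i : UnitAddCircle) := by
          rw [← sub_eq_zero, ← AddCircle.coe_sub]
          refine (AddCircle.coe_eq_zero_iff (1 : ℝ)).2 ⟨-⌊x i - a i⌋, ?_⟩
          have := Int.floor_add_fract (x i - a i)
          simp only [zsmul_eq_mul, mul_one]
          push_cast
          linarith
        have h3 : b i ≤ t := by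
          by_contra hlt
          exact hi ⟨t, ⟨by linarith [Int.fract_nonneg (x i - a i)], (not_le.1 hlt).le⟩, htx⟩
        have h4 : 1 - g i (x i) ≤ ε := by
          have := hgε i t h3 (by linarith [Int.fract_lt_one (x i - a i)])
          rw [hper (hg i) htx]
          linarith
        rw [zero_add]
        refine le_trans ?_ h4
        rw [← mul_prod_erase univ _ (mem_univ i)]
        exact mul_le_of_le_one_right (sub_nonneg.2 ((hg i).le_one _))
          (prod_le_one (fun j _ => sub_nonneg.2 ((hg j).le_one _))
            fun j _ => by linarith [(hg j).nonneg (x j)])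
    rw [pointMean_add_const A q hρ] at h2
    have h5 := prod_le_prod_add univ (f := fun i => b i - a i) (g := fun i => 1 - M i)
      (t := 2 * η) (by positivity) (fun i _ => hlen i)
      (fun i _ => ⟨sub_nonneg.2 (hg i).mean_le_one, by linarith [(hg i).mean_nonneg]⟩)
      (fun i _ => by linarith [hM i])
    rw [card_univ, Fintype.card_fin] at h5
    have h6 := (abs_le.1 h1).1
    have h7 : 0 ≤ (n : ℝ) * ε := by positivity
    linarith
  · choose g M hg hM hgε using fun i => exists_arc_bump hN hη (hab i).1
    have h1 := abs_pointMean_prod_sub_le A q hρ hN hg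
    have h2 : pointMean A q F ≤ pointMean A q (fun x => ∏ i, g i (x i) + n * ε) := by
      refine pointMean_mono A q fun x => ?_
      rw [hF]
      dsimp only
      split_ifs with hx
      · have := prod_le_prod_add univ (f := fun _ : Fin n => (1 : ℝ)) (g := fun i => g i (x i))
          hε0 (fun _ _ => ⟨zero_le_one, le_rfl⟩) (fun i _ => ⟨(hg i).nonneg _, (hg i).le_one _⟩)
          (fun i _ => by
            obtain ⟨t, ht, htx⟩ := hx i (Set.mem_univ i)
            have := hgε i t ht.1 ht.2
            rw [hper (hg i) htx]
            linarith)
        simpa using this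
      · have : 0 ≤ ∏ i, g i (x i) := prod_nonneg fun i _ => (hg i).nonneg _
        positivity
    rw [pointMean_add_const A q hρ] at h2
    have h5 := prod_le_prod_add univ (f := M) (g := fun i => b i - a i)
      (t := 2 * η) (by positivity) (fun i _ => ⟨(hg i).mean_nonneg, (hg i).mean_le_one⟩)
      (fun i _ => hlen i) (fun i _ => by linarith [hM i])
    rw [card_univ, Fintype.card_fin] at h5
    have h6 := (abs_le.1 h1).2
    linarith

theorem sum_prod_pairWeight_le {N : ℕ} (hN : 1 ≤ N) :
    ∑ τ : Fin n → Fin N × Fin N, ∏ i, pairWeight (τ i) ≤ (3 + 2 * Real.log N) ^ n := by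
  have := (prod_univ_sum (fun _ : Fin n => (univ : Finset (Fin N × Fin N)))
    (fun _ τ => pairWeight τ)).symm
  rw [Fintype.piFinset_univ] at this
  rw [this, prod_const, card_univ, Fintype.card_fin]
  exact pow_le_pow_left₀ (sum_nonneg fun _ _ => pairWeight_nonneg _) (sum_pairWeight_le hN) n

end Discrepancy

/-! ### Many moduli with exactly k prime factors. -/

section LowerBound

open Finset

variable {n : ℕ}

theorem mem_moduliWith {A : LocalSets n} {k q : ℕ} {x : ℝ} :
    q ∈ moduliWith A k x ↔ 1 ≤ q ∧ (q : ℝ) ≤ x ∧ 1 ≤ rho A q ∧ q.primeFactors.card = k := by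
  simp only [moduliWith, moduli, mem_filter, mem_Icc]
  constructor
  · rintro ⟨⟨⟨h1, h2⟩, h3⟩, h4⟩
    exact ⟨h1, (Nat.le_floor_iff' (by omega)).1 h2, h3, h4⟩
  · rintro ⟨h1, h2, h3, h4⟩
    exact ⟨⟨⟨h1, (Nat.le_floor_iff' (by omega)).2 h2⟩, h3⟩, h4⟩

theorem coprime_prod_of_notMem {R : Finset ℕ} {p : ℕ} (hp : p.Prime) (hR : ∀ q ∈ R, q.Prime)
    (hpR : p ∉ R) : Nat.Coprime p (∏ q ∈ R, q) :=
  Nat.Coprime.prod_right fun q hq =>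
    (Nat.coprime_primes hp (hR q hq)).2 fun h => hpR (h ▸ hq)

theorem one_le_rho_prod (A : LocalSets n) (R : Finset ℕ)
    (hR : ∀ p ∈ R, p.Prime ∧ 1 ≤ rho A p) : 1 ≤ rho A (∏ p ∈ R, p) := by
  induction R using Finset.induction_on with
  | empty => simp [rho_one]
  | insert p R hp ih =>
    rw [prod_insert hp, rho_mul A (coprime_prod_of_notMem (hR p (mem_insert_self _ _)).1
      (fun q hq => (hR q (mem_insert_of_mem hq)).1) hp)]
    exact Nat.mul_pos (hR p (mem_insert_self _ _)).2
      (ih fun q hq => hR q (mem_insert_of_mem hq))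

/-- A lower bound for the number of large primes in `Q` up to `x / r`. -/
theorem le_card_primeModuli_sdiff (A : LocalSets n) {α x₀ w x r : ℝ}
    (hA : ManyPrimes A α x₀) (hw : 1 < w) (hx : x = w ^ 4) (hr : 1 ≤ r) (hrw : r ≤ w)
    (hx₀ : x₀ ≤ w ^ 3) (hα : 2 * Real.log 4 ≤ α * w) :
    α * x / (2 * Real.log x) * (1 / r) ≤
      ((primeModuli A (x / r) \ primeModuli A (w ^ 2)).card : ℝ) := by
  have hw0 : 0 < w := by linarith
  have hr0 : 0 < r := by linarith
  have hx1 : 1 < x := by rw [hx]; exact one_lt_pow₀ hw (by norm_num)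
  have hlog : 0 < Real.log x := Real.log_pos hx1
  have hlog4 : 0 < Real.log 4 := Real.log_pos (by norm_num)
  have hxr : w ^ 3 ≤ x / r := by
    rw [le_div_iff₀ hr0, hx]
    calc w ^ 3 * r ≤ w ^ 3 * w := by gcongr
      _ = w ^ 4 := by ring
  have h1 := hA _ (hx₀.trans hxr)
  have h2 := sum_log_primeModuli_le A (x := w ^ 2) (by positivity)
  have hsub : primeModuli A (w ^ 2) ⊆ primeModuli A (x / r) :=
    primeModuli_mono A (le_trans (pow_le_pow_right₀ hw.le (by norm_num)) hxr)
  have h3 := sum_sdiff (f := fun p : ℕ => Real.log p) hsub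
  have h4 : ∑ p ∈ primeModuli A (x / r) \ primeModuli A (w ^ 2), Real.log p ≤
      ((primeModuli A (x / r) \ primeModuli A (w ^ 2)).card : ℝ) * Real.log x := by
    rw [← nsmul_eq_mul]
    refine sum_le_card_nsmul _ _ _ fun p hp => ?_
    obtain ⟨hp1, hp2, -⟩ := mem_primeModuli.1 (mem_sdiff.1 hp).1
    exact Real.log_le_log (by exact_mod_cast hp1.pos)
      (hp2.trans (div_le_self (by linarith) hr))
  -- Since x/r ≥ w³, Chebyshev's bound at w² removes at most half of the available logarithmic mass.
  have h5 : Real.log 4 * w ^ 2 ≤ α * (x / r) / 2 := by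
    have hα0 : 0 ≤ α := by
      by_contra hneg
      nlinarith
    calc Real.log 4 * w ^ 2 = (2 * Real.log 4) * w ^ 2 / 2 := by ring
      _ ≤ (α * w) * w ^ 2 / 2 := by gcongr
      _ = α * w ^ 3 / 2 := by ring
      _ ≤ α * (x / r) / 2 := by gcongr
  have h6 : α * (x / r) / 2 ≤
      ((primeModuli A (x / r) \ primeModuli A (w ^ 2)).card : ℝ) * Real.log x := by linarith
  calc α * x / (2 * Real.log x) * (1 / r) = (α * (x / r) / 2) / Real.log x := by field_simp
    _ ≤ _ := by rwa [div_le_iff₀ hlog]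

/-- Count squarefree moduli: k - 1 primes of Q up to z with product R, and one prime of Q in (w²,
x/R]. Since z ≤ w² the large prime is identifiable, so distinct choices give distinct moduli. The
number of large primes is at least proportional to 1/R, and summing over R is the lower bound for
elementary symmetric sums. -/
theorem le_card_moduliWith (A : LocalSets n) {α x₀ w x z : ℝ} {k : ℕ}
    (hA : ManyPrimes A α x₀) (hα0 : 0 < α) (hk : 2 ≤ k) (hw : 1 < w) (hx : x = w ^ 4) (hz : 1 ≤ z)
    (hzw : z ^ k ≤ w) (hx₀ : x₀ ≤ w ^ 3) (hα : 2 * Real.log 4 ≤ α * w)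
    (hP : 1 + Real.log k ≤ ∑ p ∈ primeModuli A z, 1 / (p : ℝ)) :
    α * x / (2 * Real.log x) *
      ((∑ p ∈ primeModuli A z, 1 / (p : ℝ) - (1 + Real.log k)) ^ (k - 1) / (k - 1).factorial) ≤
      ((moduliWith A k x).card : ℝ) := by
  have hw0 : 0 < w := by linarith
  have hx1 : 1 < x := by rw [hx]; exact one_lt_pow₀ hw (by norm_num)
  have hzw1 : z ≤ w := (le_self_pow₀ hz (by omega)).trans hzw
  have hww : w ≤ w ^ 2 := le_self_pow₀ hw.le (by norm_num)
  set Pz := primeModuli A z with hPz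
  set big : Finset ℕ → Finset ℕ := fun R =>
    primeModuli A (x / ((∏ p ∈ R, p : ℕ) : ℝ)) \ primeModuli A (w ^ 2) with hbig
  have hlow := le_sum_powersetCard_prod Pz (fun p : ℕ => 1 / (p : ℝ)) (fun _ _ => by positivity)
    (1 + Real.log k) hP (k - 1) (fun S hS hc => sum_inv_le_one_add_log S
      (fun p hp => (mem_primeModuli.1 (hS hp)).1.pos) (by exact_mod_cast (by omega : 1 ≤ k))
      (by exact_mod_cast (by omega : S.card ≤ k)))
  have hRprime : ∀ R ∈ Pz.powersetCard (k - 1), ∀ p ∈ R, p.Prime ∧ (p : ℝ) ≤ z ∧ 1 ≤ rho A p :=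
    fun R hR p hp => mem_primeModuli.1 ((mem_powersetCard.1 hR).1 hp)
  have hRw : ∀ R ∈ Pz.powersetCard (k - 1),
      (1 : ℝ) ≤ ((∏ p ∈ R, p : ℕ) : ℝ) ∧ ((∏ p ∈ R, p : ℕ) : ℝ) ≤ w := by
    intro R hR
    constructor
    · exact_mod_cast Finset.prod_pos fun p hp => (hRprime R hR p hp).1.pos
    · push_cast
      calc ∏ p ∈ R, (p : ℝ) ≤ ∏ _p ∈ R, z :=
            prod_le_prod (fun _ _ => Nat.cast_nonneg _) fun p hp => (hRprime R hR p hp).2.1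
        _ = z ^ (k - 1) := by rw [prod_const, (mem_powersetCard.1 hR).2]
        _ ≤ z ^ k := pow_le_pow_right₀ hz (by omega)
        _ ≤ w := hzw
  have hbigmem : ∀ R p, p ∈ big R → p.Prime ∧ (p : ℝ) ≤ x / ((∏ p ∈ R, p : ℕ) : ℝ) ∧
      1 ≤ rho A p ∧ w ^ 2 < p := by
    intro R p hp
    obtain ⟨h1, h2⟩ := mem_sdiff.1 hp
    obtain ⟨h3, h4, h5⟩ := mem_primeModuli.1 h1
    refine ⟨h3, h4, h5, ?_⟩
    by_contra hle
    exact h2 (mem_primeModuli.2 ⟨h3, not_lt.1 hle, h5⟩)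
  have hnot : ∀ R ∈ Pz.powersetCard (k - 1), ∀ p ∈ R, ¬ w ^ 2 < (p : ℝ) := fun R hR p hp => by
    have := (hRprime R hR p hp).2.1
    linarith
  have hcard : ((Pz.powersetCard (k - 1)).sigma big).card ≤ (moduliWith A k x).card := by
    refine card_le_card_of_injOn (fun b => ∏ i ∈ insert b.2 b.1, i) ?_ ?_
    · rintro ⟨R, p⟩ hb
      obtain ⟨hR, hp⟩ := mem_sigma.1 (mem_coe.1 hb)
      obtain ⟨hp1, hp2, hp3, hp4⟩ := hbigmem R p hp
      have hpR : p ∉ R := fun h => hnot R hR p h hp4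
      have hprime : ∀ i ∈ insert p R, i.Prime ∧ 1 ≤ rho A i := fun i hi => by
        rcases mem_insert.1 hi with rfl | hi
        · exact ⟨hp1, hp3⟩
        · exact ⟨(hRprime R hR i hi).1, (hRprime R hR i hi).2.2⟩
      refine mem_coe.2 (mem_moduliWith.2 ⟨Finset.prod_pos fun i hi => (hprime i hi).1.pos, ?_,
        one_le_rho_prod A _ hprime, ?_⟩)
      · dsimp only
        rw [prod_insert hpR]
        have := (hRw R hR).1
        rw [le_div_iff₀ (by linarith)] at hp2
        exact_mod_cast hp2
      · dsimp only
        rw [Nat.primeFactors_prod fun i hi => (hprime i hi).1, card_insert_of_notMem hpR,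
          (mem_powersetCard.1 hR).2]
        omega
    · rintro ⟨R, p⟩ hb ⟨R', p'⟩ hb' heq
      obtain ⟨hR, hp⟩ := mem_sigma.1 (mem_coe.1 hb)
      obtain ⟨hR', hp'⟩ := mem_sigma.1 (mem_coe.1 hb')
      obtain ⟨hp1, -, -, hp4⟩ := hbigmem R p hp
      obtain ⟨hp1', -, -, hp4'⟩ := hbigmem R' p' hp'
      dsimp only at *
      have e := congrArg Nat.primeFactors heq
      rw [Nat.primeFactors_prod, Nat.primeFactors_prod] at e
      · have hpp : p = p' := by
          have : p ∈ insert p' R' := e ▸ mem_insert_self p R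
          rcases mem_insert.1 this with h | h
          · exact h
          · exact absurd hp4 (hnot R' hR' p h)
        subst hpp
        have hRR : R = R' := by
          rw [← erase_insert (fun h => hnot R hR p h hp4), e,
            erase_insert (fun h => hnot R' hR' p h hp4)]
        subst hRR
        rfl
      · intro i hi
        rcases mem_insert.1 hi with rfl | hi
        · exact hp1'
        · exact (hRprime R' hR' i hi).1
      · intro i hi
        rcases mem_insert.1 hi with rfl | hi
        · exact hp1
        · exact (hRprime R hR i hi).1
  refine le_trans ?_ (Nat.cast_le.2 hcard)
  rw [card_sigma]
  push_cast
  have hlogx : 0 < Real.log x := Real.log_pos hx1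
  calc _ ≤ α * x / (2 * Real.log x) * ∑ S ∈ Pz.powersetCard (k - 1), ∏ p ∈ S, 1 / (p : ℝ) :=
        mul_le_mul_of_nonneg_left hlow (by positivity)
    _ ≤ _ := by
        rw [mul_sum]
        refine sum_le_sum fun R hR => ?_
        have := le_card_primeModuli_sdiff A hA hw hx (hRw R hR).1 (hRw R hR).2 hx₀ hα
        refine le_trans (le_of_eq ?_) this
        congr 1
        push_cast
        rw [prod_div_distrib, prod_const_one]

end LowerBound

/-! ### Averaging over a varying prime factor. -/

section TwistedSums

open Finset

variable {n : ℕ}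

theorem norm_expSum_mul_le (A : LocalSets n) (h : Fin n → ℤ) {r s : ℕ} [NeZero r] [NeZero s]
    (hrs : Nat.Coprime r s) :
    ‖expSum A h (r * s) 1‖ ≤
      ‖expSum A h r (((ZMod.unitOfCoprime s hrs.symm)⁻¹ : (ZMod r)ˣ) : ZMod r)‖ := by
  rw [expSum_mul A h hrs, norm_mul, map_one, map_one, one_mul, one_mul]
  exact mul_le_of_le_one_right (norm_nonneg _) (norm_expSum_le_one A h s _)

/-- Averaging the exponential sums over primes in progressions modulo `r`. -/
theorem sum_norm_expSum_primes_le (A : LocalSets n) (h : Fin n → ℤ) {r m : ℕ} [NeZero r]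
    [NeZero m] {y : ℝ} (hy : 2 ≤ y) (hry : (r : ℝ) ^ 4 ≤ y) (S : Finset ℕ)
    (hS : ∀ p ∈ S, p.Prime ∧ (p : ℝ) ≤ y ∧ Nat.Coprime r (m * p)) :
    ∑ p ∈ S, ‖expSum A h (r * (m * p)) 1‖ ≤ unitSum A h r *
      (50 * (y / (r * Real.log y)) * ∏ p ∈ r.primeFactors, (1 + 1 / (p : ℝ))) := by
  classical
  set B := 50 * (y / (r * Real.log y)) * ∏ p ∈ r.primeFactors, (1 + 1 / (p : ℝ)) with hB
  have hr : 0 < r := Nat.pos_of_ne_zero (NeZero.ne r)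
  -- The twist seen by the modulus r. As m is invertible mod r, a fibre of ψ on S consists of primes
  -- in one residue class; the default value 1 is never met on S.
  let ψ : ℕ → (ZMod r)ˣ := fun p =>
    if hc : Nat.Coprime r (m * p) then (ZMod.unitOfCoprime (m * p) hc.symm)⁻¹ else 1
  have h1 : ∀ p ∈ S, ‖expSum A h (r * (m * p)) 1‖ ≤ ‖expSum A h r ((ψ p : (ZMod r)ˣ) : ZMod r)‖ := by
    intro p hp
    obtain ⟨hp1, -, hp3⟩ := hS p hp
    have : NeZero (m * p) := ⟨mul_ne_zero (NeZero.ne m) hp1.ne_zero⟩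
    have := norm_expSum_mul_le A h hp3
    simp only [ψ, dif_pos hp3]
    exact this
  have hfib : ∀ u : (ZMod r)ˣ, ((S.filter (fun p => ψ p = u)).card : ℝ) ≤ B := by
    intro u
    rcases (S.filter (fun p => ψ p = u)).eq_empty_or_nonempty with he | ⟨b, hb⟩
    · rw [he, card_empty, Nat.cast_zero, hB]
      have : 0 ≤ Real.log y := Real.log_nonneg (by linarith)
      positivity
    · refine card_primes_modEq_le hr hy hry b _ fun p hp => ?_
      obtain ⟨hp, hpu⟩ := mem_filter.1 hp
      obtain ⟨hb, hbu⟩ := mem_filter.1 hb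
      obtain ⟨hp1, hp2, hp3⟩ := hS p hp
      obtain ⟨-, -, hb3⟩ := hS b hb
      refine ⟨hp1, hp2, ?_⟩
      have e : ψ p = ψ b := hpu.trans hbu.symm
      simp only [ψ, dif_pos hp3, dif_pos hb3] at e
      have e2 := congrArg (fun u : (ZMod r)ˣ => (u : ZMod r)) (inv_injective e)
      simp only [ZMod.coe_unitOfCoprime] at e2
      rw [ZMod.natCast_eq_natCast_iff] at e2
      exact Nat.ModEq.cancel_left_of_coprime (Nat.Coprime.coprime_mul_right_right hp3) e2
  calc ∑ p ∈ S, ‖expSum A h (r * (m * p)) 1‖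
      ≤ ∑ p ∈ S, ‖expSum A h r ((ψ p : (ZMod r)ˣ) : ZMod r)‖ := sum_le_sum h1
    _ = ∑ u : (ZMod r)ˣ, ∑ p ∈ S.filter (fun p => ψ p = u),
          ‖expSum A h r ((ψ p : (ZMod r)ˣ) : ZMod r)‖ := (sum_fiberwise S ψ _).symm
    _ = ∑ u : (ZMod r)ˣ, ((S.filter (fun p => ψ p = u)).card : ℝ) *
          ‖expSum A h r (u : ZMod r)‖ := by
        refine sum_congr rfl fun u _ => ?_
        rw [← nsmul_eq_mul, ← sum_const]
        exact sum_congr rfl fun p hp => by rw [(mem_filter.1 hp).2]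
    _ ≤ ∑ u : (ZMod r)ˣ, B * ‖expSum A h r (u : ZMod r)‖ :=
        sum_le_sum fun u _ => mul_le_mul_of_nonneg_right (hfib u) (norm_nonneg _)
    _ = _ := by rw [← mul_sum, ← unitSum_eq, mul_comm]

theorem unitSum_prod_pow (A : LocalSets n) (h : Fin n → ℤ) (s : Finset ℕ) (v : ℕ → ℕ)
    (hs : ∀ p ∈ s, p.Prime) :
    unitSum A h (∏ p ∈ s, p ^ v p) = ∏ p ∈ s, unitSum A h (p ^ v p) := by
  induction s using Finset.induction_on with
  | empty => simp [unitSum_one]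
  | insert p s hp ih =>
    have hs' := fun q hq => hs q (mem_insert_of_mem hq)
    have hp' := hs p (mem_insert_self _ _)
    rw [prod_insert hp, prod_insert hp, ← ih hs']
    have : NeZero (p ^ v p) := ⟨pow_ne_zero _ hp'.ne_zero⟩
    have : NeZero (∏ q ∈ s, q ^ v q) :=
      ⟨prod_ne_zero_iff.2 fun q hq => pow_ne_zero _ (hs' q hq).ne_zero⟩
    refine unitSum_mul_of_neZero A h (Nat.Coprime.prod_right fun q hq => ?_)
    exact Nat.Coprime.pow _ _ ((Nat.coprime_primes hp' (hs' q hq)).2 fun e => hp (e ▸ hq))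

/-- The local factors: a saving at prime powers up to `z`, and the trivial bound above. -/
noncomputable def localFactor (A : LocalSets n) (h : Fin n → ℤ) (z : ℝ) (a : ℕ × ℕ) : ℝ :=
  if ((a.1 ^ a.2 : ℕ) : ℝ) ≤ z then
    unitSum A h (a.1 ^ a.2) / ((a.1 ^ a.2 : ℕ) : ℝ) ^ 2 * (1 + 1 / (a.1 : ℝ))
  else 1 / ((a.1 ^ a.2 : ℕ) : ℝ)

theorem localFactor_nonneg (A : LocalSets n) (h : Fin n → ℤ) (z : ℝ) (a : ℕ × ℕ) :
    0 ≤ localFactor A h z a := by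
  have := unitSum_nonneg A h (a.1 ^ a.2)
  unfold localFactor
  split_ifs <;> positivity

/-- Split t = rm, with r collecting the prime powers at most z. Only r is used for equidistribution:
it is at most z^ω(t), hence r⁴ ≤ x/t as the sieve bound requires. With y = x/(rm), the factor
U(r)·y/r equals x·U(r)/(r²m), which factors over the primes of t into the local factors. -/
theorem sum_norm_expSum_multiples_le (A : LocalSets n) (h : Fin n → ℤ) {t : ℕ} (ht : t ≠ 0)
    {x z ℓ : ℝ} (hℓ : 0 < ℓ) (hx : 0 < x) (hz : 1 ≤ z) (hy : 2 ≤ x / t)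
    (hzy : z ^ (4 * t.primeFactors.card) ≤ x / t)
    (hlog : ℓ ≤ Real.log (x / t)) (S : Finset ℕ)
    (hS : ∀ p ∈ S, p.Prime ∧ (p : ℝ) ≤ x / t ∧ Nat.Coprime t p) :
    ∑ p ∈ S, ‖expSum A h (t * p) 1‖ ≤
      50 * x / ℓ * ∏ p ∈ t.primeFactors, localFactor A h z (p, t.factorization p) := by
  classical
  set v := t.factorization with hv
  set s₁ := t.primeFactors.filter (fun p => ((p ^ v p : ℕ) : ℝ) ≤ z) with hs₁
  set s₂ := t.primeFactors.filter (fun p => ¬ ((p ^ v p : ℕ) : ℝ) ≤ z) with hs₂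
  set r := ∏ p ∈ s₁, p ^ v p with hr
  set m := ∏ p ∈ s₂, p ^ v p with hm
  have hprime : ∀ p ∈ t.primeFactors, p.Prime := fun p hp => Nat.prime_of_mem_primeFactors hp
  have htrm : t = r * m := by
    conv_lhs => rw [← Nat.prod_factorization_pow_eq_self ht]
    exact (prod_filter_mul_prod_filter_not _ _ _).symm
  have hr0 : r ≠ 0 := left_ne_zero_of_mul (htrm ▸ ht)
  have hm0 : m ≠ 0 := right_ne_zero_of_mul (htrm ▸ ht)
  have : NeZero r := ⟨hr0⟩
  have : NeZero m := ⟨hm0⟩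
  have hr' : (0 : ℝ) < r := by exact_mod_cast Nat.pos_of_ne_zero hr0
  have hm' : (0 : ℝ) < m := by exact_mod_cast Nat.pos_of_ne_zero hm0
  have hrm : Nat.Coprime r m := by
    refine Nat.Coprime.prod_left fun p hp => Nat.Coprime.prod_right fun q hq => ?_
    obtain ⟨hp1, hp2⟩ := mem_filter.1 hp
    obtain ⟨hq1, hq2⟩ := mem_filter.1 hq
    exact Nat.Coprime.pow _ _ ((Nat.coprime_primes (hprime p hp1) (hprime q hq1)).2
      fun e => hq2 (e ▸ hp2))
  have hrz : (r : ℝ) ^ 4 ≤ x / t := by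
    refine le_trans ?_ hzy
    have : (r : ℝ) ≤ z ^ t.primeFactors.card := by
      rw [hr]
      push_cast
      calc ∏ p ∈ s₁, (p : ℝ) ^ v p ≤ ∏ _p ∈ s₁, z :=
            prod_le_prod (fun _ _ => by positivity) fun p hp => by
              have := (mem_filter.1 hp).2
              push_cast at this
              exact this
        _ = z ^ s₁.card := prod_const _
        _ ≤ _ := pow_le_pow_right₀ hz (card_filter_le _ _)
    calc (r : ℝ) ^ 4 ≤ (z ^ t.primeFactors.card) ^ 4 := by gcongr
      _ = _ := by rw [← pow_mul, mul_comm]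
  have h1 := sum_norm_expSum_primes_le A h (r := r) (m := m) hy hrz S fun p hp => by
    obtain ⟨a, b, c⟩ := hS p hp
    exact ⟨a, b, Nat.Coprime.mul_right hrm (c.coprime_dvd_left ⟨m, htrm⟩)⟩
  have h2 : ∑ p ∈ S, ‖expSum A h (t * p) 1‖ = ∑ p ∈ S, ‖expSum A h (r * (m * p)) 1‖ := by
    refine sum_congr rfl fun p _ => ?_
    have e : t * p = r * (m * p) := by rw [htrm, mul_assoc]
    rw [e]
  rw [h2]
  refine h1.trans ?_
  have hpf : ∏ p ∈ r.primeFactors, (1 + 1 / (p : ℝ)) ≤ ∏ p ∈ s₁, (1 + 1 / (p : ℝ)) := by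
    have hsub : r.primeFactors ⊆ s₁ := by
      intro p hp
      obtain ⟨hp1, hp2, -⟩ := Nat.mem_primeFactors.1 hp
      obtain ⟨q, hq, hpq⟩ := (Prime.dvd_finsetProd_iff hp1.prime _).1 hp2
      have := (Nat.prime_dvd_prime_iff_eq hp1 (hprime q (mem_filter.1 hq).1)).1
        (hp1.dvd_of_dvd_pow hpq)
      rwa [this]
    rw [← prod_sdiff hsub]
    refine le_mul_of_one_le_left (by positivity) (Finset.one_le_prod fun p _ => ?_)
    have : (0 : ℝ) ≤ 1 / (p : ℝ) := by positivity
    linarith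
  have hloc : ∏ p ∈ t.primeFactors, localFactor A h z (p, v p) =
      unitSum A h r / (r : ℝ) ^ 2 * (∏ p ∈ s₁, (1 + 1 / (p : ℝ))) * (1 / m) := by
    rw [← prod_filter_mul_prod_filter_not t.primeFactors (fun p => ((p ^ v p : ℕ) : ℝ) ≤ z)]
    congr 1
    · rw [hr, unitSum_prod_pow A h s₁ v fun p hp => hprime p (mem_filter.1 hp).1]
      rw [Nat.cast_prod, ← prod_pow, ← prod_div_distrib, ← prod_mul_distrib]
      refine prod_congr rfl fun p hp => ?_
      rw [localFactor, if_pos (mem_filter.1 hp).2]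
    · rw [hm, Nat.cast_prod, ← prod_const_one (s := s₂), ← prod_div_distrib]
      refine prod_congr rfl fun p hp => ?_
      rw [localFactor, if_neg (mem_filter.1 hp).2]
  rw [hloc]
  have hU := unitSum_nonneg A h r
  have hyr : (x / t) / (r * Real.log (x / t)) ≤ x / ((r : ℝ) ^ 2 * m) / ℓ := by
    have e : (t : ℝ) = r * m := by exact_mod_cast htrm
    have e2 : x / t / (r * Real.log (x / t)) = x / ((r : ℝ) ^ 2 * m) / Real.log (x / t) := by
      have : Real.log (x / t) ≠ 0 := by linarith
      rw [e] at *
      field_simp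
    rw [e2]
    gcongr
  calc _ ≤ unitSum A h r * (50 * (x / ((r : ℝ) ^ 2 * m) / ℓ) * ∏ p ∈ s₁, (1 + 1 / (p : ℝ))) := by
        gcongr
    _ = _ := by field_simp

end TwistedSums

/-! ### The mean of the exponential sums over the moduli. -/

section UpperBound

open Finset

variable {n : ℕ}

theorem card_le_of_sq_dvd {x : ℝ} (hx : 0 ≤ x) {D : ℕ} (hD : 1 ≤ D) (S : Finset ℕ)
    (hS : ∀ q ∈ S, 1 ≤ q ∧ (q : ℝ) ≤ x ∧ ∃ d, D < d ∧ d ^ 2 ∣ q) : (S.card : ℝ) ≤ x / D := by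
  classical
  -- The maximum keeps the right end above D, as the tail bound for the sum of 1/d² needs, even when
  -- x is small.
  have hsub : S ⊆ (Ioc D (max (D + 1) ⌊x⌋₊)).biUnion
      fun d => (Ioc 0 ⌊x⌋₊).filter (fun q => d ^ 2 ∣ q) := by
    intro q hq
    obtain ⟨h1, h2, d, h3, h4⟩ := hS q hq
    have hqx : q ≤ ⌊x⌋₊ := Nat.le_floor h2
    have hdq : d ≤ q := (Nat.le_self_pow two_ne_zero d).trans (Nat.le_of_dvd h1 h4)
    refine mem_biUnion.2 ⟨d, mem_Ioc.2 ⟨h3, (hdq.trans hqx).trans (le_max_right _ _)⟩,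
      mem_filter.2 ⟨mem_Ioc.2 ⟨h1, hqx⟩, h4⟩⟩
  have h1 : (S.card : ℝ) ≤ ∑ d ∈ Ioc D (max (D + 1) ⌊x⌋₊), x * ((d : ℝ) ^ 2)⁻¹ := by
    refine (Nat.cast_le.2 ((card_le_card hsub).trans card_biUnion_le)).trans ?_
    rw [Nat.cast_sum]
    refine sum_le_sum fun d _ => ?_
    rw [Nat.Ioc_filter_dvd_card_eq_div]
    refine Nat.cast_div_le.trans ?_
    rw [div_eq_mul_inv]
    push_cast
    gcongr
    exact Nat.floor_le hx
  rw [← mul_sum] at h1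
  have h2 := sum_Ioc_inv_sq_le_sub (α := ℝ) (k := D) (n := max (D + 1) ⌊x⌋₊) (by omega)
    (le_trans (by omega) (le_max_left _ _))
  have h3 : (0 : ℝ) ≤ ((max (D + 1) ⌊x⌋₊ : ℕ) : ℝ)⁻¹ := by positivity
  rw [div_eq_mul_inv]
  exact h1.trans (mul_le_mul_of_nonneg_left (by linarith) hx)

/-- Take d = p^⌊v/2⌋: for v ≥ 2 one has v ≤ 3⌊v/2⌋, so d³ ≥ p^v > z ≥ D³. -/
theorem exists_sq_dvd_of_lt_pow {p v q D : ℕ} {z : ℝ} (hv : 2 ≤ v) (hp : p.Prime)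
    (hq : p ^ v ∣ q) (hz : z < ((p ^ v : ℕ) : ℝ)) (hD : (D : ℝ) ^ 3 ≤ z) :
    ∃ d, D < d ∧ d ^ 2 ∣ q := by
  refine ⟨p ^ (v / 2), ?_, ?_⟩
  · have h1 : D ^ 3 < p ^ v := by
      have := hD.trans_lt hz
      exact_mod_cast this
    have h2 : p ^ v ≤ (p ^ (v / 2)) ^ 3 := by
      rw [← pow_mul]
      exact Nat.pow_le_pow_right hp.pos (by omega)
    exact lt_of_pow_lt_pow_left₀ 3 (Nat.zero_le _) (h1.trans_le h2)
  · rw [← pow_mul]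
    exact (pow_dvd_pow p (by omega)).trans hq

/-- The largest prime factor of an integer whose higher prime powers are small. -/
theorem exists_large_prime_factor {q k : ℕ} {z : ℝ} (hk : 1 ≤ k)
    (hcard : q.primeFactors.card = k) (hzq : z ^ k < q)
    (hpow : ∀ p ∈ q.primeFactors, 2 ≤ q.factorization p → ((p ^ q.factorization p : ℕ) : ℝ) ≤ z) :
    ∃ p, p.Prime ∧ p ∣ q ∧ Nat.Coprime (q / p) p ∧ (q : ℝ) ≤ (p : ℝ) ^ k := by
  have hq0 : q ≠ 0 := by
    rintro rfl
    simp at hcard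
    omega
  obtain ⟨p, hp, hmax⟩ := exists_max_image q.primeFactors id
    (card_pos.1 (by omega))
  have hpp := Nat.prime_of_mem_primeFactors hp
  -- With p the largest prime factor, each exact prime power of q is either a prime at most p or a
  -- higher power at most z. As z^k < q, the maximum must be p, and p > z rules out a higher power
  -- of p.
  have hle : (q : ℝ) ≤ (max z p) ^ k := by
    conv_lhs => rw [← Nat.prod_factorization_pow_eq_self hq0]
    rw [Finsupp.prod, Nat.cast_prod, ← hcard]
    refine (prod_le_prod (fun _ _ => by positivity) fun r hr => ?_).trans
      (le_of_eq (prod_const (max z (p : ℝ))))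
    have hr' : r ∈ q.primeFactors := hr
    have hr1 : 1 ≤ q.factorization r := Nat.pos_of_ne_zero (Finsupp.mem_support_iff.1 hr)
    rcases Nat.lt_or_ge (q.factorization r) 2 with h | h
    · have e : q.factorization r = 1 := by omega
      rw [e, pow_one]
      exact le_trans (by exact_mod_cast hmax r hr') (le_max_right _ _)
    · exact (hpow r hr' h).trans (le_max_left _ _)
  have hzp : z < p := by
    by_contra hcon
    rw [max_eq_left (not_lt.1 hcon)] at hle
    linarith
  have hfac : q.factorization p = 1 := by
    have h1 : 1 ≤ q.factorization p :=
      Nat.pos_of_ne_zero (Finsupp.mem_support_iff.1 (by simpa using hp))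
    by_contra hne
    have h2 := hpow p hp (by omega)
    have h3 : p ≤ p ^ q.factorization p := Nat.le_self_pow (by omega) p
    have h4 : (p : ℝ) ≤ ((p ^ q.factorization p : ℕ) : ℝ) := by exact_mod_cast h3
    linarith
  have hdvd := Nat.dvd_of_mem_primeFactors hp
  refine ⟨p, hpp, hdvd, ?_, ?_⟩
  · refine ((Nat.Prime.coprime_iff_not_dvd hpp).2 fun hd => ?_).symm
    have h2 : p ^ 2 ∣ q := by
      obtain ⟨c, hc⟩ := hd
      refine ⟨c, ?_⟩
      rw [← Nat.div_mul_cancel hdvd, hc]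
      ring
    have := (hpp.pow_dvd_iff_le_factorization hq0).1 h2
    omega
  · rwa [max_eq_right hzp.le] at hle

/-- The prime powers that can divide exactly one of the moduli under consideration. -/
noncomputable def primePowerPairs (A : LocalSets n) (z x : ℝ) : Finset (ℕ × ℕ) :=
  (Icc 1 ⌊x⌋₊ ×ˢ Icc 1 ⌊x⌋₊).filter fun a => a.1.Prime ∧ ((a.1 ^ a.2 : ℕ) : ℝ) ≤ x ∧
    1 ≤ rho A (a.1 ^ a.2) ∧ (2 ≤ a.2 → ((a.1 ^ a.2 : ℕ) : ℝ) ≤ z)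

theorem mem_primePowerPairs {A : LocalSets n} {z x : ℝ} {p v : ℕ} :
    (p, v) ∈ primePowerPairs A z x ↔ 1 ≤ v ∧ p.Prime ∧ ((p ^ v : ℕ) : ℝ) ≤ x ∧
      1 ≤ rho A (p ^ v) ∧ (2 ≤ v → ((p ^ v : ℕ) : ℝ) ≤ z) := by
  simp only [primePowerPairs, mem_filter, mem_product, mem_Icc]
  constructor
  · rintro ⟨⟨-, h1, -⟩, h2⟩
    exact ⟨h1, h2⟩
  · rintro ⟨h1, h2⟩
    have h3 : p ^ v ≤ ⌊x⌋₊ := Nat.le_floor h2.2.1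
    exact ⟨⟨⟨h2.1.one_le, (Nat.le_self_pow (by omega) p).trans h3⟩, h1,
      (Nat.lt_pow_self h2.1.one_lt).le.trans h3⟩, h2⟩

theorem one_le_rho_pow_factorization (A : LocalSets n) {q p : ℕ} (hq : q ≠ 0) (h : 1 ≤ rho A q)
    (hp : p ∈ q.primeFactors) : 1 ≤ rho A (p ^ q.factorization p) := by
  rw [rho_eq_prod A hq, Finsupp.prod] at h
  exact Nat.pos_of_ne_zero (prod_ne_zero_iff.1 (Nat.one_le_iff_ne_zero.1 h) p hp)

/-- An integer is determined by the set of its exact prime powers, an m-element set, so the sum is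
part of an elementary symmetric sum. -/
theorem sum_prod_primeFactors_le (A : LocalSets n) (f : ℕ × ℕ → ℝ) (hf : ∀ a, 0 ≤ f a) (z x : ℝ)
    (m : ℕ) (T : Finset ℕ) (hT : ∀ t ∈ T, t ≠ 0 ∧ t.primeFactors.card = m ∧
      ∀ p ∈ t.primeFactors, (p, t.factorization p) ∈ primePowerPairs A z x) :
    ∑ t ∈ T, ∏ p ∈ t.primeFactors, f (p, t.factorization p) ≤
      (∑ a ∈ primePowerPairs A z x, f a) ^ m / m.factorial := by
  classical
  refine le_trans ?_ (sum_powersetCard_prod_le (primePowerPairs A z x) f (fun a _ => hf a) m)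
  let g : ℕ → Finset (ℕ × ℕ) := fun t => t.primeFactors.image fun p => (p, t.factorization p)
  have hinj : ∀ t : ℕ, Set.InjOn (fun p => (p, t.factorization p)) (t.primeFactors : Set ℕ) :=
    fun t a _ b _ h => (Prod.mk.inj h).1
  have hg : ∀ t, ∏ p ∈ t.primeFactors, f (p, t.factorization p) = ∏ a ∈ g t, f a :=
    fun t => (prod_image (hinj t)).symm
  have hgi : Set.InjOn g (T : Set ℕ) := by
    intro s hs t ht h
    have key : ∀ u ∈ T, ∏ a ∈ g u, a.1 ^ a.2 = u := fun u hu => by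
      rw [prod_image (hinj u)]
      exact Nat.prod_factorization_pow_eq_self (hT u hu).1
    rw [← key s hs, ← key t ht, h]
  rw [sum_congr rfl fun t _ => hg t, ← sum_image (f := fun S => ∏ a ∈ S, f a) hgi]
  refine sum_le_sum_of_subset_of_nonneg ?_ fun S _ _ => prod_nonneg fun a _ => hf a
  intro S hS
  obtain ⟨t, ht, rfl⟩ := mem_image.1 hS
  obtain ⟨-, h2, h3⟩ := hT t ht
  refine mem_powersetCard.2 ⟨fun a ha => ?_, ?_⟩
  · obtain ⟨p, hp, rfl⟩ := mem_image.1 ha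
    exact h3 p hp
  · rw [card_image_of_injOn (hinj t), h2]

/-- Group the moduli by t = q/P with P a prime dividing q exactly once and q ≤ P^k. From w³ < q one
gets log(x/t) ≥ log P ≥ 3 log w / k, which is where a factor k is lost. -/
theorem sum_norm_expSum_good_le (A : LocalSets n) (h : Fin n → ℤ) {k : ℕ} {w x z : ℝ}
    (hk : 2 ≤ k) (hw : 1 < w) (hz : 1 ≤ z) (hzw : z ^ (4 * k ^ 2) ≤ w) (G : Finset ℕ)
    (hG : ∀ q ∈ G, q ∈ moduliWith A k x ∧ w ^ 3 < q ∧ ∀ p ∈ q.primeFactors,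
      2 ≤ q.factorization p → ((p ^ q.factorization p : ℕ) : ℝ) ≤ z) :
    ∑ q ∈ G, ‖expSum A h q 1‖ ≤ 50 * x / (3 * Real.log w / k) *
      ((∑ a ∈ primePowerPairs A z x, localFactor A h z a) ^ (k - 1) / (k - 1).factorial) := by
  classical
  -- No sign of x is assumed: a member of G makes x positive, and for negative x there are no prime
  -- power pairs, so the right side is 0.
  rcases G.eq_empty_or_nonempty with rfl | hGne
  · rw [sum_empty]
    rcases le_or_gt 0 x with hx | hx
    · have : 0 ≤ ∑ a ∈ primePowerPairs A z x, localFactor A h z a :=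
        sum_nonneg fun a _ => localFactor_nonneg A h z a
      have := Real.log_pos hw
      positivity
    · have : primePowerPairs A z x = ∅ := by
        simp [primePowerPairs, Nat.floor_of_nonpos hx.le]
      rw [this, sum_empty, zero_pow (by omega)]
      simp
  have hw0 : 0 < w := by linarith
  have hlw := Real.log_pos hw
  have hk0 : (0 : ℝ) < k := by exact_mod_cast (by omega : 0 < k)
  have hkz : z ^ k ≤ w := by
    refine le_trans (pow_le_pow_right₀ hz ?_) hzw
    nlinarith
  have hww : w ≤ w ^ 3 := le_self_pow₀ hw.le (by norm_num)
  have hex : ∀ q ∈ G, ∃ p, p.Prime ∧ p ∣ q ∧ Nat.Coprime (q / p) p ∧ (q : ℝ) ≤ (p : ℝ) ^ k := by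
    intro q hq
    obtain ⟨h1, h2, h3⟩ := hG q hq
    exact exists_large_prime_factor (by omega) (mem_moduliWith.1 h1).2.2.2
      (hkz.trans_lt (hww.trans_lt h2)) h3
  choose! P hPp hPd hPc hPk using hex
  have hq : ∀ q ∈ G, q / P q * P q = q := fun q hq => Nat.div_mul_cancel (hPd q hq)
  have hx0 : 0 < x := by
    obtain ⟨q, hq⟩ := hGne
    obtain ⟨h1, h2, -⟩ := mem_moduliWith.1 (hG q hq).1
    exact lt_of_lt_of_le (by exact_mod_cast h1) h2
  set T := G.image fun q => q / P q with hT
  set ℓ := 3 * Real.log w / k with hℓ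
  have hℓ0 : 0 < ℓ := by positivity
  have hfiber : ∀ t ∈ T, ∑ q ∈ G.filter (fun q => q / P q = t), ‖expSum A h q 1‖ ≤
      50 * x / ℓ * ∏ p ∈ t.primeFactors, localFactor A h z (p, t.factorization p) := by
    intro t ht
    obtain ⟨q, hqG, hqt⟩ := mem_image.1 ht
    obtain ⟨hq1, hq2, hq3, hq4⟩ := mem_moduliWith.1 (hG q hqG).1
    have hqw := (hG q hqG).2.1
    have hqe : t * P q = q := hqt ▸ hq q hqG
    have ht0 : t ≠ 0 := left_ne_zero_of_mul (hqe.trans_ne (by omega))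
    have ht0' : (0 : ℝ) < t := by exact_mod_cast Nat.pos_of_ne_zero ht0
    have hPx : (P q : ℝ) ≤ x / t := by
      rw [le_div_iff₀' ht0']
      exact_mod_cast (congrArg (Nat.cast (R := ℝ)) hqe).le.trans hq2
    have hPw : w ^ 3 < (P q : ℝ) ^ k := hqw.trans_le (hPk q hqG)
    have hP0 : (0 : ℝ) < P q := by exact_mod_cast (hPp q hqG).pos
    have htcard : t.primeFactors.card ≤ k := by
      rw [← hq4]
      exact card_le_card (Nat.primeFactors_mono ⟨_, hqe.symm⟩ (by omega))
    have hmain := sum_norm_expSum_multiples_le A h ht0 hℓ0 hx0 hz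
      (le_trans (by exact_mod_cast (hPp q hqG).two_le) hPx) (z := z) ?_ ?_
      ((G.filter (fun q => q / P q = t)).image P) ?_
    · refine le_trans (le_of_eq ?_) hmain
      rw [sum_image]
      · refine sum_congr rfl fun r hr => ?_
        obtain ⟨hr1, hr2⟩ := mem_filter.1 hr
        have : t * P r = r := hr2 ▸ hq r hr1
        rw [this]
      · intro r hr s hs hrs
        obtain ⟨hr1, hr2⟩ := mem_filter.1 (mem_coe.1 hr)
        obtain ⟨hs1, hs2⟩ := mem_filter.1 (mem_coe.1 hs)
        rw [← hq r hr1, ← hq s hs1, hr2, hs2, hrs]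
    -- The sieve's size condition: z^(4k) ≤ P, because the k-th power of the left side is z^(4k²) ≤
    -- w < P^k.
    · refine le_trans ?_ hPx
      refine le_trans (pow_le_pow_right₀ hz (Nat.mul_le_mul_left 4 htcard)) ?_
      refine le_of_lt (lt_of_pow_lt_pow_left₀ k hP0.le ?_)
      rw [← pow_mul, show 4 * k * k = 4 * k ^ 2 by ring]
      exact (hzw.trans hww).trans_lt hPw
    · refine le_trans ?_ (Real.log_le_log hP0 hPx)
      rw [hℓ, div_le_iff₀' hk0]
      have := Real.log_le_log (by positivity) hPw.le
      rw [Real.log_pow, Real.log_pow] at this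
      exact_mod_cast this
    · intro p hp
      obtain ⟨r, hr, rfl⟩ := mem_image.1 hp
      obtain ⟨hr1, hr2⟩ := mem_filter.1 hr
      have hrx := (mem_moduliWith.1 (hG r hr1).1).2.1
      have e : t * P r = r := hr2 ▸ hq r hr1
      refine ⟨hPp r hr1, ?_, hr2 ▸ hPc r hr1⟩
      rw [le_div_iff₀' ht0']
      exact_mod_cast (congrArg (Nat.cast (R := ℝ)) e).le.trans hrx
  have hTmem : ∀ t ∈ T, t ≠ 0 ∧ t.primeFactors.card = k - 1 ∧
      ∀ p ∈ t.primeFactors, (p, t.factorization p) ∈ primePowerPairs A z x := by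
    intro t ht
    obtain ⟨q, hqG, hqt⟩ := mem_image.1 ht
    obtain ⟨hq1, hq2, hq3, hq4⟩ := mem_moduliWith.1 (hG q hqG).1
    have hqe : t * P q = q := hqt ▸ hq q hqG
    have hc : Nat.Coprime t (P q) := hqt ▸ hPc q hqG
    have ht0 : t ≠ 0 := left_ne_zero_of_mul (hqe.trans_ne (by omega))
    have hPq := hPp q hqG
    have hrt : 1 ≤ rho A t := by
      rw [← hqe, rho_mul A hc] at hq3
      exact Nat.pos_of_ne_zero (left_ne_zero_of_mul (Nat.one_le_iff_ne_zero.1 hq3))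
    refine ⟨ht0, ?_, fun p hp => ?_⟩
    · rw [← hqe, hc.primeFactors_mul, card_union_of_disjoint hc.disjoint_primeFactors,
        hPq.primeFactors, card_singleton] at hq4
      omega
    · obtain ⟨hp1, hp2, -⟩ := Nat.mem_primeFactors.1 hp
      have hpP : p ≠ P q := fun e => by
        have : P q ∣ 1 := by
          rw [← hc.gcd_eq_one]
          exact Nat.dvd_gcd (e ▸ hp2) dvd_rfl
        exact hPq.one_lt.ne' (Nat.dvd_one.1 this)
      have hfac : q.factorization p = t.factorization p := by
        rw [← hqe, Nat.factorization_mul ht0 hPq.ne_zero, hPq.factorization]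
        simp [hpP.symm]
      have hpq : p ∈ q.primeFactors :=
        Nat.primeFactors_mono ⟨_, hqe.symm⟩ (by omega) hp
      refine mem_primePowerPairs.2 ⟨?_, hp1, ?_, one_le_rho_pow_factorization A ht0 hrt hp, ?_⟩
      · exact Nat.pos_of_ne_zero (Finsupp.mem_support_iff.1 (by simpa using hp))
      · refine le_trans ?_ hq2
        rw [← hfac]
        exact_mod_cast Nat.le_of_dvd hq1 (Nat.ordProj_dvd q p)
      · rw [← hfac]
        exact (hG q hqG).2.2 p hpq
  calc ∑ q ∈ G, ‖expSum A h q 1‖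
      = ∑ t ∈ T, ∑ q ∈ G.filter (fun q => q / P q = t), ‖expSum A h q 1‖ :=
        (sum_fiberwise_of_maps_to (fun q hq => mem_image_of_mem _ hq) _).symm
    _ ≤ ∑ t ∈ T, 50 * x / ℓ * ∏ p ∈ t.primeFactors, localFactor A h z (p, t.factorization p) :=
        sum_le_sum hfiber
    _ = 50 * x / ℓ * ∑ t ∈ T, ∏ p ∈ t.primeFactors, localFactor A h z (p, t.factorization p) :=
        (mul_sum _ _ _).symm
    _ ≤ _ := mul_le_mul_of_nonneg_left (sum_prod_primeFactors_le A _
        (localFactor_nonneg A h z) z x (k - 1) T hTmem) (by positivity)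

/-- Two exceptional sets are counted trivially: q ≤ w³, and q with a higher prime power exceeding z,
which have a square divisor d² with d > D. -/
theorem sum_norm_expSum_moduliWith_le (A : LocalSets n) (h : Fin n → ℤ) {k D : ℕ} {w x z : ℝ}
    (hk : 2 ≤ k) (hw : 1 < w) (hx : 0 ≤ x) (hz : 1 ≤ z) (hzw : z ^ (4 * k ^ 2) ≤ w) (hD : 1 ≤ D)
    (hDz : (D : ℝ) ^ 3 ≤ z) :
    ∑ q ∈ moduliWith A k x, ‖expSum A h q 1‖ ≤ w ^ 3 + x / D + 50 * x / (3 * Real.log w / k) *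
      ((∑ a ∈ primePowerPairs A z x, localFactor A h z a) ^ (k - 1) / (k - 1).factorial) := by
  classical
  set Q := moduliWith A k x with hQ
  have hmem : ∀ q ∈ Q, 1 ≤ q ∧ (q : ℝ) ≤ x := fun q hq =>
    ⟨(mem_moduliWith.1 hq).1, (mem_moduliWith.1 hq).2.1⟩
  have hone : ∀ S ⊆ Q, ∑ q ∈ S, ‖expSum A h q 1‖ ≤ (S.card : ℝ) := fun S hS => by
    rw [← nsmul_one]
    refine sum_le_card_nsmul _ _ _ fun q hq => ?_
    have : NeZero q := ⟨by have := (hmem q (hS hq)).1; omega⟩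
    exact norm_expSum_le_one A h q 1
  set smooth : ℕ → Prop := fun q => ∀ p ∈ q.primeFactors,
      2 ≤ q.factorization p → ((p ^ q.factorization p : ℕ) : ℝ) ≤ z with hsm
  have h1 : ∑ q ∈ Q.filter (fun q : ℕ => ¬ w ^ 3 < (q : ℝ)), ‖expSum A h q 1‖ ≤ w ^ 3 := by
    refine (hone _ (filter_subset _ _)).trans ?_
    have hsub : Q.filter (fun q : ℕ => ¬ w ^ 3 < (q : ℝ)) ⊆ Icc 1 ⌊w ^ 3⌋₊ := fun q hq => by
      obtain ⟨ha, hb⟩ := mem_filter.1 hq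
      exact mem_Icc.2 ⟨(hmem q ha).1, Nat.le_floor (not_lt.1 hb)⟩
    have := card_le_card hsub
    rw [Nat.card_Icc, Nat.add_sub_cancel] at this
    exact (Nat.cast_le.2 this).trans (Nat.floor_le (by positivity))
  have h2 : ∑ q ∈ (Q.filter (fun q : ℕ => w ^ 3 < (q : ℝ))).filter (fun q => ¬ smooth q),
      ‖expSum A h q 1‖ ≤ x / D := by
    refine (hone _ ((filter_subset _ _).trans (filter_subset _ _))).trans
      (card_le_of_sq_dvd hx hD _ fun q hq => ?_)
    obtain ⟨ha, hb⟩ := mem_filter.1 hq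
    obtain ⟨hc, hd⟩ := hmem q (mem_filter.1 ha).1
    refine ⟨hc, hd, ?_⟩
    simp only [hsm, not_forall, not_le] at hb
    obtain ⟨p, hp, hv, hlt⟩ := hb
    exact exists_sq_dvd_of_lt_pow hv (Nat.prime_of_mem_primeFactors hp)
      (Nat.ordProj_dvd q p) hlt hDz
  have h3 := sum_norm_expSum_good_le A h hk hw hz hzw
    ((Q.filter (fun q : ℕ => w ^ 3 < (q : ℝ))).filter smooth) fun q hq => by
      obtain ⟨ha, hb⟩ := mem_filter.1 hq
      exact ⟨(mem_filter.1 ha).1, (mem_filter.1 ha).2, hb⟩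
  rw [← sum_filter_add_sum_filter_not Q (fun q : ℕ => w ^ 3 < (q : ℝ)),
    ← sum_filter_add_sum_filter_not (Q.filter (fun q : ℕ => w ^ 3 < (q : ℝ))) smooth]
  linarith

end UpperBound

/-! ### The sum of the local factors. -/

section LocalFactors

open Finset

variable {n : ℕ}

theorem lam_le_rho (A : LocalSets n) (p : ℕ) [NeZero p] : lam A p ≤ rho A p := by
  refine csSup_le' ?_
  rintro m ⟨H, -, rfl⟩
  exact Set.ncard_le_ncard Set.inter_subset_right (Set.toFinite _)

theorem localFactor_le_two_div (A : LocalSets n) (h : Fin n → ℤ) (z : ℝ) {p v : ℕ} (hp : p.Prime) :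
    localFactor A h z (p, v) ≤ 2 / (p : ℝ) ^ v := by
  have hp1 : (1 : ℝ) ≤ p := by exact_mod_cast hp.one_le
  have hp0 : (0 : ℝ) < (p : ℝ) ^ v := by positivity
  have : NeZero (p ^ v) := ⟨pow_ne_zero _ hp.ne_zero⟩
  have hU := unitSum_le A h (p ^ v)
  unfold localFactor
  dsimp only
  push_cast at hU ⊢
  split_ifs
  · have h2 : 1 + 1 / (p : ℝ) ≤ 2 := by
      have : 1 / (p : ℝ) ≤ 1 := (div_le_one (by linarith)).2 hp1
      linarith
    calc _ ≤ (p : ℝ) ^ v / ((p : ℝ) ^ v) ^ 2 * 2 := by gcongr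
      _ = _ := by field_simp
  · gcongr
    norm_num

/-- The terms are, in order: the Cauchy–Schwarz saving, the effect of the factor 1 + 1/p, the primes
dividing every h_i (no saving), and the primes above z (trivial bound). -/
theorem localFactor_prime_le (A : LocalSets n) (h : Fin n → ℤ) (z : ℝ) {p : ℕ} (hp : p.Prime) :
    localFactor A h z (p, 1) ≤ 1 / (p : ℝ) * √(lam A p / rho A p) + 1 / (p : ℝ) ^ 2 +
      (if (fun i => (h i : ZMod p)) = 0 then 2 * (1 / (p : ℝ)) else 0) +
      (if z < p then 1 / (p : ℝ) else 0) := by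
  have hp0 : (0 : ℝ) < p := by exact_mod_cast hp.pos
  have : NeZero p := ⟨hp.ne_zero⟩
  set s := √((lam A p : ℝ) / rho A p) with hs
  have hs0 : 0 ≤ s := Real.sqrt_nonneg _
  have hs1 : s ≤ 1 := by
    rw [hs, Real.sqrt_le_one]
    exact div_le_one_of_le₀ (by exact_mod_cast lam_le_rho A p) (Nat.cast_nonneg _)
  have hi : 0 ≤ (if z < p then 1 / (p : ℝ) else 0) := by split_ifs <;> positivity
  have h1 : 0 ≤ 1 / (p : ℝ) * s := by positivity
  have h2 : 0 ≤ 1 / (p : ℝ) ^ 2 := by positivity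
  by_cases h0 : (fun i => (h i : ZMod p)) = 0
  · rw [if_pos h0]
    have := localFactor_le_two_div A h z (v := 1) hp
    rw [pow_one] at this
    have e : 2 / (p : ℝ) = 2 * (1 / (p : ℝ)) := by ring
    linarith
  · rw [if_neg h0]
    unfold localFactor
    simp only [pow_one]
    by_cases hz : (p : ℝ) ≤ z
    · rw [if_pos hz, if_neg (not_lt.2 hz)]
      have hU := unitSum_prime_le A h p h0
      calc unitSum A h p / (p : ℝ) ^ 2 * (1 + 1 / (p : ℝ))
          ≤ (p * s) / (p : ℝ) ^ 2 * (1 + 1 / (p : ℝ)) := by gcongr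
        _ = 1 / (p : ℝ) * s + 1 / (p : ℝ) ^ 2 * s := by field_simp
        _ ≤ 1 / (p : ℝ) * s + 1 / (p : ℝ) ^ 2 * 1 := by gcongr
        _ = _ := by ring
    · rw [if_neg hz, if_pos (not_le.1 hz)]
      linarith

/-- The product of these primes divides a nonzero coordinate of size at most 2^K, so there are at
most K of them. -/
theorem sum_inv_common_primes_le (h : Fin n → ℤ) (hh : h ≠ 0) {K : ℕ} (hK : 1 ≤ K)
    (hN : ∀ i, |h i| ≤ 2 ^ K) (S : Finset ℕ)
    (hS : ∀ p ∈ S, p.Prime ∧ (fun i => (h i : ZMod p)) = 0) :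
    ∑ p ∈ S, 1 / (p : ℝ) ≤ 1 + Real.log K := by
  obtain ⟨i, hi⟩ := Function.ne_iff.1 hh
  have hi' : (h i).natAbs ≠ 0 := Int.natAbs_ne_zero.2 hi
  have hdvd : ∏ p ∈ S, p ∣ (h i).natAbs := by
    refine Finset.prod_primes_dvd _ (fun p hp => (hS p hp).1.prime) fun p hp => ?_
    have := congrFun (hS p hp).2 i
    simp only [Pi.zero_apply] at this
    exact Int.natCast_dvd.1 ((ZMod.intCast_zmod_eq_zero_iff_dvd _ _).1 this)
  have h1 : 2 ^ S.card ≤ ∏ p ∈ S, p := by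
    rw [← prod_const]
    exact prod_le_prod' fun p hp => (hS p hp).1.two_le
  have h2 : (h i).natAbs ≤ 2 ^ K := by
    zify
    exact hN i
  have h3 : S.card ≤ K := (Nat.pow_le_pow_iff_right (by norm_num)).1
    ((h1.trans (Nat.le_of_dvd (Nat.pos_of_ne_zero hi') hdvd)).trans h2)
  exact sum_inv_le_one_add_log S (fun p hp => (hS p hp).1.pos) (by exact_mod_cast hK)
    (by exact_mod_cast h3)

theorem sum_inv_sq_le_two_of_pos (S : Finset ℕ) (hS : ∀ p ∈ S, 0 < p) :
    ∑ p ∈ S, 1 / (p : ℝ) ^ 2 ≤ 2 := by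
  refine le_trans (sum_le_sum_of_subset_of_nonneg (fun p hp => ?_) fun _ _ _ => by positivity)
    (sum_inv_sq_le_two (S.sup id))
  exact mem_Icc.2 ⟨hS p hp, le_sup (f := id) hp⟩

theorem sum_inv_higher_powers_le (M : ℕ) (S : Finset ℕ) (hS : ∀ p ∈ S, 2 ≤ p) :
    ∑ a ∈ S ×ˢ Ico 2 M, 2 / (a.1 : ℝ) ^ a.2 ≤ 8 := by
  rw [sum_product]
  have h1 : ∀ p ∈ S, ∑ v ∈ Ico 2 M, 2 / (p : ℝ) ^ v ≤ 4 * (1 / (p : ℝ) ^ 2) := by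
    intro p hp
    have hp2 : (2 : ℝ) ≤ p := by exact_mod_cast hS p hp
    have hinv : (p : ℝ)⁻¹ ≤ 2⁻¹ := inv_anti₀ (by norm_num) hp2
    have h := geom_sum_Ico_le_of_lt_one (m := 2) (n := M) (x := (p : ℝ)⁻¹) (by positivity)
      (by norm_num at hinv ⊢; linarith)
    have e : ∑ v ∈ Ico 2 M, 2 / (p : ℝ) ^ v = 2 * ∑ v ∈ Ico 2 M, ((p : ℝ)⁻¹) ^ v := by
      rw [mul_sum]
      exact sum_congr rfl fun v _ => by rw [inv_pow, div_eq_mul_inv]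
    rw [e]
    have h2 : (p : ℝ)⁻¹ ^ 2 / (1 - (p : ℝ)⁻¹) ≤ (p : ℝ)⁻¹ ^ 2 / (1 / 2) := by
      gcongr
      norm_num at hinv ⊢
      linarith
    calc _ ≤ 2 * ((p : ℝ)⁻¹ ^ 2 / (1 / 2)) := by linarith
      _ = _ := by rw [inv_pow]; ring
  refine (sum_le_sum h1).trans ?_
  rw [← mul_sum]
  have := sum_inv_sq_le_two_of_pos S fun p hp => lt_of_lt_of_le (by norm_num) (hS p hp)
  linarith

/-- Cauchy–Schwarz with weights 1/p turns the hypothesis on the mean of λ/ρ into the factor √δ. The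
frequency enters only through K. The 22 collects 2 from the sum of 1/p², 12 from the primes above z
and 8 from the higher powers. -/
theorem sum_localFactor_le (A : LocalSets n) (h : Fin n → ℤ) (hh : h ≠ 0) {x z δ : ℝ} {K : ℕ}
    (hz : 4 ≤ z) (hzx : z ≤ x) (hK : 1 ≤ K) (hN : ∀ i, |h i| ≤ 2 ^ K) (hδ : 0 ≤ δ)
    (hlam : ∑ p ∈ primeModuli A x, 1 / (p : ℝ) * ((lam A p : ℝ) / (rho A p : ℝ)) ≤
      δ * ∑ p ∈ primeModuli A x, 1 / (p : ℝ)) :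
    ∑ a ∈ primePowerPairs A z x, localFactor A h z a ≤
      √δ * (∑ p ∈ primeModuli A x, 1 / (p : ℝ)) + 2 * (1 + Real.log K) +
        4 * Real.log (Real.log x / Real.log z) + 22 := by
  classical
  set Q := primeModuli A x with hQ
  have hQp : ∀ p ∈ Q, p.Prime ∧ (p : ℝ) ≤ x := fun p hp =>
    ⟨(mem_primeModuli.1 hp).1, (mem_primeModuli.1 hp).2.1⟩
  have hsplit : primePowerPairs A z x ⊆ (Q.image fun p => (p, 1)) ∪
      ((Icc 1 ⌊x⌋₊).filter Nat.Prime ×ˢ Ico 2 (⌊x⌋₊ + 1)) := by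
    rintro ⟨p, v⟩ ha
    have hb := (mem_filter.1 ha).1
    obtain ⟨h1, h2, h3, h4, -⟩ := mem_primePowerPairs.1 ha
    rw [mem_product, mem_Icc, mem_Icc] at hb
    rcases eq_or_ne v 1 with rfl | hv
    · rw [pow_one] at h3 h4
      exact mem_union_left _ (mem_image.2 ⟨p, mem_primeModuli.2 ⟨h2, h3, h4⟩, rfl⟩)
    · refine mem_union_right _ (mem_product.2 ⟨mem_filter.2 ⟨mem_Icc.2 hb.1, h2⟩, ?_⟩)
      have := hb.2
      dsimp only at this ⊢
      exact mem_Ico.2 ⟨by omega, by omega⟩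
  have hCS : ∑ p ∈ Q, 1 / (p : ℝ) * √((lam A p : ℝ) / rho A p) ≤
      √δ * ∑ p ∈ Q, 1 / (p : ℝ) := by
    set P := ∑ p ∈ Q, 1 / (p : ℝ) with hP
    have hP0 : 0 ≤ P := sum_nonneg fun _ _ => by positivity
    have h1 := Real.sum_sqrt_mul_sqrt_le Q (f := fun p : ℕ => 1 / (p : ℝ))
      (g := fun p : ℕ => 1 / (p : ℝ) * ((lam A p : ℝ) / rho A p)) (fun _ => by positivity)
      (fun _ => by positivity)
    calc ∑ p ∈ Q, 1 / (p : ℝ) * √((lam A p : ℝ) / rho A p)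
        = ∑ p ∈ Q, √(1 / (p : ℝ)) * √(1 / (p : ℝ) * ((lam A p : ℝ) / rho A p)) := by
          refine sum_congr rfl fun p _ => ?_
          rw [Real.sqrt_mul (by positivity), ← mul_assoc, Real.mul_self_sqrt (by positivity)]
      _ ≤ √P * √(∑ p ∈ Q, 1 / (p : ℝ) * ((lam A p : ℝ) / rho A p)) := h1
      _ ≤ √P * √(δ * P) := by gcongr
      _ = √δ * P := by
          rw [Real.sqrt_mul hδ, mul_left_comm, Real.mul_self_sqrt hP0]
  have h2 := sum_inv_sq_le_two_of_pos Q fun p hp => (hQp p hp).1.pos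
  have h3 := sum_inv_common_primes_le h hh hK hN
    (Q.filter fun p => (fun i => (h i : ZMod p)) = 0) fun p hp =>
      ⟨(hQp p (mem_filter.1 hp).1).1, (mem_filter.1 hp).2⟩
  have h4 := sum_inv_primes_Ioc_le hz hzx (Q.filter fun p : ℕ => z < (p : ℝ)) fun p hp =>
    ⟨(hQp p (mem_filter.1 hp).1).1, (mem_filter.1 hp).2, (hQp p (mem_filter.1 hp).1).2⟩
  have h5 : ∑ a ∈ Q.image fun p => (p, 1), localFactor A h z a ≤
      ∑ p ∈ Q, 1 / (p : ℝ) * √((lam A p : ℝ) / rho A p) + ∑ p ∈ Q, 1 / (p : ℝ) ^ 2 +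
      2 * (∑ p ∈ Q.filter fun p => (fun i => (h i : ZMod p)) = 0, 1 / (p : ℝ)) +
      ∑ p ∈ Q.filter fun p : ℕ => z < (p : ℝ), 1 / (p : ℝ) := by
    rw [sum_image fun a _ b _ e => (Prod.mk.inj e).1, mul_sum, sum_filter, sum_filter,
      ← sum_add_distrib, ← sum_add_distrib, ← sum_add_distrib]
    exact sum_le_sum fun p hp => localFactor_prime_le A h z (hQp p hp).1
  have h6 : ∑ a ∈ (Icc 1 ⌊x⌋₊).filter Nat.Prime ×ˢ Ico 2 (⌊x⌋₊ + 1), localFactor A h z a ≤ 8 := by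
    refine le_trans (sum_le_sum fun a ha => ?_)
      (sum_inv_higher_powers_le (⌊x⌋₊ + 1) ((Icc 1 ⌊x⌋₊).filter Nat.Prime)
        fun p hp => (mem_filter.1 hp).2.two_le)
    exact localFactor_le_two_div A h z (mem_filter.1 (mem_product.1 ha).1).2
  have h7 := sum_le_sum_of_subset_of_nonneg hsplit (f := localFactor A h z)
    fun a _ _ => localFactor_nonneg A h z a
  have h8 := sum_union_inter (s₁ := Q.image fun p => (p, 1))
    (s₂ := (Icc 1 ⌊x⌋₊).filter Nat.Prime ×ˢ Ico 2 (⌊x⌋₊ + 1)) (f := localFactor A h z)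
  have h9 : 0 ≤ ∑ a ∈ (Q.image fun p => (p, 1)) ∩
      ((Icc 1 ⌊x⌋₊).filter Nat.Prime ×ˢ Ico 2 (⌊x⌋₊ + 1)), localFactor A h z a :=
    sum_nonneg fun a _ => localFactor_nonneg A h z a
  linarith

end LocalFactors

/-! ### The averaged discrepancy and the numerical trade-offs. -/

section Averages

open Finset

variable {n : ℕ}

theorem sum_disc_moduliWith_le (A : LocalSets n) {k D N K : ℕ} {w x z δ η : ℝ}
    (hk : 2 ≤ k) (hw : 1 < w) (hz : 4 ≤ z) (hzx : z ≤ x) (hzw : z ^ (4 * k ^ 2) ≤ w)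
    (hD : 1 ≤ D) (hDz : (D : ℝ) ^ 3 ≤ z) (hN : 1 ≤ N) (hK : 1 ≤ K) (hNK : N ≤ 2 ^ K)
    (hη : 0 < η) (hδ : 0 ≤ δ)
    (hlam : ∑ p ∈ primeModuli A x, 1 / (p : ℝ) * ((lam A p : ℝ) / (rho A p : ℝ)) ≤
      δ * ∑ p ∈ primeModuli A x, 1 / (p : ℝ)) :
    ∑ q ∈ moduliWith A k x, disc (Delta A q) ≤
      (moduliWith A k x).card * (2 * n * η + (n + 1) * (1 / (4 * N * η ^ 2))) +
      (3 + 2 * Real.log N) ^ n * (w ^ 3 + x / D + 50 * x / (3 * Real.log w / k) *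
        ((√δ * (∑ p ∈ primeModuli A x, 1 / (p : ℝ)) + 2 * (1 + Real.log K) +
          4 * Real.log (Real.log x / Real.log z) + 22) ^ (k - 1) / (k - 1).factorial)) := by
  classical
  set M := √δ * (∑ p ∈ primeModuli A x, 1 / (p : ℝ)) + 2 * (1 + Real.log K) +
          4 * Real.log (Real.log x / Real.log z) + 22 with hM
  set E := w ^ 3 + x / D + 50 * x / (3 * Real.log w / k) * (M ^ (k - 1) / (k - 1).factorial)
    with hE
  have hx0 : 0 < x := by linarith
  have hlw := Real.log_pos hw
  have hlx : Real.log z ≤ Real.log x := Real.log_le_log (by linarith) hzx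
  have hlz : 0 < Real.log z := Real.log_pos (by linarith)
  have hM0 : 0 ≤ M := by
    have h1 : 0 ≤ Real.log (Real.log x / Real.log z) := Real.log_nonneg ((one_le_div hlz).2 hlx)
    have h2 : 0 ≤ Real.log K := Real.log_natCast_nonneg K
    have h3 : 0 ≤ ∑ p ∈ primeModuli A x, 1 / (p : ℝ) := sum_nonneg fun _ _ => by positivity
    positivity
  have hE0 : 0 ≤ E := by positivity
  have hW : ∀ τ : Fin n → Fin N × Fin N, vecFreq τ ≠ 0 →
      ∑ q ∈ moduliWith A k x, ‖expSum A (vecFreq τ) q 1‖ ≤ E := by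
    intro τ hτ
    refine (sum_norm_expSum_moduliWith_le A (vecFreq τ) hk hw hx0.le (by linarith) hzw hD
      hDz).trans ?_
    have h1 := sum_localFactor_le A (vecFreq τ) hτ hz hzx hK (fun i => by
      refine (abs_pairFreq_le (τ i)).trans ?_
      exact_mod_cast hNK) hδ hlam
    have h2 : 0 ≤ ∑ a ∈ primePowerPairs A z x, localFactor A (vecFreq τ) z a :=
      sum_nonneg fun a _ => localFactor_nonneg A _ z a
    rw [hE]
    gcongr
  have hweight : ∀ τ : Fin n → Fin N × Fin N, 0 ≤ ∏ i, pairWeight (τ i) :=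
    fun τ => prod_nonneg fun i _ => pairWeight_nonneg _
  have htotal : ∑ q ∈ moduliWith A k x, expSumTotal A N q ≤ (3 + 2 * Real.log N) ^ n * E := by
    unfold expSumTotal
    rw [sum_comm]
    calc _ ≤ ∑ τ ∈ (univ : Finset (Fin n → Fin N × Fin N)).filter (fun τ => vecFreq τ ≠ 0),
          (∏ i, pairWeight (τ i)) * E := by
            refine sum_le_sum fun τ hτ => ?_
            rw [← mul_sum]
            exact mul_le_mul_of_nonneg_left (hW τ (mem_filter.1 hτ).2) (hweight τ)
      _ ≤ ∑ τ : Fin n → Fin N × Fin N, (∏ i, pairWeight (τ i)) * E :=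
          sum_le_sum_of_subset_of_nonneg (filter_subset _ _) fun τ _ _ =>
            mul_nonneg (hweight τ) hE0
      _ = (∑ τ : Fin n → Fin N × Fin N, ∏ i, pairWeight (τ i)) * E := (sum_mul _ _ _).symm
      _ ≤ _ := mul_le_mul_of_nonneg_right (sum_prod_pairWeight_le hN) hE0
  calc _ ≤ ∑ q ∈ moduliWith A k x, (2 * n * η + (n + 1) * (1 / (4 * N * η ^ 2)) +
        expSumTotal A N q) := by
        refine sum_le_sum fun q hq => ?_
        obtain ⟨h1, -, h3, -⟩ := mem_moduliWith.1 hq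
        have : NeZero q := ⟨by omega⟩
        exact disc_Delta_le A q h3 hN hη
    _ ≤ _ := by
        rw [sum_add_distrib, sum_const, nsmul_eq_mul]
        linarith

/-- The smallest of the first k terms of the geometric series is at most their average. -/
theorem natCast_mul_pow_pred_le {r : ℝ} (hr0 : 0 ≤ r) (hr1 : r < 1) (k : ℕ) :
    (k : ℝ) * r ^ (k - 1) ≤ 1 / (1 - r) := by
  have h1 : (k : ℝ) * r ^ (k - 1) ≤ ∑ j ∈ range k, r ^ j := by
    have := card_nsmul_le_sum (range k) (fun j => r ^ j) (r ^ (k - 1)) fun j hj =>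
      pow_le_pow_of_le_one hr0 hr1.le (by have := mem_range.1 hj; omega)
    rwa [card_range, nsmul_eq_mul] at this
  refine h1.trans ?_
  have h2 := geom_sum_Ico_le_of_lt_one (m := 0) (n := k) hr0 hr1
  rwa [pow_zero, ← range_eq_Ico] at h2

/-- Split θ⁵ = θ³·θ². As θ³ ≤ e^(-3/10), the factor (1.05/0.95)·θ³ stays below 0.83, and the powers
of 0.83 absorb k; θ² is what remains. -/
theorem mul_pow_pred_le_of_ratio {θ M d P : ℝ} (hθ1 : θ ^ 10 ≤ 1 / Real.exp 1)
    (hM0 : 0 ≤ M) (hM : M ≤ 1.05 * (θ ^ 5 * P)) (hd : 0.95 * P ≤ d) (hP : 0 ≤ P) (k : ℕ) :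
    (k : ℝ) * M ^ (k - 1) ≤ 6 * (θ ^ (k - 1)) ^ 2 * d ^ (k - 1) := by
  have h1 : θ ^ 10 ≤ 0.368 := by
    refine hθ1.trans ?_
    rw [div_le_iff₀ (Real.exp_pos 1)]
    have := Real.exp_one_gt_d9
    linarith
  have h3 : θ ^ 3 ≤ 0.743 := by
    refine le_of_pow_le_pow_left₀ (n := 10) (by norm_num) (by norm_num) ?_
    calc (θ ^ 3) ^ 10 = (θ ^ 10) ^ 3 := by ring
      _ ≤ 0.368 ^ 3 := by gcongr
      _ ≤ _ := by norm_num
  have hd0 : 0 ≤ d := le_trans (by positivity) hd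
  have hM2 : M ≤ 0.83 * (θ ^ 2 * d) := by
    have hP' : 0 ≤ θ ^ 2 * P := by positivity
    calc M ≤ 1.05 * (θ ^ 5 * P) := hM
      _ = 1.05 * θ ^ 3 * (θ ^ 2 * P) := by ring
      _ ≤ 1.05 * 0.743 * (θ ^ 2 * P) := by gcongr
      _ ≤ 0.83 * (θ ^ 2 * (0.95 * P)) := by nlinarith
      _ ≤ _ := by gcongr
  have h4 := natCast_mul_pow_pred_le (r := 0.83) (by norm_num) (by norm_num) k
  have h5 : (k : ℝ) * 0.83 ^ (k - 1) ≤ 6 := h4.trans (by norm_num)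
  calc (k : ℝ) * M ^ (k - 1) ≤ k * (0.83 * (θ ^ 2 * d)) ^ (k - 1) := by gcongr
    _ = (k * 0.83 ^ (k - 1)) * ((θ ^ (k - 1)) ^ 2 * d ^ (k - 1)) := by
        rw [mul_pow, mul_pow, ← pow_mul, ← pow_mul, mul_comm 2]
        ring
    _ ≤ 6 * ((θ ^ (k - 1)) ^ 2 * d ^ (k - 1)) := by gcongr
    _ = _ := by ring

/-- One power of η pays for n logarithms: for n ≥ 1 and y = η^(-1/n), log(1/η) = n log y ≤ ny, and
y^n·η = 1. -/
theorem log_pow_mul_le (n : ℕ) {η : ℝ} (hη : 0 < η) (hη1 : η ≤ 1) :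
    (5 + 6 * Real.log (1 / η)) ^ n * η ≤ (5 + 6 * n) ^ n := by
  rcases Nat.eq_zero_or_pos n with rfl | hn
  · simpa using hη1
  have hn0 : (0 : ℝ) < n := by exact_mod_cast hn
  set u := 1 / η with hu
  have hu1 : 1 ≤ u := (one_le_div hη).2 hη1
  set y := u ^ (1 / (n : ℝ)) with hy
  have hy1 : 1 ≤ y := Real.one_le_rpow hu1 (by positivity)
  have hyn : y ^ n = u := by
    rw [hy, ← Real.rpow_natCast, ← Real.rpow_mul (by linarith), one_div_mul_cancel hn0.ne',
      Real.rpow_one]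
  have hlog : Real.log u ≤ n * y := by
    rw [← hyn, Real.log_pow]
    gcongr
    exact Real.log_le_self (by linarith)
  have hlog0 : 0 ≤ Real.log u := Real.log_nonneg hu1
  calc (5 + 6 * Real.log u) ^ n * η ≤ ((5 + 6 * n) * y) ^ n * η := by
        gcongr
        nlinarith
    _ = (5 + 6 * n) ^ n * (u * η) := by rw [mul_pow, hyn, mul_assoc]
    _ = _ := by rw [hu, one_div_mul_cancel hη.ne', mul_one]

end Averages

/-! ### Choice of parameters in terms of L = log log x. -/

section Asymptotics

open Finset

variable {n : ℕ}

theorem factorial_pred_le_exp_sq {k : ℕ} {L : ℝ} (hkL : (k : ℝ) ≤ L) :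
    ((k - 1).factorial : ℝ) ≤ Real.exp (L ^ 2) := by
  have hk1 : ((k - 1 : ℕ) : ℝ) ≤ L := le_trans (by exact_mod_cast Nat.sub_le k 1) hkL
  have hL0 : 0 ≤ L := (Nat.cast_nonneg _).trans hk1
  calc ((k - 1).factorial : ℝ) ≤ ((k - 1 : ℕ) : ℝ) ^ (k - 1) := by
        exact_mod_cast Nat.factorial_le_pow (k - 1)
    _ ≤ (Real.exp L) ^ (k - 1) := by
        gcongr
        linarith [Real.add_one_le_exp L]
    _ = Real.exp ((k - 1 : ℕ) * L) := (Real.exp_nat_mul _ _).symm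
    _ ≤ _ := by
        rw [sq]
        gcongr

/-- The target saving is never below exp(-L²), since θ ≥ θ^10 ≥ 1/L ≥ e^(-L) and k ≤ L. This is what
lets it dominate the exceptional moduli. -/
theorem one_le_exp_sq_mul_pow {k : ℕ} {L θ : ℝ} (hkL : (k : ℝ) ≤ L) (hL : 0 < L)
    (hθ : 0 < θ) (hθ1 : θ ≤ 1) (hδ : 1 / L ≤ θ ^ 10) : 1 ≤ Real.exp (L ^ 2) * θ ^ (k - 1) := by
  have h1 : 1 ≤ Real.exp L * θ := by
    have h2 : θ ^ 10 ≤ θ := pow_le_of_le_one hθ.le hθ1 (by norm_num)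
    have h3 : 1 ≤ L * θ := (div_le_iff₀' hL).1 (hδ.trans h2)
    refine h3.trans ?_
    gcongr
    linarith [Real.add_one_le_exp L]
  have hk1 : ((k - 1 : ℕ) : ℝ) ≤ L := le_trans (by exact_mod_cast Nat.sub_le k 1) hkL
  calc 1 ≤ (Real.exp L * θ) ^ (k - 1) := one_le_pow₀ h1
    _ = Real.exp ((k - 1 : ℕ) * L) * θ ^ (k - 1) := by rw [mul_pow, Real.exp_nat_mul]
    _ ≤ _ := by
        rw [sq]
        gcongr

/-- Both exceptional sets have size O(x·e^(-s)), and s ≥ 4L² beats the combined 6 + L + 3L² coming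
from the constant, log x, the factorial and η^(-2). -/
theorem exceptional_le {L s x η F : ℝ} {D : ℕ} (hL : 16 ≤ L) (hs : 4 * L ^ 2 ≤ s)
    (hsX : 48 * L ^ 2 * s = Real.exp L) (hx : x = Real.exp (Real.exp L))
    (hD : D = ⌊Real.exp s⌋₊) (hη : 0 < η) (hη1 : 1 ≤ Real.exp (L ^ 2) * η) (hF0 : 0 ≤ F)
    (hF : F ≤ Real.exp (L ^ 2)) :
    (Real.exp (Real.exp L / 4) ^ 3 + x / D) * (2 * Real.exp L * F) ≤ x * η ^ 2 := by
  have hx0 : 0 < x := hx ▸ Real.exp_pos _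
  have hs0 : 0 ≤ s := le_trans (by positivity) hs
  have hD1 : Real.exp s / 2 ≤ D := by
    have h1 := Nat.lt_floor_add_one (Real.exp s)
    have h2 := Real.add_one_le_exp s
    rw [← hD] at h1
    nlinarith
  have h1 : x / D ≤ 2 * (x * Real.exp (-s)) := by
    calc x / D ≤ x / (Real.exp s / 2) := by gcongr
      _ = _ := by rw [Real.exp_neg]; field_simp
  have h2 : Real.exp (Real.exp L / 4) ^ 3 ≤ x * Real.exp (-s) := by
    rw [hx, ← Real.exp_nat_mul, ← Real.exp_add, Real.exp_le_exp]
    have h4 : 256 ≤ L ^ 2 := by nlinarith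
    have h5 : 48 * 256 * s ≤ 48 * L ^ 2 * s := by gcongr
    push_cast
    linarith
  have h3 : 6 ≤ Real.exp 6 := by linarith [Real.add_one_le_exp (6 : ℝ)]
  have hE2 : 1 ≤ (Real.exp (L ^ 2) * η) ^ 2 := one_le_pow₀ hη1
  calc (Real.exp (Real.exp L / 4) ^ 3 + x / D) * (2 * Real.exp L * F)
      ≤ (3 * (x * Real.exp (-s))) * (2 * Real.exp L * Real.exp (L ^ 2)) := by
        gcongr
        linarith
    _ = 6 * (Real.exp (-s) * Real.exp L * Real.exp (L ^ 2)) * x * 1 := by ring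
    _ ≤ Real.exp 6 * (Real.exp (-s) * Real.exp L * Real.exp (L ^ 2)) * x *
        (Real.exp (L ^ 2) * η) ^ 2 := by gcongr
    _ = Real.exp (6 - s + L + L ^ 2 + L ^ 2 + L ^ 2) * (x * η ^ 2) := by
        simp only [Real.exp_add, Real.exp_sub, Real.exp_neg]
        field_simp
    _ ≤ 1 * (x * η ^ 2) := by
        gcongr
        rw [Real.exp_le_one_iff]
        nlinarith
    _ = _ := one_mul _

/-- The cube is chosen so that the Fejér tail 1/(4Nη²) is at most η, while log N stays comparable to
log(1/η) and N ≤ 2^K with log K = O(log L). -/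
theorem natCeil_inv_cube_bounds {L η : ℝ} (hL : 16 ≤ L) (hη : 0 < η) (hη1 : η ≤ 1)
    (hη2 : 1 ≤ Real.exp (L ^ 2) * η) :
    1 ≤ ⌈(1 / η) ^ 3⌉₊ ∧ 1 / (4 * (⌈(1 / η) ^ 3⌉₊ : ℝ) * η ^ 2) ≤ η ∧
      3 + 2 * Real.log ⌈(1 / η) ^ 3⌉₊ ≤ 5 + 6 * Real.log (1 / η) ∧
      ⌈(1 / η) ^ 3⌉₊ ≤ 2 ^ ⌈L ^ 3⌉₊ := by
  set u := 1 / η with hu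
  have hu1 : 1 ≤ u := (one_le_div hη).2 hη1
  have hu3 : 1 ≤ u ^ 3 := one_le_pow₀ hu1
  set N := ⌈u ^ 3⌉₊ with hN
  have h1 : u ^ 3 ≤ N := Nat.le_ceil _
  have h2 : (N : ℝ) ≤ 2 * u ^ 3 := by
    have := (Nat.ceil_lt_add_one (a := u ^ 3) (by linarith)).le
    linarith
  have hN1 : (1 : ℝ) ≤ N := hu3.trans h1
  have huη : u * η = 1 := one_div_mul_cancel hη.ne'
  have hlog2 := Real.log_two_lt_d9
  have hlog2' := Real.log_two_gt_d9
  refine ⟨by exact_mod_cast hN1, ?_, ?_, ?_⟩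
  · rw [div_le_iff₀ (by positivity)]
    calc (1 : ℝ) = (u * η) ^ 3 := by rw [huη, one_pow]
      _ = u ^ 3 * η ^ 3 := mul_pow _ _ _
      _ ≤ N * η ^ 3 := by gcongr
      _ ≤ 4 * (N * η ^ 3) := by
          have : 0 ≤ N * η ^ 3 := by positivity
          linarith
      _ = _ := by ring
  · have := Real.log_le_log (by linarith) h2
    rw [Real.log_mul (by norm_num) (by positivity), Real.log_pow] at this
    push_cast at this
    linarith
  · have hue : u ≤ Real.exp (L ^ 2) := by
      rw [hu, div_le_iff₀ hη]
      exact hη2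
    have h3 : (N : ℝ) ≤ 2 ^ ⌈L ^ 3⌉₊ := by
      calc (N : ℝ) ≤ 2 * u ^ 3 := h2
        _ ≤ Real.exp 1 * (Real.exp (L ^ 2)) ^ 3 := by
            gcongr
            linarith [Real.add_one_le_exp (1 : ℝ)]
        _ = Real.exp (1 + 3 * L ^ 2) := by
            rw [Real.exp_add, ← Real.exp_nat_mul]
            norm_num
        _ ≤ Real.exp (⌈L ^ 3⌉₊ * Real.log 2) := by
            rw [Real.exp_le_exp]
            have h4 := Nat.le_ceil (L ^ 3)
            have h5 : 16 * L ^ 2 ≤ L ^ 3 := by nlinarith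
            nlinarith
        _ = _ := by rw [Real.exp_nat_mul, Real.exp_log (by norm_num)]
    exact_mod_cast h3

theorem log_natCeil_cube_le {L : ℝ} (hL : 16 ≤ L) :
    1 ≤ ⌈L ^ 3⌉₊ ∧ Real.log ⌈L ^ 3⌉₊ ≤ 1 + 3 * Real.log L := by
  have h0 : (1 : ℝ) ≤ L ^ 3 := one_le_pow₀ (by linarith)
  have h1 : L ^ 3 ≤ ⌈L ^ 3⌉₊ := Nat.le_ceil _
  have h2 : (⌈L ^ 3⌉₊ : ℝ) ≤ 2 * L ^ 3 := by
    have := (Nat.ceil_lt_add_one (a := L ^ 3) (by linarith)).le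
    linarith
  refine ⟨by exact_mod_cast h0.trans h1, ?_⟩
  have := Real.log_le_log (by linarith) h2
  rw [Real.log_mul (by norm_num) (by positivity), Real.log_pow] at this
  push_cast at this
  linarith [Real.log_two_lt_d9]

set_option maxHeartbeats 1000000 in
theorem average_disc_le (A : LocalSets n) {α x₀ c L θ x : ℝ} {k : ℕ} (hα : 0 < α)
    (hA : ManyPrimes A α x₀) (hx₀ : 2 ≤ x₀) (hc : 0 < c) (hx : x = Real.exp (Real.exp L))
    (hL : 16 ≤ L) (hLc : 40 + 14 * Real.log L ≤ 0.05 * (c * √L))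
    (hLe : 192 * L ^ 4 ≤ Real.exp L) (hx₀L : x₀ ≤ Real.exp (Real.exp L / 4))
    (hαL : 2 * Real.log 4 ≤ α * Real.exp (Real.exp L / 4))
    (hP : c * L ≤ ∑ p ∈ primeModuli A x, 1 / (p : ℝ)) (hθ : 0 < θ) (hδL : 1 / L ≤ θ ^ 10)
    (hδe : θ ^ 10 ≤ 1 / Real.exp 1)
    (hlam : ∑ p ∈ primeModuli A x, 1 / (p : ℝ) * ((lam A p : ℝ) / (rho A p : ℝ)) ≤
      θ ^ 10 * ∑ p ∈ primeModuli A x, 1 / (p : ℝ))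
    (hk : 2 ≤ k) (hkα : (k : ℝ) ≤ α * θ ^ 10 * L) :
    (moduliWith A k x).Nonempty ∧
      1 / ((moduliWith A k x).card : ℝ) * ∑ q ∈ moduliWith A k x, disc (Delta A q) ≤
        (2 * (3 * n + 1) + 801 * (5 + 6 * n) ^ n) * (1 / α) * θ ^ (k - 1) := by
  classical
  have hL0 : 0 < L := by linarith
  have hlogL : 0 ≤ Real.log L := Real.log_nonneg (by linarith)
  have hlog2 := Real.log_two_lt_d9
  have hlog4 : Real.log 4 = 2 * Real.log 2 := by
    rw [show (4 : ℝ) = 2 ^ 2 by norm_num, Real.log_pow]; norm_num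
  have hlog16 : Real.log 16 = 4 * Real.log 2 := by
    rw [show (16 : ℝ) = 2 ^ 4 by norm_num, Real.log_pow]; norm_num
  have he := Real.exp_one_gt_d9
  have hα4 : α ≤ 1.39 := by linarith [hA.le_log_four hx₀]
  have hδ1 : θ ^ 10 ≤ 0.368 := by
    refine hδe.trans ?_
    rw [div_le_iff₀ (Real.exp_pos 1)]
    linarith
  have hθ1 : θ ≤ 1 := by
    refine le_of_pow_le_pow_left₀ (n := 10) (by norm_num) (by norm_num) ?_
    rw [one_pow]
    linarith
  have hkL : (k : ℝ) ≤ L := by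
    refine hkα.trans ?_
    refine mul_le_of_le_one_left hL0.le ?_
    calc α * θ ^ 10 ≤ 1.39 * 0.368 := by gcongr
      _ ≤ 1 := by norm_num
  have hk0 : (0 : ℝ) < k := by exact_mod_cast (by omega : 0 < k)
  set X := Real.exp L with hX
  have hX0 : 0 < X := Real.exp_pos _
  -- With z = e^(3s) and k ≤ L, the exponent 4k²·3s is at most 12L²s = X/4 = log w, which is the
  -- condition z^(4k²) ≤ w; D = ⌊e^s⌋ then gives D³ ≤ z.
  set s := X / (48 * L ^ 2) with hs
  have hsX : 48 * L ^ 2 * s = X := mul_div_cancel₀ _ (by positivity)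
  have hs4 : 4 * L ^ 2 ≤ s := by
    rw [hs, le_div_iff₀ (by positivity)]
    linarith
  have hL2 : 256 ≤ L ^ 2 := by nlinarith
  have hs0 : 1024 ≤ s := by linarith
  set w := Real.exp (X / 4) with hw
  set z := Real.exp (3 * s) with hz
  set D := ⌊Real.exp s⌋₊ with hD
  set η := θ ^ (k - 1) with hη
  have hη0 : 0 < η := by positivity
  have hη1 : η ≤ 1 := pow_le_one₀ hθ.le hθ1
  have hη2 : 1 ≤ Real.exp (L ^ 2) * η := one_le_exp_sq_mul_pow hkL hL0 hθ hθ1 hδL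
  obtain ⟨hN1, hNη, hNlog, hNK⟩ := natCeil_inv_cube_bounds hL hη0 hη1 hη2
  obtain ⟨hK1, hKlog⟩ := log_natCeil_cube_le hL
  set N := ⌈(1 / η) ^ 3⌉₊ with hN
  set K := ⌈L ^ 3⌉₊ with hK
  have hlogx : Real.log x = X := by rw [hx, Real.log_exp]
  have hlogz : Real.log z = 3 * s := Real.log_exp _
  have hlogw : Real.log w = X / 4 := Real.log_exp _
  have hx4 : x = w ^ 4 := by
    rw [hx, hw, ← Real.exp_nat_mul]
    congr 1
    push_cast
    ring
  have hw1 : 1 < w := Real.one_lt_exp_iff.2 (by positivity)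
  have hz4 : 4 ≤ z := by linarith [Real.add_one_le_exp (3 * s)]
  have hsX4 : 3 * s ≤ X := by
    have : 48 * 256 * s ≤ 48 * L ^ 2 * s := by gcongr
    linarith
  have hzx : z ≤ x := by
    rw [hx]
    exact Real.exp_le_exp.2 hsX4
  have hk2L : (k : ℝ) ^ 2 ≤ L ^ 2 := by gcongr
  have hzw : z ^ (4 * k ^ 2) ≤ w := by
    rw [hz, ← Real.exp_nat_mul, hw, Real.exp_le_exp]
    push_cast
    have : 12 * (k : ℝ) ^ 2 * s ≤ 12 * L ^ 2 * s := by gcongr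
    linarith
  have hzw' : z ^ k ≤ w := by
    refine le_trans (pow_le_pow_right₀ (by linarith) ?_) hzw
    nlinarith
  have hD1 : 1 ≤ D := Nat.le_floor (by push_cast; exact Real.one_le_exp (by linarith))
  have hDz : (D : ℝ) ^ 3 ≤ z := by
    calc (D : ℝ) ^ 3 ≤ (Real.exp s) ^ 3 := by
          gcongr
          exact Nat.floor_le (Real.exp_pos _).le
      _ = z := by
          rw [hz, ← Real.exp_nat_mul]
          norm_num
  have hratio : Real.log (Real.log x / Real.log z) ≤ 2.8 + 2 * Real.log L := by
    have : Real.log x / Real.log z = 16 * L ^ 2 := by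
      rw [hlogx, hlogz, div_eq_iff (by positivity), ← hsX]
      ring
    rw [this, Real.log_mul (by norm_num) (by positivity), Real.log_pow, hlog16]
    push_cast
    linarith
  set P := ∑ p ∈ primeModuli A x, 1 / (p : ℝ) with hPdef
  set Pz := ∑ p ∈ primeModuli A z, 1 / (p : ℝ) with hPz
  set d := Pz - (1 + Real.log k) with hd
  have hsqrtL : √L * √L = L := Real.mul_self_sqrt hL0.le
  have hsqrtL1 : 1 ≤ √L := Real.one_le_sqrt.2 (by linarith)
  have hsqrtL0 : 0 < √L := by linarith
  have hθ5 : √(θ ^ 10) = θ ^ 5 := by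
    rw [show θ ^ 10 = (θ ^ 5) ^ 2 by ring, Real.sqrt_sq (by positivity)]
  have hP0 : 0 ≤ P := le_trans (by positivity) hP
  -- The left side dominates all additive errors in M and in P - d. Here δ ≥ 1/L is decisive: θ⁵ =
  -- √δ ≥ 1/√L and P ≥ cL give θ⁵P ≥ c√L.
  have hPerr : 40 + 14 * Real.log L ≤ 0.05 * (θ ^ 5 * P) := by
    refine hLc.trans ?_
    have h1 : 1 ≤ √L * θ ^ 5 := by
      rw [← hθ5, ← Real.sqrt_mul hL0.le, Real.one_le_sqrt]
      rwa [div_le_iff₀' hL0] at hδL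
    have h2 : c * √L ≤ θ ^ 5 * P := by
      calc c * √L = c * √L * 1 := (mul_one _).symm
        _ ≤ c * √L * (√L * θ ^ 5) := by gcongr
        _ = θ ^ 5 * (c * (√L * √L)) := by ring
        _ ≤ _ := by
            rw [hsqrtL]
            gcongr
    linarith
  have hθ5P : θ ^ 5 * P ≤ P := mul_le_of_le_one_left hP0 (pow_le_one₀ hθ.le hθ1)
  have hlogk : Real.log k ≤ Real.log L := Real.log_le_log hk0 hkL
  have hPzP : P - (12 + 4 * (2.8 + 2 * Real.log L)) ≤ Pz := by
    have h1 := sum_inv_primes_Ioc_le hz4 hzx (primeModuli A x \ primeModuli A z) fun p hp => by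
      obtain ⟨h1, h2⟩ := mem_sdiff.1 hp
      obtain ⟨h3, h4, h5⟩ := mem_primeModuli.1 h1
      refine ⟨h3, ?_, h4⟩
      by_contra hle
      exact h2 (mem_primeModuli.2 ⟨h3, not_lt.1 hle, h5⟩)
    have h2 := sum_sdiff (f := fun p : ℕ => 1 / (p : ℝ)) (primeModuli_mono A hzx)
    linarith
  have hdP : 0.95 * P ≤ d := by linarith
  have hd1 : 1 ≤ d := by linarith
  set F : ℝ := ((k - 1).factorial : ℝ) with hF
  have hF0 : 0 < F := by positivity
  have hFL : F ≤ Real.exp (L ^ 2) := factorial_pred_le_exp_sq hkL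
  have hcard := le_card_moduliWith A hA hα hk hw1 hx4 (by linarith) hzw'
    (hx₀L.trans (le_self_pow₀ hw1.le (by norm_num))) hαL (by linarith)
  have hdisc := sum_disc_moduliWith_le A hk hw1 hz4 hzx hzw hD1 hDz hN1 hK1 hNK hη0
    (by positivity) hlam
  have hexc := exceptional_le hL hs4 hsX hx hD hη0 hη2 hF0.le hFL
  set M := √(θ ^ 10) * P + 2 * (1 + Real.log K) + 4 * Real.log (Real.log x / Real.log z) + 22
    with hM
  have hM0 : 0 ≤ M := by
    have h1 : 0 ≤ Real.log (Real.log x / Real.log z) := by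
      rw [hlogx, hlogz]
      exact Real.log_nonneg ((one_le_div (by linarith)).2 hsX4)
    have h2 : 0 ≤ Real.log K := Real.log_natCast_nonneg K
    positivity
  have hMP : M ≤ 1.05 * (θ ^ 5 * P) := by
    rw [hM, hθ5]
    linarith
  have hmain := mul_pow_pred_le_of_ratio hδe hM0 hMP hdP hP0 k
  set Q : ℝ := ((moduliWith A k x).card : ℝ) with hQ
  rw [hlogx] at hcard
  have hx0 : 0 < x := hx ▸ Real.exp_pos _
  have hdk : 1 ≤ d ^ (k - 1) := one_le_pow₀ hd1
  have hQ0 : 0 < Q := lt_of_lt_of_le (by positivity) hcard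
  have hne : (moduliWith A k x).Nonempty := card_pos.1 (Nat.cast_pos.1 hQ0)
  refine ⟨hne, ?_⟩
  have hexc' : w ^ 3 + x / D ≤ 1 / α * η ^ 2 * Q := by
    have h1 : w ^ 3 + x / D ≤ x * η ^ 2 / (2 * X * F) := by
      rwa [le_div_iff₀ (by positivity)]
    refine h1.trans ?_
    calc x * η ^ 2 / (2 * X * F) = 1 / α * η ^ 2 * (α * x / (2 * X) * (1 / F)) := by field_simp
      _ ≤ 1 / α * η ^ 2 * (α * x / (2 * X) * (d ^ (k - 1) / F)) := by gcongr
      _ ≤ _ := by gcongr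
  -- As log w = X/4, the leading constant is 200/3; times 6 from absorbing k, and 2/α from the lower
  -- bound for Q, it becomes 800/α.
  have hmain' : 50 * x / (3 * Real.log w / k) * (M ^ (k - 1) / F) ≤ 800 * (1 / α) * η ^ 2 * Q := by
    calc 50 * x / (3 * Real.log w / k) * (M ^ (k - 1) / F)
        = 200 / 3 * (x / X) * (k * M ^ (k - 1)) / F := by
          rw [hlogw]
          field_simp
          ring
      _ ≤ 200 / 3 * (x / X) * (6 * η ^ 2 * d ^ (k - 1)) / F := by gcongr
      _ = 800 * (1 / α) * η ^ 2 * (α * x / (2 * X) * (d ^ (k - 1) / F)) := by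
          field_simp
          ring
      _ ≤ _ := by gcongr
  have hlogη : 0 ≤ Real.log (1 / η) := Real.log_nonneg ((one_le_div hη0).2 hη1)
  have hlogN : 0 ≤ Real.log N := Real.log_natCast_nonneg N
  have hB0 : 0 ≤ w ^ 3 + x / D + 50 * x / (3 * Real.log w / k) * (M ^ (k - 1) / F) := by
    have hlw := Real.log_pos hw1
    positivity
  have hpow := log_pow_mul_le n hη0 hη1
  -- The cutoff error carries no 1/α; it is inserted using α ≤ 2.
  have hηα : η ≤ 2 * (1 / α) * η := by
    have : 1 ≤ 2 * (1 / α) := by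
      rw [mul_one_div, one_le_div hα]
      linarith
    exact le_mul_of_one_le_left hη0.le this
  -- Of η², one factor cancels the power of log N and the other survives; 801 adds the exceptional
  -- moduli to 800.
  have hexp : (3 + 2 * Real.log N) ^ n * (w ^ 3 + x / D + 50 * x / (3 * Real.log w / k) *
      (M ^ (k - 1) / F)) ≤ 801 * (5 + 6 * n) ^ n * (1 / α) * η * Q := by
    calc _ ≤ (5 + 6 * Real.log (1 / η)) ^ n * (801 * (1 / α) * η ^ 2 * Q) := by
          gcongr
          linarith
      _ = ((5 + 6 * Real.log (1 / η)) ^ n * η) * (801 * (1 / α) * η * Q) := by ring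
      _ ≤ (5 + 6 * n) ^ n * (801 * (1 / α) * η * Q) := by gcongr
      _ = _ := by ring
  have hbox : 2 * n * η + (n + 1) * (1 / (4 * N * η ^ 2)) ≤
      2 * (3 * n + 1) * (1 / α) * η := by
    calc 2 * n * η + (n + 1) * (1 / (4 * N * η ^ 2)) ≤ 2 * n * η + (n + 1) * η := by gcongr
      _ = (3 * n + 1) * η := by ring
      _ ≤ (3 * n + 1) * (2 * (1 / α) * η) := by gcongr
      _ = _ := by ring
  rw [one_div_mul_eq_div, div_le_iff₀ hQ0]
  refine hdisc.trans ?_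
  calc _ ≤ Q * (2 * (3 * n + 1) * (1 / α) * η) + 801 * (5 + 6 * n) ^ n * (1 / α) * η * Q :=
        add_le_add (mul_le_mul_of_nonneg_left hbox hQ0.le) hexp
    _ = _ := by ring

end Asymptotics

/-! ### All largeness conditions hold for large L, depending only on α, x₀ and c. -/

section Threshold

open Filter Topology

theorem eventually_asymptotic_conditions {α x₀ c : ℝ} (hα : 0 < α) (hc : 0 < c) :
    ∀ᶠ L : ℝ in atTop, 16 ≤ L ∧ 40 + 14 * Real.log L ≤ 0.05 * (c * √L) ∧
      192 * L ^ 4 ≤ Real.exp L ∧ x₀ ≤ Real.exp (Real.exp L / 4) ∧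
      2 * Real.log 4 ≤ α * Real.exp (Real.exp L / 4) := by
  have hw : Tendsto (fun L : ℝ => Real.exp (Real.exp L / 4)) atTop atTop :=
    Real.tendsto_exp_atTop.comp (Real.tendsto_exp_atTop.atTop_div_const (by norm_num))
  have h1 : (fun L : ℝ => 40 + 14 * Real.log L) =o[atTop] fun L : ℝ => √L := by
    have hl : Real.log =o[atTop] fun L : ℝ => √L := by
      simp_rw [Real.sqrt_eq_rpow]
      exact isLittleO_log_rpow_atTop (by norm_num)
    refine (Asymptotics.IsLittleO.add ?_ (hl.const_mul_left 14))
    exact Asymptotics.isLittleO_const_left.2 (Or.inr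
      (tendsto_norm_atTop_atTop.comp Real.tendsto_sqrt_atTop))
  have h2 : (fun L : ℝ => L ^ 4) =o[atTop] Real.exp := Real.isLittleO_pow_exp_atTop
  filter_upwards [eventually_ge_atTop 16, h1.bound (show 0 < 0.05 * c by positivity),
    h2.bound (show (0 : ℝ) < 1 / 192 by norm_num), hw.eventually_ge_atTop x₀,
    (hw.const_mul_atTop hα).eventually_ge_atTop (2 * Real.log 4)] with L a b c d e
  refine ⟨a, ?_, ?_, d, e⟩
  · rw [Real.norm_of_nonneg (Real.sqrt_nonneg L)] at b
    linarith [Real.le_norm_self (40 + 14 * Real.log L)]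
  · rw [Real.norm_of_nonneg (Real.exp_pos L).le] at c
    linarith [Real.le_norm_self (L ^ 4)]

end Threshold

end CRTSets

theorem theorem4 :
    ∃ C : ℕ → ℝ, (∀ n, 0 < C n) ∧
      ∀ α x₀ : ℝ, 0 < α → 2 ≤ x₀ →
        ∃ X : ℝ, ∀ n : ℕ, 1 ≤ n → ∀ A : CRTSets.LocalSets n, CRTSets.ManyPrimes A α x₀ →
          ∀ x : ℝ, X ≤ x →
          ∀ δ : ℝ, 0 < δ → 1 / Real.log (Real.log x) ≤ δ → δ ≤ 1 / Real.exp 1 →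
            (∑ p ∈ CRTSets.primeModuli A x,
                1 / (p : ℝ) * ((CRTSets.lam A p : ℝ) / (CRTSets.rho A p : ℝ))
              ≤ δ * ∑ p ∈ CRTSets.primeModuli A x, 1 / (p : ℝ)) →
            ∀ k : ℕ, 2 ≤ k → (k : ℝ) ≤ α * δ * Real.log (Real.log x) →
              (CRTSets.moduliWith A k x).Nonempty ∧
              1 / ((CRTSets.moduliWith A k x).card : ℝ) *
                  ∑ q ∈ CRTSets.moduliWith A k x, CRTSets.disc (CRTSets.Delta A q)
                ≤ C n * (1 / α) * δ ^ (((k : ℝ) - 1) / 10) := by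
  refine ⟨fun n => 2 * (3 * n + 1) + 801 * (5 + 6 * n) ^ n, fun n => by positivity, ?_⟩
  intro α x₀ hα hx₀
  obtain ⟨c, hc, X₁, hX₁⟩ := CRTSets.exists_loglog_le_sum_inv (x₀ := x₀) hα
  obtain ⟨X₂, hX₂⟩ := Filter.eventually_atTop.1 ((Real.tendsto_log_atTop.comp
    Real.tendsto_log_atTop).eventually (CRTSets.eventually_asymptotic_conditions (x₀ := x₀) hα hc))
  -- Chosen before n, A, δ and k. The 3 keeps log x positive, so that x = exp(exp L) with L = log
  -- log x.
  refine ⟨max (max X₁ X₂) 3, ?_⟩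
  intro n _ A hA x hx δ hδ0 hδL hδe hlam k hk hkα
  obtain ⟨hL, hLc, hLe, hx₀L, hαL⟩ :=
    hX₂ x (((le_max_right _ _).trans (le_max_left _ _)).trans hx)
  have hP := hX₁ n A hA x (((le_max_left _ _).trans (le_max_left _ _)).trans hx)
  have hx1 : 1 < x := lt_of_lt_of_le (by norm_num) ((le_max_right _ _).trans hx)
  simp only [Function.comp_apply] at *
  have hxL : x = Real.exp (Real.exp (Real.log (Real.log x))) := by
    rw [Real.exp_log (Real.log_pos hx1), Real.exp_log (by linarith)]
  have hθ10 : (δ ^ (1 / 10 : ℝ)) ^ 10 = δ := by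
    rw [← Real.rpow_natCast, ← Real.rpow_mul hδ0.le]
    norm_num
  have hθk : (δ ^ (1 / 10 : ℝ)) ^ (k - 1) = δ ^ (((k : ℝ) - 1) / 10) := by
    rw [← Real.rpow_natCast, ← Real.rpow_mul hδ0.le, Nat.cast_sub (by omega)]
    congr 1
    push_cast
    ring
  have h := CRTSets.average_disc_le A (θ := δ ^ (1 / 10 : ℝ)) (x := x) (k := k) hα hA hx₀ hc hxL
    hL hLc hLe hx₀L hαL hP (Real.rpow_pos_of_pos hδ0 _) (by rwa [hθ10]) (by rwa [hθ10])
    (by rwa [hθ10]) hk (by rwa [hθ10])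
  rwa [hθk] at h
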